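/- Let $(X,\omega)$ be a compact Kähler manifold of dimension $n$ and let $(E,D)$ be a smooth complex vector bundle over $X$ with a non-Hermitian Yang–Mills connection, that is, a connection $D$ whose curvature satisfies $F_D=D^2\in\Omega^{1,1}(\mathrm{End}\,E)$ and $\sqrt{-1}\Lambda_\omega F_D=\lambda\,\mathrm{Id}_E$ for a constant $\lambda\in\mathbb R$, where $\Lambda_\omega$ is contraction with $\omega$. For a smooth Hermitian metric $H$ on $E$ write $D=D_H+\psi_H$ with $D_H$ preserving $H$ and $\psi_H\in\Omega^1(\mathrm{End}\,E)$ self-adjoint with respect to $H$, and let $G_H=(\bar\partial_H+\psi_H^{1,0})^2$, where $\bar\partial_H$ is the $(0,1)$-part of $D_H$ and $\psi_H^{1,0}$ is the $(1,0)$-part of $\psi_H$. For Hermitian metrics $K,L$ put $$\mathcal M(K,L)=\int_0^1\int_X\mathrm{tr}\Big(-4\sqrt{-1}\,\Lambda_\omega G_{H(t)}\cdot H(t)^{-1}\frac{\partial H(t)}{\partial t}\Big)\frac{\omega^n}{n!}\,dt,$$ where $H(t)$, $t\in[0,1]$, is any smooth path of Hermitian metrics from $H(0)=K$ to $H(1)=L$.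 Let $K,L$ be Hermitian metrics on $E$ and let $s$ be a smooth $K$-self-adjoint endomorphism of $E$ with $L=Ke^{s}$, i.e. $L(u,v)=K(e^{s}u,v)$. Then all the integrals below converge and, for every choice of the path in the definition of $\mathcal M(K,L)$, $$\mathcal M(K,L)=\int_X\mathrm{tr}\big((-4\sqrt{-1}\,\Lambda_\omega G_K)\,s\big)\frac{\omega^n}{n!}+\int_X\langle\Psi(s)(Ds),Ds\rangle_K\,\frac{\omega^n}{n!}.$$ Here $\Psi(x,y)=\dfrac{e^{y-x}-(y-x)-1}{(y-x)^2}$ for $x\ne y$ and $\Psi(x,x)=\tfrac12$. If $e_1,\dots,e_r$ is a $K$-orthonormal basis of a fibre with $s e_i=\lambda_i e_i$, and $A e_i=\sum_j A_i^j e_j$, then $\Psi(s)(A)e_i=\sum_j\Psi(\lambda_i,\lambda_j)A_i^j e_j$. The pairing $\langle\cdot,\cdot\rangle_K$ on $\mathrm{End}(E)$-valued $1$-forms is the one induced by $K$ and the Kähler metric $\omega(\cdot,J\cdot)$. -/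

import Mathlib

open Bundle Set MeasureTheory Module
open scoped Manifold ContDiff Topology

namespace NHYM

/-! ## Linear algebra on a single vector space -/

section LinearAlgebra

/-- An orthonormal basis for an inner product given on a bare finite-dimensional vector space. -/
noncomputable def onBasis {𝕜 W : Type*} [RCLike 𝕜] [AddCommGroup W] [Module 𝕜 W]
    [FiniteDimensional 𝕜 W] (c : InnerProductSpace.Core 𝕜 W) :
    Basis (Fin (finrank 𝕜 W)) 𝕜 W :=
  letI : NormedAddCommGroup W := c.toNormedAddCommGroup
  letI : InnerProductSpace 𝕜 W := InnerProductSpace.ofCore c.toCore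
  (stdOrthonormalBasis 𝕜 W).toBasis

theorem onBasis_inner {𝕜 W : Type*} [RCLike 𝕜] [AddCommGroup W] [Module 𝕜 W]
    [FiniteDimensional 𝕜 W] (c : InnerProductSpace.Core 𝕜 W) (i j : Fin (finrank 𝕜 W)) :
    c.inner (onBasis c i) (onBasis c j) = if i = j then 1 else 0 := by
  let _ : NormedAddCommGroup W := c.toNormedAddCommGroup
  let _ : InnerProductSpace 𝕜 W := InnerProductSpace.ofCore c.toCore
  have h := orthonormal_iff_ite.mp (stdOrthonormalBasis 𝕜 W).orthonormal i j
  have e : onBasis c = (stdOrthonormalBasis 𝕜 W).toBasis := rfl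
  rw [e]
  simp only [OrthonormalBasis.coe_toBasis]
  exact h

/-- `Ψ(x,y) = (e^{y-x} - (y-x) - 1) / (y-x)²`, extended by its limit `1/2` to the diagonal. -/
noncomputable def Psi (x y : ℝ) : ℝ :=
  if x = y then 1 / 2 else (Real.exp (y - x) - (y - x) - 1) / (y - x) ^ 2

variable {W : Type*} [AddCommGroup W] [Module ℂ W]

open Classical in
/-- The set of eigenvalues of an endomorphism of a finite-dimensional space. -/
noncomputable def eigenvalueSet (A : Module.End ℂ W) : Finset ℂ :=
  (minpoly ℂ A).roots.toFinset

open Classical in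
/-- For a diagonalizable endomorphism `A` with eigenvalue `c`: the projection onto the eigenspace
of `c` along the other eigenspaces, written as a Lagrange polynomial in `A`. -/
noncomputable def eigenProj (A : Module.End ℂ W) (c : ℂ) : Module.End ℂ W :=
  Polynomial.aeval A (Lagrange.basis (eigenvalueSet A) id c)

/-- The endomorphism `Φ(A)(B)` for a function `Φ` of two real variables, a diagonalizable
endomorphism `A` with real eigenvalues and an arbitrary endomorphism `B`. If `A eᵢ = lᵢ eᵢ` for a
basis `e` and `B eᵢ = ∑ⱼ Bᵢʲ eⱼ`, then `Φ(A)(B) eᵢ = ∑ⱼ Φ(lᵢ, lⱼ) Bᵢʲ eⱼ`. -/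
noncomputable def applyTwoVar (Φ : ℝ → ℝ → ℝ) (A B : Module.End ℂ W) : Module.End ℂ W :=
  ∑ l ∈ eigenvalueSet A, ∑ m ∈ eigenvalueSet A,
    (Φ l.re m.re : ℂ) • (eigenProj A m * B * eigenProj A l)

/-- The `(0,1)`-part `½(T + √-1 T ∘ J)` of a map `T` with values in a complex vector space, defined
on a real vector space with complex structure `J`. -/
noncomputable def part01 {U : Type*} (J : U → U) (T : U → W) (u : U) : W :=
  (1 / 2 : ℂ) • (T u + Complex.I • T (J u))

/-- The `(1,0)`-part `½(T - √-1 T ∘ J)`. -/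
noncomputable def part10 {U : Type*} (J : U → U) (T : U → W) (u : U) : W :=
  (1 / 2 : ℂ) • (T u - Complex.I • T (J u))

end LinearAlgebra

/-! ## Complex manifolds and Kähler forms -/

section Manifold

variable (E : Type*) [NormedAddCommGroup E] [NormedSpace ℂ E]
  {X : Type*} [TopologicalSpace X] [ChartedSpace E X]

/-- The smooth manifold underlying a complex manifold. -/
instance isManifold_real [IsManifold 𝓘(ℂ, E) ω X] : IsManifold 𝓘(ℝ, E) ∞ X := by
  apply isManifold_of_contDiffOn
  intro e e' he he'
  have h := HasGroupoid.compatible (G := contDiffGroupoid ω 𝓘(ℂ, E)) he he'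
  rw [contDiffGroupoid, mem_groupoid_of_pregroupoid] at h
  exact (ContDiffOn.restrict_scalars ℝ h.1).of_le le_top

/-- The complex structure `J` on the tangent spaces of a complex manifold. -/
noncomputable def J (x : X) : TangentSpace 𝓘(ℝ, E) x →ₗ[ℝ] TangentSpace 𝓘(ℝ, E) x :=
  (Complex.I • (LinearMap.id : E →ₗ[ℝ] E) : E →ₗ[ℝ] E)

theorem J_J (x : X) (u : TangentSpace 𝓘(ℝ, E) x) : J E x (J E x u) = -u := by
  have h (e : E) : Complex.I • Complex.I • e = -e := by
    rw [smul_smul, Complex.I_mul_I, neg_one_smul]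
  exact h u

variable [IsManifold 𝓘(ℂ, E) ω X]

/-- The coordinate vector field of the chart around `x₀` in the direction `u` (zero outside the
domain of the chart). -/
noncomputable def coordField (x₀ : X) (u : E) (y : X) : TangentSpace 𝓘(ℝ, E) y :=
  (trivializationAt E (TangentSpace 𝓘(ℝ, E)) x₀).symm y u

variable (X) in
/-- A Kähler form: a smooth closed real `2`-form, invariant under `J`, with `κ(u, J u) > 0`. -/
structure KahlerForm where
  toFun (x : X) : TangentSpace 𝓘(ℝ, E) x →L[ℝ] TangentSpace 𝓘(ℝ, E) x →L[ℝ] ℝ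
  alternating (x : X) (u : TangentSpace 𝓘(ℝ, E) x) : toFun x u u = 0
  invariant (x : X) (u w : TangentSpace 𝓘(ℝ, E) x) : toFun x (J E x u) (J E x w) = toFun x u w
  positive (x : X) (u : TangentSpace 𝓘(ℝ, E) x) (hu : u ≠ 0) : 0 < toFun x u (J E x u)
  smooth : ContMDiff 𝓘(ℝ, E) (𝓘(ℝ, E).prod 𝓘(ℝ, E →L[ℝ] E →L[ℝ] ℝ)) ∞
    (fun x ↦ TotalSpace.mk' (E →L[ℝ] E →L[ℝ] ℝ) x (toFun x))
  /-- `dκ = 0`, written on the coordinate vector fields of every chart. -/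
  closed (x₀ y : X) (hy : y ∈ (chartAt E x₀).source) (u v w : E) :
    mvfderiv 𝓘(ℝ, E) (fun z ↦ toFun z (coordField E x₀ v z) (coordField E x₀ w z)) y
        (coordField E x₀ u y)
      + mvfderiv 𝓘(ℝ, E) (fun z ↦ toFun z (coordField E x₀ w z) (coordField E x₀ u z)) y
        (coordField E x₀ v y)
      + mvfderiv 𝓘(ℝ, E) (fun z ↦ toFun z (coordField E x₀ u z) (coordField E x₀ v z)) y
        (coordField E x₀ w y) = 0

namespace KahlerForm

variable {E} (κ : KahlerForm E X)

theorem skew (x : X) (u w : TangentSpace 𝓘(ℝ, E) x) : κ.toFun x u w = -κ.toFun x w u := by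
  have h := κ.alternating x (u + w)
  simp only [map_add, add_apply, κ.alternating] at h
  linarith

/-- The Kähler metric `g(u,w) = κ(u, J w)`. -/
@[reducible]
noncomputable def metric (x : X) : InnerProductSpace.Core ℝ (TangentSpace 𝓘(ℝ, E) x) where
  inner u w := κ.toFun x u (J E x w)
  conj_inner_symm u w := by
    have h := κ.invariant x w (J E x u)
    rw [J_J, map_neg, κ.skew x _ u, neg_neg] at h
    simpa using h.symm
  re_inner_nonneg u := by
    by_cases hu : u = 0
    · simp [hu]
    · simpa using (κ.positive x u hu).le
  add_left u v w := by simp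
  smul_left u v r := by simp
  definite u hu := by
    by_contra h
    exact absurd hu (κ.positive x u h).ne'

variable [FiniteDimensional ℂ E]

instance finiteDimensional_tangent (x : X) : FiniteDimensional ℝ (TangentSpace 𝓘(ℝ, E) x) :=
  (inferInstance : FiniteDimensional ℝ E)

/-- A real orthonormal basis of `T_x X` for the Kähler metric. -/
noncomputable def frame (x : X) :
    Basis (Fin (finrank ℝ (TangentSpace 𝓘(ℝ, E) x))) ℝ (TangentSpace 𝓘(ℝ, E) x) :=
  onBasis (κ.metric x)

/-- The contraction `Λ η = ⟨η, κ⟩ = ½ ∑_{a,b} κ(e_a, e_b) η(e_a, e_b)` of a vector-valued `2`-form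
at `x` with the Kähler form, over an orthonormal basis `e` of `T_x X`; on `2`-forms this is the
adjoint of `f ↦ f κ`. -/
noncomputable def contract {W : Type*} [AddCommGroup W] [Module ℂ W] (x : X)
    (η : TangentSpace 𝓘(ℝ, E) x → TangentSpace 𝓘(ℝ, E) x → W) : W :=
  (1 / 2 : ℂ) • ∑ a, ∑ b, (κ.toFun x (κ.frame x a) (κ.frame x b) : ℂ) •
    η (κ.frame x a) (κ.frame x b)

/-- The function `det (h_{jk})` in the chart around `x₀`, where
`h_{jk} = g(∂_j, ∂_k) - √-1 κ(∂_j, ∂_k)` for the coordinate fields of a complex basis of `E`;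
thus `κ = (√-1/2) ∑ h_{jk} dz_j ∧ dz̄_k`, and `κⁿ/n!` is `det (h_{jk})` times Lebesgue measure
`dx₁ dy₁ ⋯ dxₙ dyₙ`. -/
noncomputable def volumeDensity (x₀ y : X) : ℝ :=
  (Matrix.det (Matrix.of fun j k : Fin (finrank ℂ E) ↦
    ((κ.toFun y (coordField E x₀ (finBasis ℂ E j) y)
        (J E y (coordField E x₀ (finBasis ℂ E k) y)) : ℂ)
      - Complex.I * (κ.toFun y (coordField E x₀ (finBasis ℂ E j) y)
        (coordField E x₀ (finBasis ℂ E k) y) : ℂ)))).re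

variable (E) in
/-- Lebesgue measure `dx₁ dy₁ ⋯ dxₙ dyₙ` for the complex basis of `E` used above. -/
noncomputable def lebesgue [MeasurableSpace E] [BorelSpace E] : Measure E :=
  (Complex.basisOneI.smulTower (finBasis ℂ E)).addHaar

variable [MeasurableSpace E] [BorelSpace E] [MeasurableSpace X]

/-- The measure `κⁿ/n!` restricted to the domain of the chart around `x₀`. -/
noncomputable def chartMeasure (x₀ : X) : Measure X :=
  (((lebesgue E).restrict (chartAt E x₀).target).withDensity
    (fun p ↦ ENNReal.ofReal (κ.volumeDensity x₀ ((chartAt E x₀).symm p)))).map (chartAt E x₀).symm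

/-- The measure `κⁿ/n!` on `X`. The measures in the charts agree on overlaps, and their supremum
is the measure which restricts to each of them on the domain of the chart. -/
noncomputable def vol : Measure X := ⨆ x₀ : X, κ.chartMeasure x₀

end KahlerForm

end Manifold

/-! ## Complex vector bundles, connections and Hermitian metrics -/

section VectorBundle

variable {E : Type*} [NormedAddCommGroup E] [NormedSpace ℂ E]
  {X : Type*} [TopologicalSpace X] [ChartedSpace E X]
  (F : Type*) [NormedAddCommGroup F] [NormedSpace ℂ F]
  {V : X → Type*} [TopologicalSpace (TotalSpace F V)] [∀ x, AddCommGroup (V x)]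
  [∀ x, Module ℂ (V x)] [∀ x, TopologicalSpace (V x)]
  [FiberBundle F V]

/-- The real vector bundle underlying a complex vector bundle. -/
instance vectorBundle_real [VectorBundle ℂ F V] : VectorBundle ℝ F V where
  trivialization_linear' e _ :=
    ⟨fun b hb ↦ ⟨(Trivialization.linear ℂ e hb).map_add, fun c v ↦ by
      have := (Trivialization.linear ℂ e hb).map_smul (c : ℂ) v
      simpa using this⟩⟩
  continuousOn_coordChange' e e' _ _ := by
    have h := (ContinuousLinearMap.restrictScalarsL ℂ F F ℝ ℝ).continuous.comp_continuousOn
      (continuousOn_coordChange ℂ e e')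
    have : e.IsLinear ℝ := ⟨fun b hb ↦ ⟨(Trivialization.linear ℂ e hb).map_add, fun c v ↦ by
      have := (Trivialization.linear ℂ e hb).map_smul (c : ℂ) v
      simpa using this⟩⟩
    have : e'.IsLinear ℝ := ⟨fun b hb ↦ ⟨(Trivialization.linear ℂ e' hb).map_add, fun c v ↦ by
      have := (Trivialization.linear ℂ e' hb).map_smul (c : ℂ) v
      simpa using this⟩⟩
    refine h.congr fun b hb ↦ ?_
    ext v
    exact (Trivialization.coordChangeL_apply e e' hb v).trans
      (Trivialization.coordChangeL_apply (R := ℂ) e e' hb v).symm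

theorem finiteDimensional_fiber [FiniteDimensional ℂ F] [VectorBundle ℂ F V] (x : X) :
    FiniteDimensional ℂ (V x) := by
  have e := (trivializationAt F V x).continuousLinearEquivAt ℂ x
    (FiberBundle.mem_baseSet_trivializationAt' x)
  exact FiniteDimensional.of_injective e.toLinearMap e.injective

/-- Smooth sections of a vector bundle. -/
def IsSmooth (E : Type*) [NormedAddCommGroup E] [NormedSpace ℂ E] {X : Type*} [TopologicalSpace X]
    [ChartedSpace E X] (F : Type*) [NormedAddCommGroup F] [NormedSpace ℂ F]
    {V : X → Type*} [TopologicalSpace (TotalSpace F V)] [∀ x, TopologicalSpace (V x)]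
    [FiberBundle F V] (σ : ∀ x, V x) : Prop :=
  ContMDiff 𝓘(ℝ, E) (𝓘(ℝ, E).prod 𝓘(ℝ, F)) ∞ (fun x ↦ TotalSpace.mk' F x (σ x))

variable (E) in
/-- Smooth endomorphisms of the vector bundle. -/
def IsSmoothEnd (s : ∀ x, Module.End ℂ (V x)) : Prop :=
  ∀ σ : ∀ x, V x, IsSmooth E F σ → IsSmooth E F (fun x ↦ s x (σ x))

variable (E V) in
/-- A smooth Hermitian metric on a complex vector bundle (antilinear in the first variable). -/
structure HermitianMetric where
  toFun (x : X) : V x →ₗ⋆[ℂ] V x →ₗ[ℂ] ℂ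
  conj_symm (x : X) (u w : V x) : starRingEnd ℂ (toFun x w u) = toFun x u w
  positive (x : X) (u : V x) (hu : u ≠ 0) : 0 < (toFun x u u).re
  smooth (σ τ : ∀ x, V x) (hσ : IsSmooth E F σ) (hτ : IsSmooth E F τ) :
    ContMDiff 𝓘(ℝ, E) 𝓘(ℝ, ℂ) ∞ (fun x ↦ toFun x (σ x) (τ x))

section Endomorphism

variable (E) in
/-- The endomorphism of the fibre at `x` induced by an operator `P` on smooth sections for which
`P σ` depends only on `σ x`. -/
noncomputable def endOf (x : X) (P : (∀ y, V y) → V x) : Module.End ℂ (V x) :=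
  Classical.epsilon fun A ↦ ∀ σ : ∀ y, V y, IsSmooth E F σ → A (σ x) = P σ

end Endomorphism

theorem contMDiff_mul_complex {E' H' M : Type*} [NormedAddCommGroup E'] [NormedSpace ℝ E']
    [TopologicalSpace H'] {I : ModelWithCorners ℝ E' H'} [TopologicalSpace M] [ChartedSpace H' M]
    {f g : M → ℂ} (hf : ContMDiff I 𝓘(ℝ, ℂ) ∞ f) (hg : ContMDiff I 𝓘(ℝ, ℂ) ∞ g) :
    ContMDiff I 𝓘(ℝ, ℂ) ∞ (fun x ↦ f x * g x) :=
  (contDiff_mul (𝕜 := ℝ) (𝔸 := ℂ)).contMDiff.comp (hf.prodMk_space hg)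

namespace HermitianMetric

variable {F} (H : HermitianMetric E F V)

/-- The metric as an inner product on the fibre. -/
@[reducible]
noncomputable def core (x : X) : InnerProductSpace.Core ℂ (V x) where
  inner u w := H.toFun x u w
  conj_inner_symm u w := H.conj_symm x u w
  re_inner_nonneg u := by
    by_cases hu : u = 0
    · simp [hu]
    · simpa using (H.positive x u hu).le
  add_left u v w := by simp
  smul_left u v r := by simp
  definite u hu := by
    by_contra h
    have := H.positive x u h
    rw [hu] at this
    simp at this

/-- `A` is self-adjoint with respect to the metric at `x`. -/
def IsSelfAdjointAt (x : X) (A : Module.End ℂ (V x)) : Prop :=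
  ∀ u w, H.toFun x (A u) w = H.toFun x u (A w)

/-- The endomorphism `H⁻¹ B` for a sesquilinear form `B` on the fibre: `B(u,w) = H(u, H⁻¹B w)`. -/
noncomputable def inverseMul (x : X) (B : V x → V x → ℂ) : Module.End ℂ (V x) :=
  Classical.epsilon fun A ↦ ∀ u w, H.toFun x u (A w) = B u w

/-- The metric `(1 - t) H + t H'`. -/
noncomputable def segment (H' : HermitianMetric E F V) (t : Icc (0 : ℝ) 1) :
    HermitianMetric E F V where
  toFun x := (1 - (t : ℝ) : ℂ) • H.toFun x + ((t : ℝ) : ℂ) • H'.toFun x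
  conj_symm x u w := by
    simp [H.conj_symm x u w, H'.conj_symm x u w]
  positive x u hu := by
    have h1 := H.positive x u hu
    have h2 := H'.positive x u hu
    have h0 := t.2.1
    have h3 := t.2.2
    simp only [LinearMap.add_apply, LinearMap.smul_apply, smul_eq_mul, Complex.add_re,
      Complex.mul_re, Complex.sub_re, Complex.sub_im, Complex.one_re, Complex.one_im,
      Complex.ofReal_re, Complex.ofReal_im]
    rcases h0.eq_or_lt with h | h
    · rw [← h]; simpa using h1
    · nlinarith [mul_pos h h2, mul_nonneg (sub_nonneg.2 h3) h1.le]
  smooth σ τ hσ hτ := by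
    have hK := contMDiff_mul_complex (contMDiff_const (c := (1 - (t : ℝ) : ℂ)))
      (H.smooth σ τ hσ hτ)
    have hL := contMDiff_mul_complex (contMDiff_const (c := ((t : ℝ) : ℂ))) (H'.smooth σ τ hσ hτ)
    exact hK.add hL

end HermitianMetric

variable {F}
variable (K L : HermitianMetric E F V)

/-- A smooth path of Hermitian metrics from `K` to `L`, parametrized by `[0,1]`. -/
structure MetricPath where
  toFun : ℝ → HermitianMetric E F V
  source : toFun 0 = K
  target : toFun 1 = L
  smooth (σ τ : ∀ x, V x) (hσ : IsSmooth E F σ) (hτ : IsSmooth E F τ) :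
    ContMDiffOn (𝓘(ℝ, ℝ).prod 𝓘(ℝ, E)) 𝓘(ℝ, ℂ) ∞
      (fun p : ℝ × X ↦ (toFun p.1).toFun p.2 (σ p.2) (τ p.2)) (Icc 0 1 ×ˢ univ)

/-- Any two metrics are joined by a smooth path, namely by the segment between them. -/
theorem MetricPath.nonempty (K L : HermitianMetric E F V) : Nonempty (MetricPath K L) := by
  refine ⟨⟨fun t ↦ K.segment L (projIcc 0 1 zero_le_one t), ?_, ?_, ?_⟩⟩
  · cases K
    simp [HermitianMetric.segment]
  · cases L
    simp [HermitianMetric.segment]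
  · intro σ τ hσ hτ
    have h1 : ContMDiff (𝓘(ℝ, ℝ).prod 𝓘(ℝ, E)) 𝓘(ℝ, ℂ) ∞ (fun p : ℝ × X ↦ (p.1 : ℂ)) :=
      (Complex.ofRealCLM.contMDiff).comp contMDiff_fst
    have hK := (K.smooth σ τ hσ hτ).comp
      (contMDiff_snd (I := 𝓘(ℝ, ℝ)) (J := 𝓘(ℝ, E)) (M := ℝ) (N := X))
    have hL := (L.smooth σ τ hσ hτ).comp
      (contMDiff_snd (I := 𝓘(ℝ, ℝ)) (J := 𝓘(ℝ, E)) (M := ℝ) (N := X))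
    refine ContMDiffOn.congr
      ((contMDiff_mul_complex ((contMDiff_const (c := (1 : ℂ))).sub h1) hK).add
        (contMDiff_mul_complex h1 hL)).contMDiffOn ?_
    rintro ⟨t, x⟩ ht
    simp [HermitianMetric.segment, projIcc_of_mem zero_le_one ht.1]

end VectorBundle

/-! ## Connections and curvature -/

section Connection

variable {E : Type*} [NormedAddCommGroup E] [NormedSpace ℂ E]
  {X : Type*} [TopologicalSpace X] [ChartedSpace E X] [IsManifold 𝓘(ℂ, E) ω X]
  {F : Type*} [NormedAddCommGroup F] [NormedSpace ℂ F]
  {V : X → Type*} [TopologicalSpace (TotalSpace F V)] [∀ x, AddCommGroup (V x)]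
  [∀ x, Module ℂ (V x)] [∀ x, TopologicalSpace (V x)]
  [∀ x, IsTopologicalAddGroup (V x)] [∀ x, ContinuousSMul ℝ (V x)]
  [FiberBundle F V] [VectorBundle ℂ F V]

variable (E F V) in
/-- A smooth connection `D` on a complex vector bundle; `D σ x v` is `(D_v σ)(x)`. -/
structure Connection extends CovariantDerivative 𝓘(ℝ, E) F V where
  smooth : ContMDiffCovariantDerivativeOn F ∞ toFun univ
  complex_linear (σ : ∀ x, V x) (hσ : IsSmooth E F σ) (x : X) (v : TangentSpace 𝓘(ℝ, E) x) :
    toFun (fun y ↦ Complex.I • σ y) x v = Complex.I • toFun σ x v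

/-- The square of an operator `P : Γ(V) → Ω¹(V)`, extended to `Ω¹(V) → Ω²(V)` by
`P (α ⊗ σ) = dα ⊗ σ - α ∧ P σ` for a connection `P` (and with `∂̄ α` in place of `dα` for an operator
with `P (f σ) = ∂̄f ⊗ σ + f P σ`), evaluated at `x` on the tangent vectors `u`, `w`. The vectors are
extended to the coordinate fields of the holomorphic chart at `x`; these commute and are constant
in the coordinates, so `(P (P σ))(u, w) = P_u (P_w σ) - P_w (P_u σ)`. -/
noncomputable def square (P : (∀ x, V x) → ∀ x : X, TangentSpace 𝓘(ℝ, E) x → V x)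
    (σ : ∀ x, V x) (x : X) (u w : TangentSpace 𝓘(ℝ, E) x) : V x :=
  P (fun y ↦ P σ y (coordField E x w y)) x u - P (fun y ↦ P σ y (coordField E x u y)) x w

namespace Connection

variable (D : Connection E F V)

/-- The curvature `F_D = D²`, an endomorphism-valued `2`-form. -/
noncomputable def curvature (x : X) (u w : TangentSpace 𝓘(ℝ, E) x) : Module.End ℂ (V x) :=
  endOf E F x fun σ ↦ square (fun τ y v ↦ D.toFun τ y v) σ x u w

/-- The derivative `D s` of an endomorphism `s`, an endomorphism-valued `1`-form. -/
noncomputable def endDeriv (s : ∀ x, Module.End ℂ (V x)) (x : X)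
    (v : TangentSpace 𝓘(ℝ, E) x) : Module.End ℂ (V x) :=
  endOf E F x fun σ ↦ D.toFun (fun y ↦ s y (σ y)) x v - s x (D.toFun σ x v)

/-- `D` is non-Hermitian Yang-Mills: `F_D` is of type `(1,1)` and `√-1 Λ F_D = λ Id` for a real
constant `λ`. -/
structure IsNHYM [FiniteDimensional ℂ E] (κ : KahlerForm E X) : Prop where
  type11 (x : X) (u w : TangentSpace 𝓘(ℝ, E) x) :
    D.curvature x (J E x u) (J E x w) = D.curvature x u w
  yang_mills : ∃ c : ℝ, ∀ x, Complex.I • κ.contract x (D.curvature x) = (c : ℂ) • 1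

variable (H : HermitianMetric E F V)

/-- The `H`-self-adjoint endomorphism-valued `1`-form `ψ_H` in the unique decomposition
`D = D_H + ψ_H` with `D_H` preserving `H`, that is,
`d(H(σ,τ)) = H(D_H σ, τ) + H(σ, D_H τ)`. -/
noncomputable def psi (x : X) (v : TangentSpace 𝓘(ℝ, E) x) : Module.End ℂ (V x) :=
  Classical.epsilon fun A ↦ H.IsSelfAdjointAt x A ∧
    ∀ σ τ : ∀ y, V y, IsSmooth E F σ → IsSmooth E F τ →
      mvfderiv 𝓘(ℝ, E) (fun y ↦ H.toFun y (σ y) (τ y)) x v =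
        H.toFun x (D.toFun σ x v - A (σ x)) (τ x) + H.toFun x (σ x) (D.toFun τ x v - A (τ x))

/-- The unitary connection `D_H = D - ψ_H`. -/
noncomputable def unitary (σ : ∀ x, V x) (x : X) (v : TangentSpace 𝓘(ℝ, E) x) : V x :=
  D.toFun σ x v - D.psi H x v (σ x)

/-- The operator `D''_H = ∂̄_H + ψ_H^{1,0}`. -/
noncomputable def dbar (σ : ∀ x, V x) (x : X) (v : TangentSpace 𝓘(ℝ, E) x) : V x :=
  part01 (J E x) (D.unitary H σ x) v + part10 (J E x) (D.psi H x) v (σ x)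

/-- The pseudo-curvature `G_H = (D''_H)²`, an endomorphism-valued `2`-form. -/
noncomputable def pseudoCurvature (x : X) (u w : TangentSpace 𝓘(ℝ, E) x) :
    Module.End ℂ (V x) :=
  endOf E F x fun σ ↦ square (D.dbar H) σ x u w

end Connection

/-! ## Donaldson's functional -/

variable {K L : HermitianMetric E F V}

/-- The endomorphism `H(t)⁻¹ ∂H(t)/∂t` along a path of metrics. -/
noncomputable def MetricPath.velocity (γ : MetricPath K L) (t : ℝ) (x : X) :
    Module.End ℂ (V x) :=
  (γ.toFun t).inverseMul x
    fun u w ↦ derivWithin (fun τ ↦ (γ.toFun τ).toFun x u w) (Icc 0 1) t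

variable [FiniteDimensional ℂ E] (κ : KahlerForm E X) (D : Connection E F V)

/-- The function `tr((-4√-1 Λ G_H) A)` for an endomorphism `A`. -/
noncomputable def curvatureTrace (H : HermitianMetric E F V) (A : ∀ x, Module.End ℂ (V x))
    (x : X) : ℂ :=
  LinearMap.trace ℂ (V x) (((-4 * Complex.I) • κ.contract x (D.pseudoCurvature H x)) * A x)

/-- Donaldson's functional
`∫₀¹ ∫_X tr(-4√-1 Λ G_{H(t)} H(t)⁻¹ ∂H(t)/∂t) κⁿ/n! dt` along a path of metrics. -/
noncomputable def donaldson [MeasurableSpace E] [BorelSpace E] [MeasurableSpace X]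
    (γ : MetricPath K L) : ℂ :=
  ∫ t in (0 : ℝ)..1, ∫ x, curvatureTrace κ D (γ.toFun t) (γ.velocity t) x ∂κ.vol

variable [FiniteDimensional ℂ F]

/-- The inner product `⟨A, B⟩_K = tr(A B^{*K})` on endomorphisms of the fibre at `x`, computed in a
`K`-orthonormal basis `f` as `∑ᵢ K(B fᵢ, A fᵢ)` (`K` is antilinear in the first variable). -/
noncomputable def endInner (K : HermitianMetric E F V) (x : X) (A B : Module.End ℂ (V x)) : ℂ :=
  haveI : FiniteDimensional ℂ (V x) := finiteDimensional_fiber F x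
  ∑ i, K.toFun x (B (onBasis (K.core x) i)) (A (onBasis (K.core x) i))

/-- The function `⟨Ψ(s)(D s), D s⟩_K`, for the inner product of endomorphism-valued `1`-forms given
by `K` and the Kähler metric. -/
noncomputable def psiEnergy (K : HermitianMetric E F V) (s : ∀ x, Module.End ℂ (V x))
    (x : X) : ℂ :=
  ∑ a, endInner K x (applyTwoVar Psi (s x) (D.endDeriv s x (κ.frame x a)))
    (D.endDeriv s x (κ.frame x a))

end Connection

end NHYM

namespace NHYM

set_option maxSynthPendingDepth 3
set_option linter.unusedSectionVars false

/-! ### Holomorphic charts and their coordinate fields -/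

section Coordinates

variable (E : Type*) [NormedAddCommGroup E] [NormedSpace ℂ E]
  {X : Type*} [TopologicalSpace X] [ChartedSpace E X]

/-! Put e_H = ∑ₐ tr(ψ_H(eₐ)²) over an orthonormal frame of the tangent space (`potentialEnergy`).
Donaldson's functional turns out to be the exact difference 2∫(e_L - e_K); after that the formula is
a pointwise identity of linear algebra, and independence of the path is automatic.

Curvature. Only the (1,1)-part of G_H contributes to ΛG_H, and it is a covariant derivative of ψ_H.
Since √-1ΛF_D is a real multiple of the identity, the H-self-adjoint part of ΛF_D vanishes; this
kills the trace of D_H ψ_H against J and leaves -4√-1ΛG_H = 2∑ₐ(D_{eₐ}ψ_H)(eₐ), the derivative being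
taken in holomorphic coordinates (`contract_pseudoCurvature`). For a Kähler metric the contracted
Christoffel symbols vanish in such coordinates, so ∑ₐ(∂_{eₐ}α)(eₐ) is the Riemannian divergence of a
1-form α (`kahler_divergence`) and integrates to zero (`KahlerForm.integral_divergence_eq_zero`).
Hence tr(-4√-1ΛG_H v) = 2 div tr(ψ_H v) - 2∑ₐtr(ψ_H(eₐ) D_{eₐ}v) (`curvatureTrace_eq`), and only the
last sum, `traceDeriv`, survives integration.

Variation. Along a path H(t) with v = H⁻¹∂ₜH one has ∂ₜψ = -½Dv - [v,ψ]
(`hasDerivWithinAt_selfAdjointForm`). The commutator drops out of tr ψ², so ∂ₜe =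
-∑ₐtr(ψ(eₐ)D_{eₐ}v): the integrand of the functional is 2∂ₜ∫e. Fubini and the fundamental theorem of
calculus give `donaldson_eq`.

Endpoints. Let L = Ke^s and q = -2ψ. Along the curve Ke^{ts} the velocity is s, and conjugation by
e^{ts} removes the commutator, so e^s q_L e^{-s} = q_K + φ(s)(Ds) with φ(x,y) = (e^{y-x}-1)/(y-x)
(`exp_conj_selfAdjointForm`). Squaring, taking traces, and using that the K-adjoint of Ds is Ds +
[q_K,s] together with Ψ(x,y)(y-x) = φ(x,y)-1 and Ψ(x,y)+Ψ(y,x) = φ(x,y)φ(y,x), one gets ⟨Ψ(s)Ds,Ds⟩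
= 2e_L - 2e_K + 2∑ₐtr(ψ_K(eₐ)D_{eₐ}s) (`psiEnergy_eq`). The last term integrates to minus the
curvature term of the formula.

The curvature, the derivative of an endomorphism and ψ are chosen fibrewise through their effect on
global smooth sections. A `LocalFrame` of global sections turns them into matrix-valued functions on
an open subset of E, with the metric an invertible self-adjoint matrix η, and the identities above
are proved there. -/

theorem J_apply (x : X) (u : E) : J E x u = (Complex.I • u : E) := rfl

variable [IsManifold 𝓘(ℂ, E) ω X]

/-- The transition map from the chart around `x₀` to the chart around `x₁`. -/
noncomputable def transition (x₀ x₁ : X) : E → E := chartAt E x₁ ∘ (chartAt E x₀).symm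

theorem contDiffAt_transition_complex (x₀ x₁ y : X) (h₀ : y ∈ (chartAt E x₀).source)
    (h₁ : y ∈ (chartAt E x₁).source) :
    ContDiffAt ℂ ω (transition E x₀ x₁) (chartAt E x₀ y) := by
  have h := HasGroupoid.compatible (G := contDiffGroupoid ω 𝓘(ℂ, E))
    (chart_mem_atlas E x₀) (chart_mem_atlas E x₁)
  rw [contDiffGroupoid, mem_groupoid_of_pregroupoid] at h
  have h' : ContDiffOn ℂ ω (transition E x₀ x₁)
      ((chartAt E x₀).symm.trans (chartAt E x₁)).source := by
    refine (h.1.mono ?_).congr ?_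
    · simp
    · intro x _; simp [transition]
  refine h'.contDiffAt (((chartAt E x₀).symm.trans (chartAt E x₁)).open_source.mem_nhds ?_)
  simp [h₀, h₁]

theorem contDiffAt_transition (x₀ x₁ y : X) (h₀ : y ∈ (chartAt E x₀).source)
    (h₁ : y ∈ (chartAt E x₁).source) :
    ContDiffAt ℝ ∞ (transition E x₀ x₁) (chartAt E x₀ y) :=
  ((contDiffAt_transition_complex E x₀ x₁ y h₀ h₁).restrict_scalars ℝ).of_le le_top

/-- Transition maps are holomorphic, and the real derivative of a holomorphic map is its complex
derivative. Everything special to holomorphic charts below comes from this. -/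
theorem fderiv_transition_complex (x₀ x₁ y : X) (h₀ : y ∈ (chartAt E x₀).source)
    (h₁ : y ∈ (chartAt E x₁).source) :
    fderiv ℝ (transition E x₀ x₁) (chartAt E x₀ y) =
      (fderiv ℂ (transition E x₀ x₁) (chartAt E x₀ y)).restrictScalars ℝ :=
  (((contDiffAt_transition_complex E x₀ x₁ y h₀ h₁).differentiableAt
    (by simp)).hasFDerivAt.restrictScalars ℝ).fderiv

theorem fderiv_transition_I_smul (x₀ x₁ y : X) (h₀ : y ∈ (chartAt E x₀).source)
    (h₁ : y ∈ (chartAt E x₁).source) (u : E) :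
    fderiv ℝ (transition E x₀ x₁) (chartAt E x₀ y) (Complex.I • u) =
      Complex.I • fderiv ℝ (transition E x₀ x₁) (chartAt E x₀ y) u := by
  rw [fderiv_transition_complex E x₀ x₁ y h₀ h₁]
  simp

/-- The tangent space at `y` is the model space read in the preferred chart at `y`, so a coordinate
field of another chart is seen there through the differential of the transition map. -/
theorem coordField_eq_fderiv (x₀ y : X) (h₀ : y ∈ (chartAt E x₀).source) (u : E) :
    coordField E x₀ u y = fderiv ℝ (transition E x₀ y) (chartAt E x₀ y) u := by
  have h : (trivializationAt E (TangentSpace 𝓘(ℝ, E)) x₀).symmL ℝ y = _ :=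
    TangentBundle.symmL_trivializationAt_eq_core h₀
  have h2 : coordField E x₀ u y =
    (trivializationAt E (TangentSpace 𝓘(ℝ, E)) x₀).symmL ℝ y u :=
    (Trivialization.symmL_apply _ h₀ u).symm
  rw [h2, h, tangentBundleCore_coordChange_achart]
  simp only [modelWithCornersSelf_coe, range_id, fderivWithin_univ]
  rfl

theorem coordField_self (x : X) (u : E) : coordField E x u x = u := by
  rw [coordField_eq_fderiv E x x (mem_chart_source E x)]
  have : transition E x x =ᶠ[𝓝 (chartAt E x x)] id := by
    filter_upwards [(chartAt E x).open_target.mem_nhds (mem_chart_target E x)] with p hp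
    simp [transition, (chartAt E x).right_inv hp]
  rw [this.fderiv_eq, fderiv_id]
  rfl

theorem J_coordField (x₀ y : X) (h₀ : y ∈ (chartAt E x₀).source) (u : E) :
    J E y (coordField E x₀ u y) = coordField E x₀ (Complex.I • u) y := by
  rw [coordField_eq_fderiv E x₀ y h₀, coordField_eq_fderiv E x₀ y h₀,
    fderiv_transition_I_smul E x₀ y y h₀ (mem_chart_source E y)]
  exact J_apply E y _

theorem fderiv_transition_comp (x₀ x₁ x₂ y : X) (h₀ : y ∈ (chartAt E x₀).source)
    (h₁ : y ∈ (chartAt E x₁).source) (h₂ : y ∈ (chartAt E x₂).source) :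
    fderiv ℝ (transition E x₀ x₂) (chartAt E x₀ y) =
      (fderiv ℝ (transition E x₁ x₂) (chartAt E x₁ y)).comp
        (fderiv ℝ (transition E x₀ x₁) (chartAt E x₀ y)) := by
  have hxy : transition E x₀ x₁ (chartAt E x₀ y) = chartAt E x₁ y := by
    simp [transition, (chartAt E x₀).left_inv h₀]
  have h : transition E x₀ x₂ =ᶠ[𝓝 (chartAt E x₀ y)]
      transition E x₁ x₂ ∘ transition E x₀ x₁ := by
    have := ((chartAt E x₀).symm.trans (chartAt E x₁)).open_source.mem_nhds
      (x := chartAt E x₀ y) (by simp [h₀, h₁])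
    filter_upwards [this] with p hp
    simp only [OpenPartialHomeomorph.trans_source, OpenPartialHomeomorph.symm_source,
      mem_inter_iff, mem_preimage] at hp
    simp [transition, (chartAt E x₁).left_inv hp.2]
  rw [h.fderiv_eq, fderiv_comp, hxy]
  · rw [hxy]
    exact (contDiffAt_transition E x₁ x₂ y h₁ h₂).differentiableAt (by simp)
  · exact (contDiffAt_transition E x₀ x₁ y h₀ h₁).differentiableAt (by simp)

theorem coordField_change (x₀ x₁ y : X) (h₀ : y ∈ (chartAt E x₀).source)
    (h₁ : y ∈ (chartAt E x₁).source) (u : E) :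
    coordField E x₀ u y =
      coordField E x₁ (fderiv ℝ (transition E x₀ x₁) (chartAt E x₀ y) u) y := by
  rw [coordField_eq_fderiv E x₀ y h₀, coordField_eq_fderiv E x₁ y h₁,
    fderiv_transition_comp E x₀ x₁ y y h₀ h₁ (mem_chart_source E y)]
  rfl

/-- The linear isomorphism from `E` to the tangent space at `y` given by the coordinate fields of
the chart around `x₀`. -/
noncomputable def coordEquiv (x₀ y : X) (h₀ : y ∈ (chartAt E x₀).source) :
    E ≃L[ℝ] TangentSpace 𝓘(ℝ, E) y :=
  ((trivializationAt E (TangentSpace 𝓘(ℝ, E)) x₀).continuousLinearEquivAt ℝ y h₀).symm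

theorem coordEquiv_apply (x₀ y : X) (h₀ : y ∈ (chartAt E x₀).source) (u : E) :
    coordEquiv E x₀ y h₀ u = coordField E x₀ u y :=
  rfl

theorem contMDiffOn_coordField (x₀ : X) (u : E) :
    ContMDiffOn 𝓘(ℝ, E) (𝓘(ℝ, E).prod 𝓘(ℝ, E)) ∞
      (fun y ↦ TotalSpace.mk' E y (coordField E x₀ u y)) (chartAt E x₀).source := by
  have h := (trivializationAt E (TangentSpace 𝓘(ℝ, E) : X → Type _) x₀).contMDiffOn_section_baseSet_iff
    (IB := 𝓘(ℝ, E)) (n := ∞) (s := fun y ↦ coordField E x₀ u y)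
  rw [TangentBundle.trivializationAt_baseSet] at h
  rw [h]
  refine contMDiffOn_const (c := u) |>.congr fun y hy ↦ ?_
  exact congrArg Prod.snd ((trivializationAt E (TangentSpace 𝓘(ℝ, E) : X → Type _) x₀).apply_mk_symm hy u)

theorem contMDiffAt_iff_contDiffAt_chart {W : Type*} [NormedAddCommGroup W] [NormedSpace ℝ W]
    {n : ℕ∞} {f : X → W} (x₀ y : X) (h₀ : y ∈ (chartAt E x₀).source) :
    ContMDiffAt 𝓘(ℝ, E) 𝓘(ℝ, W) n f y ↔
      ContDiffAt ℝ n (f ∘ (chartAt E x₀).symm) (chartAt E x₀ y) := by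
  have : IsManifold 𝓘(ℝ, E) n X := IsManifold.of_le (n := ∞) (by exact_mod_cast le_top)
  rw [contMDiffAt_iff_source_of_mem_source (x := x₀) h₀]
  simp only [mfld_simps]
  rw [contMDiffWithinAt_univ, contMDiffAt_iff_contDiffAt]

/-- The manifold derivative at `y` is computed in the chart at `y`; the chain rule moves it to a
fixed chart, so that derivatives at varying points can be compared. -/
theorem mvfderiv_coordField {W : Type*} [NormedAddCommGroup W] [NormedSpace ℝ W] {f : X → W}
    (x₀ y : X) (h₀ : y ∈ (chartAt E x₀).source) (u : E)
    (hf : MDifferentiableAt 𝓘(ℝ, E) 𝓘(ℝ, W) f y) :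
    mvfderiv 𝓘(ℝ, E) f y (coordField E x₀ u y) =
      fderiv ℝ (f ∘ (chartAt E x₀).symm) (chartAt E x₀ y) u := by
  have h1 : mvfderiv 𝓘(ℝ, E) f y (coordField E x₀ u y) =
      fderiv ℝ (f ∘ (chartAt E y).symm) (chartAt E y y) (coordField E x₀ u y) := by
    change mfderiv 𝓘(ℝ, E) 𝓘(ℝ, W) f y (coordField E x₀ u y) = _
    rw [hf.mfderiv]
    simp only [writtenInExtChartAt, mfld_simps, fderivWithin_univ]
    rfl
  rw [h1, coordField_eq_fderiv E x₀ y h₀]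
  have h2 : f ∘ (chartAt E x₀).symm =ᶠ[𝓝 (chartAt E x₀ y)]
      (f ∘ (chartAt E y).symm) ∘ transition E x₀ y := by
    have := ((chartAt E x₀).symm.trans (chartAt E y)).open_source.mem_nhds
      (x := chartAt E x₀ y) (by simp [h₀])
    filter_upwards [this] with p hp
    simp only [OpenPartialHomeomorph.trans_source, OpenPartialHomeomorph.symm_source,
      mem_inter_iff, mem_preimage] at hp
    simp [transition, (chartAt E y).left_inv hp.2]
  have hxy : transition E x₀ y (chartAt E x₀ y) = chartAt E y y := by
    simp [transition, (chartAt E x₀).left_inv h₀]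
  rw [h2.fderiv_eq, fderiv_comp (g := f ∘ (chartAt E y).symm), hxy]
  · rfl
  · rw [hxy]
    have := hf.differentiableWithinAt_writtenInExtChartAt
    simpa only [writtenInExtChartAt, mfld_simps, differentiableWithinAt_univ, chartAt_self_eq,
      Function.id_comp] using this
  · exact (contDiffAt_transition E x₀ y y h₀ (mem_chart_source E y)).differentiableAt (by simp)

end Coordinates

/-! ### Gram determinants -/

section Gram

variable {ι : Type*} [Fintype ι] [DecidableEq ι]

theorem det_updateRow_one (i : ι) (v : ι → ℝ) : ((1 : Matrix ι ι ℝ).updateRow i v).det = v i := by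
  rw [← Matrix.cramer_transpose_apply, Matrix.transpose_one, Matrix.cramer_one]
  rfl

/-- The derivative of the determinant at the identity matrix is the trace. -/
theorem hasFDerivAt_det_of_eq_one {W : Type*} [NormedAddCommGroup W] [NormedSpace ℝ W]
    {M : W → ι → ι → ℝ} {M' : W →L[ℝ] ι → ι → ℝ} {p : W} (hM : HasFDerivAt M M' p)
    (h1 : Matrix.of (M p) = 1) (L : W →L[ℝ] ℝ) (hL : ∀ v, L v = ∑ i, M' v i i) :
    HasFDerivAt (fun q ↦ (Matrix.of (M q)).det) L p := by
  -- The determinant is multilinear in the rows; its derivative replaces one row at a time, and at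
  -- the identity each such determinant is a diagonal entry.
  let f : ContinuousMultilinearMap ℝ (fun _ : ι ↦ ι → ℝ) ℝ :=
    ⟨(Matrix.detRowAlternating (R := ℝ) (n := ι)).toMultilinearMap, by
      change Continuous fun m : ι → ι → ℝ ↦ (Matrix.of m).det
      exact Continuous.matrix_det continuous_id⟩
  have h := (f.hasFDerivAt (x := M p)).comp p hM
  refine h.congr_fderiv ?_
  ext v
  rw [hL, ContinuousLinearMap.comp_apply, ContinuousMultilinearMap.linearDeriv_apply]
  refine Finset.sum_congr rfl fun i _ ↦ ?_
  have : f (Function.update (M p) i (M' v i)) = ((Matrix.of (M p)).updateRow i (M' v i)).det := rfl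
  rw [this, h1, det_updateRow_one]

variable {V : Type*} [AddCommGroup V] [Module ℝ V]

/-- The Gram matrix of a bilinear form. -/
def gram (b : ι → V) (g : V → V → ℝ) : Matrix ι ι ℝ := Matrix.of fun i j ↦ g (b i) (b j)

theorem gram_comp {b e : Basis ι ℝ V} (g : V →ₗ[ℝ] V →ₗ[ℝ] ℝ) (f : V →ₗ[ℝ] V) :
    gram b (fun u w ↦ g (f u) (f w)) =
      (LinearMap.toMatrix b e f).transpose * gram e (fun u w ↦ g u w) *
        LinearMap.toMatrix b e f := by
  ext i j
  simp only [gram, Matrix.of_apply, Matrix.mul_apply, Matrix.transpose_apply,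
    LinearMap.toMatrix_apply]
  conv_lhs => rw [← e.sum_repr (f (b i)), ← e.sum_repr (f (b j))]
  simp only [map_sum, map_smul, LinearMap.sum_apply, LinearMap.smul_apply, smul_eq_mul,
    Finset.sum_mul, Finset.mul_sum]
  refine Finset.sum_congr rfl fun k _ ↦ Finset.sum_congr rfl fun l _ ↦ by ring

theorem det_gram_change (b e : Basis ι ℝ V) (g : V →ₗ[ℝ] V →ₗ[ℝ] ℝ) :
    (gram b (fun u w ↦ g u w)).det = (e.det b) ^ 2 * (gram e (fun u w ↦ g u w)).det := by
  have h := gram_comp (b := b) (e := e) g LinearMap.id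
  simp only [LinearMap.id_apply] at h
  rw [h, Matrix.det_mul, Matrix.det_mul, Matrix.det_transpose, Basis.det_apply,
    LinearMap.toMatrix_id_eq_basis_toMatrix]
  ring

theorem det_gram_comp (b : Basis ι ℝ V) (g : V →ₗ[ℝ] V →ₗ[ℝ] ℝ) (f : V →ₗ[ℝ] V) :
    (gram b (fun u w ↦ g (f u) (f w))).det =
      (LinearMap.det f) ^ 2 * (gram b (fun u w ↦ g u w)).det := by
  rw [gram_comp (e := b), Matrix.det_mul, Matrix.det_mul, Matrix.det_transpose,
    LinearMap.det_toMatrix]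
  ring

end Gram

/-! ### Metric traces of bilinear maps -/

section MetricTrace

variable {V : Type*} [AddCommGroup V] [Module ℝ V] {W : Type*} [AddCommGroup W] [Module ℝ W]
  {ι : Type*} [Fintype ι] [DecidableEq ι]

theorem repr_of_orthonormal (e : Basis ι ℝ V) (g : V →ₗ[ℝ] V →ₗ[ℝ] ℝ)
    (he : ∀ i j, g (e i) (e j) = if i = j then 1 else 0) (v : V) (i : ι) :
    e.repr v i = g v (e i) := by
  conv_rhs => rw [← e.sum_repr v]
  simp only [map_sum, map_smul, LinearMap.sum_apply, LinearMap.smul_apply, smul_eq_mul, he]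
  simp

/-- The trace of a bilinear map over an orthonormal basis, in terms of an arbitrary basis `b` and
the metric duals `ξ` of its coordinate functions. -/
theorem sum_orthonormal_eq {κ : Type*} [Fintype κ] (e : Basis ι ℝ V) (g : V →ₗ[ℝ] V →ₗ[ℝ] ℝ)
    (he : ∀ i j, g (e i) (e j) = if i = j then 1 else 0) (b : Basis κ ℝ V) (ξ : κ → V)
    (hξ : ∀ c w, g (ξ c) w = b.repr w c) (B : V →ₗ[ℝ] V →ₗ[ℝ] W) :
    ∑ a, B (e a) (e a) = ∑ c, B (b c) (ξ c) := by
  have h1 (a : ι) : B (e a) (e a) = ∑ c, g (ξ c) (e a) • B (b c) (e a) := by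
    conv_lhs => enter [1]; rw [← b.sum_repr (e a)]
    simp only [map_sum, map_smul, LinearMap.sum_apply, LinearMap.smul_apply, hξ]
  have h2 (c : κ) : B (b c) (ξ c) = ∑ a, g (ξ c) (e a) • B (b c) (e a) := by
    conv_lhs => rw [← e.sum_repr (ξ c)]
    simp only [map_sum, map_smul, repr_of_orthonormal e g he]
  simp only [h1, h2]
  rw [Finset.sum_comm]

theorem sum_orthonormal_eq_of_orthonormal {κ : Type*} [Fintype κ] [DecidableEq κ]
    (e : Basis ι ℝ V) (g : V →ₗ[ℝ] V →ₗ[ℝ] ℝ)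
    (he : ∀ i j, g (e i) (e j) = if i = j then 1 else 0) (b : Basis κ ℝ V)
    (hb : ∀ i j, g (b i) (b j) = if i = j then 1 else 0) (hg : ∀ u w, g u w = g w u)
    (B : V →ₗ[ℝ] V →ₗ[ℝ] W) :
    ∑ a, B (e a) (e a) = ∑ c, B (b c) (b c) :=
  sum_orthonormal_eq e g he b b (fun c w ↦ by rw [repr_of_orthonormal b g hb, hg]) B

/-- The trace of an invariant bilinear map. -/
theorem sum_orthonormal_J (e : Basis ι ℝ V) (g : V →ₗ[ℝ] V →ₗ[ℝ] ℝ)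
    (he : ∀ i j, g (e i) (e j) = if i = j then 1 else 0) (hg : ∀ u w, g u w = g w u)
    (I : V →ₗ[ℝ] V) (hI : ∀ u, I (I u) = -u) (hgI : ∀ u w, g (I u) (I w) = g u w)
    (B : V →ₗ[ℝ] V →ₗ[ℝ] W) :
    ∑ a, B (I (e a)) (I (e a)) = ∑ a, B (e a) (e a) := by
  let I' : V ≃ₗ[ℝ] V := LinearEquiv.ofLinearMap I (-I) (by ext; simp [hI]) (by ext; simp [hI])
  have := sum_orthonormal_eq_of_orthonormal (e.map I') g
    (fun i j ↦ by simp [I', hgI, he]) e he hg B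
  simpa [I'] using this

theorem trace_eq_sum_orthonormal (e : Basis ι ℝ V) (g : V →ₗ[ℝ] V →ₗ[ℝ] ℝ)
    (he : ∀ i j, g (e i) (e j) = if i = j then 1 else 0) (T : V →ₗ[ℝ] V) :
    LinearMap.trace ℝ V T = ∑ a, g (T (e a)) (e a) := by
  rw [LinearMap.trace_eq_matrix_trace ℝ e, Matrix.trace]
  simp [LinearMap.toMatrix_apply, repr_of_orthonormal e g he]

theorem trace_eq_sum_repr (b : Basis ι ℝ V) (T : V →ₗ[ℝ] V) :
    LinearMap.trace ℝ V T = ∑ a, b.repr (T (b a)) a := by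
  rw [LinearMap.trace_eq_matrix_trace ℝ b, Matrix.trace]
  simp [LinearMap.toMatrix_apply]

end MetricTrace

/-! ### Divergence for a Kähler metric in holomorphic coordinates -/

section KahlerDivergence

variable {E : Type*} [NormedAddCommGroup E] [NormedSpace ℝ E]

/-- A bilinear form as an iterated linear map. -/
noncomputable def toBilin {W : Type*} [NormedAddCommGroup W] [NormedSpace ℝ W] (g : E →L[ℝ] E →L[ℝ] W) :
    E →ₗ[ℝ] E →ₗ[ℝ] W :=
  (ContinuousLinearMap.coeLM ℝ).comp (g : E →ₗ[ℝ] E →L[ℝ] W)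

@[simp] theorem toBilin_apply {W : Type*} [NormedAddCommGroup W] [NormedSpace ℝ W]
    (g : E →L[ℝ] E →L[ℝ] W) (u w : E) : toBilin g u w = g u w := rfl

variable {ι κ : Type*} [Fintype ι] [DecidableEq ι] [Fintype κ] [DecidableEq κ]

/-- The derivative of the Riemannian volume density `√det g`. -/
theorem hasFDerivAt_sqrt_det_gram [FiniteDimensional ℝ E]
    {g : E → E →L[ℝ] E →L[ℝ] ℝ} {g' : E →L[ℝ] E →L[ℝ] E →L[ℝ] ℝ} {p : E}
    (hg : HasFDerivAt g g' p) (b e : Basis ι ℝ E)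
    (he : ∀ i j, g p (e i) (e j) = if i = j then 1 else 0) :
    HasFDerivAt (fun q ↦ √(gram b (fun u w ↦ g q u w)).det)
      ((√(gram b (fun u w ↦ g p u w)).det / 2) •
        ∑ a, (ContinuousLinearMap.apply ℝ ℝ (e a)).comp
          ((ContinuousLinearMap.apply ℝ (E →L[ℝ] ℝ) (e a)).comp g')) p := by
  set L : E →L[ℝ] ℝ := ∑ a, (ContinuousLinearMap.apply ℝ ℝ (e a)).comp
          ((ContinuousLinearMap.apply ℝ (E →L[ℝ] ℝ) (e a)).comp g') with hLdef
  have hentry (i j : ι) : HasFDerivAt (fun q ↦ g q (e i) (e j))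
      ((ContinuousLinearMap.apply ℝ ℝ (e j)).comp
          ((ContinuousLinearMap.apply ℝ (E →L[ℝ] ℝ) (e i)).comp g')) p :=
    (ContinuousLinearMap.apply ℝ ℝ (e j)).hasFDerivAt.comp p
      ((ContinuousLinearMap.apply ℝ (E →L[ℝ] ℝ) (e i)).hasFDerivAt.comp p hg)
  have hM : HasFDerivAt (fun q (i j : ι) ↦ g q (e i) (e j))
      (ContinuousLinearMap.pi fun i ↦ ContinuousLinearMap.pi fun j ↦
        (ContinuousLinearMap.apply ℝ ℝ (e j)).comp
          ((ContinuousLinearMap.apply ℝ (E →L[ℝ] ℝ) (e i)).comp g')) p :=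
    hasFDerivAt_pi.2 fun i ↦ hasFDerivAt_pi.2 fun j ↦ hentry i j
  have h1 : Matrix.of (fun i j ↦ g p (e i) (e j)) = 1 := by
    ext i j; simp [he, Matrix.one_apply]
  have hdet := hasFDerivAt_det_of_eq_one hM h1 L (fun v ↦ by simp [hLdef])
  have hdet1 : (Matrix.of (fun i j ↦ g p (e i) (e j))).det = 1 := by rw [h1, Matrix.det_one]
  have hsq := hdet.sqrt (by rw [hdet1]; norm_num)
  -- Passing from `b` to a basis orthonormal at `p` changes the density by a constant factor, and
  -- makes the Gram matrix the identity at `p`.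
  have hfun (q : E) : √(gram b (fun u w ↦ g q u w)).det =
      |e.det b| * √(Matrix.of (fun i j ↦ g q (e i) (e j))).det := by
    have := det_gram_change b e (toBilin (g q))
    simp only [toBilin_apply] at this
    rw [this, Real.sqrt_mul (sq_nonneg _), Real.sqrt_sq_eq_abs]
    rfl
  have hp : √(gram b (fun u w ↦ g p u w)).det = |e.det b| := by
    rw [hfun, hdet1]; simp
  rw [hp]
  simp only [hfun]
  refine (hsq.const_mul |e.det b|).congr_fderiv ?_
  rw [hdet1, smul_smul]
  congr 1
  simp
  ring

/-- For a Kähler metric `g` with volume density `ρ`, the divergence of a `1`-form `α` (with respect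
to an orthonormal frame at `p`, in holomorphic coordinates) is `ρ⁻¹ tr D(ρ α^♯)`. -/
theorem kahler_divergence [FiniteDimensional ℝ E]
    {g : E → E →L[ℝ] E →L[ℝ] ℝ} {g' : E →L[ℝ] E →L[ℝ] E →L[ℝ] ℝ} {p : E}
    (hg : HasFDerivAt g g' p) (hsymm : ∀ᶠ q in 𝓝 p, ∀ u w, g q u w = g q w u)
    (I : E →L[ℝ] E) (hII : ∀ u, I (I u) = -u)
    (hinv : ∀ᶠ q in 𝓝 p, ∀ u w, g q (I u) (I w) = g q u w)
    (hclosed : ∀ u v w, g' u (I v) w + g' v (I w) u +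
      g' w (I u) v = 0)
    (b e : Basis ι ℝ E) (he : ∀ i j, g p (e i) (e j) = if i = j then 1 else 0)
    {α : E → E →L[ℝ] ℝ} {α' : E →L[ℝ] E →L[ℝ] ℝ} (hα : HasFDerivAt α α' p)
    {ξ : E → E} {ξ' : E →L[ℝ] E} (hξ : HasFDerivAt ξ ξ' p) (hgξ : ∀ᶠ q in 𝓝 p, g q (ξ q) = α q) :
    √(gram b (fun u w ↦ g p u w)).det * ∑ a, α' (e a) (e a) =
      ∑ i, b.repr (fderiv ℝ (fun q ↦ √(gram b (fun u w ↦ g q u w)).det • ξ q) p (b i)) i := by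
  have hsp := hsymm.self_of_nhds
  have hip := hinv.self_of_nhds
  have hentry (u w : E) : HasFDerivAt (fun q ↦ g q u w)
      ((ContinuousLinearMap.apply ℝ ℝ w).comp
          ((ContinuousLinearMap.apply ℝ (E →L[ℝ] ℝ) u).comp g')) p :=
    (ContinuousLinearMap.apply ℝ ℝ w).hasFDerivAt.comp p
      ((ContinuousLinearMap.apply ℝ (E →L[ℝ] ℝ) u).hasFDerivAt.comp p hg)
  have hs' (v u w : E) : g' v u w = g' v w u := by
    have h := (hentry u w).congr_of_eventuallyEq
      (hsymm.mono fun q hq ↦ (hq w u : g q w u = g q u w))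
    have := congrArg (fun L ↦ L v) ((hentry w u).unique h)
    simpa using this.symm
  have hi' (v u w : E) : g' v (I u) (I w) = g' v u w := by
    have h := (hentry u w).congr_of_eventuallyEq
      (hinv.mono fun q hq ↦ (hq u w : g q (I u) (I w) = g q u w))
    have := congrArg (fun L ↦ L v) ((hentry (I u) (I w)).unique h)
    simpa using this
  -- Product rule for α = g(ξ, ·). The trace of the second term is tr ξ'; the first must be matched
  -- with the derivative of the density.
  have hα' (u w : E) : α' u w = g' u (ξ p) w + g p (ξ' u) w := by
    have h := (hg.clm_apply hξ).congr_of_eventuallyEq (hgξ.mono fun q hq ↦ hq.symm)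
    have := congrArg (fun L ↦ L u w) (hα.unique h)
    simpa [add_comm] using this
  set v := ξ p with hv
  -- the closedness condition, traced
  have htr : ∑ a, g' (e a) v (e a) = (1 / 2) * ∑ a, g' v (e a) (e a) := by
    -- On (eₐ, v, Ieₐ) the three terms become g'(eₐ)(v,eₐ), -g'(v)(eₐ,eₐ) and g'(Ieₐ)(Ieₐ,v). Summed
    -- over `a`, the third equals the first by invariance of the trace under `I`, whence the factor
    -- ½. This is the vanishing of the contracted Christoffel symbols, and the place where dκ = 0
    -- enters.
    have h1 (a : ι) := hclosed (e a) v (I (e a))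
    simp only [hi', hII, map_neg, neg_apply] at h1
    have h2 : ∑ a, g' (I (e a)) (I (e a)) v = ∑ a, g' (e a) (e a) v :=
      sum_orthonormal_J e (toBilin (g p)) he hsp (I : E →ₗ[ℝ] E) hII hip
        (toBilin ((ContinuousLinearMap.compL ℝ E (E →L[ℝ] ℝ) ℝ
          (ContinuousLinearMap.apply ℝ ℝ v)).comp g'))
    have h3 : ∑ a, (g' (e a) v (e a) + -g' v (e a) (e a) +
        g' (I (e a)) (I (e a)) v) = 0 := Finset.sum_eq_zero fun a _ ↦ h1 a
    rw [Finset.sum_add_distrib, Finset.sum_add_distrib, h2, Finset.sum_neg_distrib] at h3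
    have h4 : ∑ a, g' (e a) (e a) v = ∑ a, g' (e a) v (e a) :=
      Finset.sum_congr rfl fun a _ ↦ hs' _ _ _
    rw [h4] at h3
    linarith
  have hρ := hasFDerivAt_sqrt_det_gram hg b e he
  rw [(hρ.fun_smul hξ).fderiv]
  set ρ := √(gram b (fun u w ↦ g p u w)).det
  have htrace : ∑ a, g p (ξ' (e a)) (e a) = ∑ i, b.repr (ξ' (b i)) i :=
    (trace_eq_sum_orthonormal e (toBilin (g p)) he (ξ' : E →ₗ[ℝ] E)).symm.trans
      (trace_eq_sum_repr b (ξ' : E →ₗ[ℝ] E))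
  -- The derivative of the density along ξ is ρ/2 times the right-hand side, so it supplies exactly
  -- the term found in `htr`.
  have hexp : ∑ i, b.repr v i * (∑ a, g' (b i) (e a) (e a)) = ∑ a, g' v (e a) (e a) := by
    conv_rhs => rw [← b.sum_repr v]
    simp only [map_sum, map_smul, sum_apply, smul_apply,
      smul_eq_mul, Finset.mul_sum]
    rw [Finset.sum_comm]
  simp only [hα', Finset.sum_add_distrib, htr, htrace]
  simp only [add_apply, smul_apply, map_add, map_smul,
    ContinuousLinearMap.smulRight_apply, Finsupp.add_apply, Finsupp.smul_apply, smul_eq_mul,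
    Finset.sum_add_distrib, sum_apply, ContinuousLinearMap.comp_apply,
    ContinuousLinearMap.apply_apply]
  rw [← Finset.mul_sum, ← hexp]
  simp only [mul_add, Finset.mul_sum]
  rw [add_comm]
  congr 1
  refine Finset.sum_congr rfl fun i _ ↦ ?_
  simp only [Finset.sum_mul]
  exact Finset.sum_congr rfl fun a _ ↦ by ring

end KahlerDivergence

/-! ### The Kähler metric in a holomorphic chart -/

section MulI

variable {E : Type*} [NormedAddCommGroup E] [NormedSpace ℂ E]

variable (E) in
/-- Multiplication by `√-1` as a real linear map. -/
noncomputable def mulI : E →L[ℝ] E :=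
  (Complex.I • ContinuousLinearMap.id ℂ E).restrictScalars ℝ

@[simp] theorem mulI_apply (u : E) : mulI E u = Complex.I • u := rfl

theorem mulI_mulI (u : E) : mulI E (mulI E u) = -u := by
  simp [smul_smul]

end MulI

section LocalMetric

variable {E : Type*} [NormedAddCommGroup E] [NormedSpace ℂ E]
  {X : Type*} [TopologicalSpace X] [ChartedSpace E X] [IsManifold 𝓘(ℂ, E) ω X]

variable (E) in
/-- The differential of the inverse of the chart around `x₀` at `y`, in the chart at `y`. -/
noncomputable def coordMap (x₀ y : X) : E →L[ℝ] E :=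
  fderiv ℝ (transition E x₀ y) (chartAt E x₀ y)

namespace KahlerForm

variable (κ : KahlerForm E X)

/-- The Kähler form at `y` as a bilinear form on the model space. -/
noncomputable def modelForm (y : X) : E →L[ℝ] E →L[ℝ] ℝ := κ.toFun y

/-- The Kähler metric in the chart around `x₀`. -/
noncomputable def localMetric (x₀ : X) (p : E) : E →L[ℝ] E →L[ℝ] ℝ :=
  (κ.modelForm ((chartAt E x₀).symm p)).bilinearComp (coordMap E x₀ ((chartAt E x₀).symm p))
    ((coordMap E x₀ ((chartAt E x₀).symm p)).comp (mulI E))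

theorem localMetric_apply (x₀ : X) {p : E} (hp : p ∈ (chartAt E x₀).target) (u w : E) :
    κ.localMetric x₀ p u w =
      κ.toFun ((chartAt E x₀).symm p) (coordField E x₀ u ((chartAt E x₀).symm p))
        (J E _ (coordField E x₀ w ((chartAt E x₀).symm p))) := by
  have hy := (chartAt E x₀).map_target hp
  rw [J_coordField E x₀ _ hy, coordField_eq_fderiv E x₀ _ hy, coordField_eq_fderiv E x₀ _ hy]
  rfl

theorem form_J_comm (y : X) (u w : TangentSpace 𝓘(ℝ, E) y) :
    κ.toFun y u (J E y w) = κ.toFun y w (J E y u) := by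
  have h := κ.invariant y u (J E y w)
  rw [J_J, map_neg, κ.skew, neg_neg] at h
  exact h.symm

theorem localMetric_symm (x₀ : X) {p : E} (hp : p ∈ (chartAt E x₀).target) (u w : E) :
    κ.localMetric x₀ p u w = κ.localMetric x₀ p w u := by
  rw [κ.localMetric_apply x₀ hp, κ.localMetric_apply x₀ hp, form_J_comm]

theorem localMetric_I (x₀ : X) {p : E} (hp : p ∈ (chartAt E x₀).target) (u w : E) :
    κ.localMetric x₀ p (Complex.I • u) (Complex.I • w) = κ.localMetric x₀ p u w := by
  have hy := (chartAt E x₀).map_target hp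
  rw [κ.localMetric_apply x₀ hp, κ.localMetric_apply x₀ hp, ← J_coordField E x₀ _ hy,
    ← J_coordField E x₀ _ hy, κ.invariant]

theorem localMetric_pos (x₀ : X) {p : E} (hp : p ∈ (chartAt E x₀).target) {u : E} (hu : u ≠ 0) :
    0 < κ.localMetric x₀ p u u := by
  rw [κ.localMetric_apply x₀ hp]
  have hy := (chartAt E x₀).map_target hp
  refine κ.positive _ _ fun h ↦ hu ?_
  rw [← coordEquiv_apply E x₀ _ hy] at h
  simpa using h

/-- The Kähler form in terms of the local metric. -/
theorem form_coordField (x₀ : X) {p : E} (hp : p ∈ (chartAt E x₀).target) (u w : E) :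
    κ.toFun ((chartAt E x₀).symm p) (coordField E x₀ u ((chartAt E x₀).symm p))
        (coordField E x₀ w ((chartAt E x₀).symm p)) = κ.localMetric x₀ p (Complex.I • u) w := by
  have hy := (chartAt E x₀).map_target hp
  rw [κ.localMetric_apply x₀ hp, ← J_coordField E x₀ _ hy, κ.invariant]

theorem localMetric_change (x₀ x₁ : X) {p : E} (hp : p ∈ (chartAt E x₀).target)
    (h₁ : (chartAt E x₀).symm p ∈ (chartAt E x₁).source) (u w : E) :
    κ.localMetric x₀ p u w = κ.localMetric x₁ (transition E x₀ x₁ p)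
      (fderiv ℝ (transition E x₀ x₁) p u) (fderiv ℝ (transition E x₀ x₁) p w) := by
  have hy := (chartAt E x₀).map_target hp
  have hq : transition E x₀ x₁ p ∈ (chartAt E x₁).target := (chartAt E x₁).map_source h₁
  have hqy : (chartAt E x₁).symm (transition E x₀ x₁ p) = (chartAt E x₀).symm p :=
    (chartAt E x₁).left_inv h₁
  rw [κ.localMetric_apply x₀ hp, κ.localMetric_apply x₁ hq, hqy,
    coordField_change E x₀ x₁ _ hy h₁, coordField_change E x₀ x₁ _ hy h₁,
    (chartAt E x₀).right_inv hp]

theorem contMDiffOn_form_coordField (x₀ : X) (u w : E) :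
    ContMDiffOn 𝓘(ℝ, E) 𝓘(ℝ, ℝ) ∞
      (fun y ↦ κ.toFun y (coordField E x₀ u y) (coordField E x₀ w y)) (chartAt E x₀).source := by
  have h := ContMDiffOn.clm_bundle_apply₂ (IM := 𝓘(ℝ, E)) (F₁ := E) (F₂ := E) (F₃ := ℝ)
    (E₁ := (TangentSpace 𝓘(ℝ, E) : X → Type _)) (E₂ := (TangentSpace 𝓘(ℝ, E) : X → Type _))
    (E₃ := fun _ : X ↦ ℝ) (b := fun y ↦ y) (ψ := fun y ↦ κ.toFun y)
    (κ.smooth.contMDiffOn (s := (chartAt E x₀).source))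
    (contMDiffOn_coordField E x₀ u) (contMDiffOn_coordField E x₀ w)
  intro y hy
  have h2 := h y hy
  rw [contMDiffWithinAt_totalSpace] at h2
  exact h2.2

theorem contDiffOn_of_contMDiffOn_chart {W : Type*} [NormedAddCommGroup W] [NormedSpace ℝ W]
    {f : X → W} (x₀ : X) (h : ContMDiffOn 𝓘(ℝ, E) 𝓘(ℝ, W) ∞ f (chartAt E x₀).source) :
    ContDiffOn ℝ ∞ (f ∘ (chartAt E x₀).symm) (chartAt E x₀).target := by
  intro p hp
  have hy := (chartAt E x₀).map_target hp
  have h1 := (h _ hy).contMDiffAt ((chartAt E x₀).open_source.mem_nhds hy)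
  have h2 := (contMDiffAt_iff_contDiffAt_chart E (n := ⊤) x₀ _ hy).1 h1
  rw [(chartAt E x₀).right_inv hp] at h2
  exact h2.contDiffWithinAt

theorem contDiffOn_localMetric [FiniteDimensional ℂ E] (x₀ : X) :
    ContDiffOn ℝ ∞ (κ.localMetric x₀) (chartAt E x₀).target := by
  have : FiniteDimensional ℝ E := FiniteDimensional.complexToReal E
  rw [contDiffOn_clm_apply]
  intro u
  rw [contDiffOn_clm_apply]
  intro w
  refine (contDiffOn_of_contMDiffOn_chart x₀
    (κ.contMDiffOn_form_coordField x₀ u (Complex.I • w))).congr fun p hp ↦ ?_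
  rw [κ.localMetric_apply x₀ hp, J_coordField E x₀ _ ((chartAt E x₀).map_target hp)]
  rfl

/-- In coordinates κ(u,w) = g(√-1u, w), so dκ = 0 becomes a cyclic identity for the first
derivatives of the metric. -/
theorem localMetric_closed [FiniteDimensional ℂ E] (x₀ : X) {p : E}
    (hp : p ∈ (chartAt E x₀).target) (u v w : E) :
    fderiv ℝ (κ.localMetric x₀) p u (Complex.I • v) w +
      fderiv ℝ (κ.localMetric x₀) p v (Complex.I • w) u +
      fderiv ℝ (κ.localMetric x₀) p w (Complex.I • u) v = 0 := by
  have hy := (chartAt E x₀).map_target hp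
  have key (a b c : E) : mvfderiv 𝓘(ℝ, E)
      (fun z ↦ κ.toFun z (coordField E x₀ b z) (coordField E x₀ c z)) ((chartAt E x₀).symm p)
        (coordField E x₀ a ((chartAt E x₀).symm p)) =
      fderiv ℝ (κ.localMetric x₀) p a (Complex.I • b) c := by
    have hd := ((κ.contMDiffOn_form_coordField x₀ b c _ hy).contMDiffAt
      ((chartAt E x₀).open_source.mem_nhds hy)).mdifferentiableAt (by simp)
    rw [mvfderiv_coordField E x₀ _ hy a hd, (chartAt E x₀).right_inv hp]
    have hg := ((κ.contDiffOn_localMetric x₀).contDiffAt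
      ((chartAt E x₀).open_target.mem_nhds hp)).differentiableAt (by simp)
    have h1 : (fun z ↦ κ.toFun z (coordField E x₀ b z) (coordField E x₀ c z)) ∘
        (chartAt E x₀).symm =ᶠ[𝓝 p] fun q ↦ κ.localMetric x₀ q (Complex.I • b) c := by
      filter_upwards [(chartAt E x₀).open_target.mem_nhds hp] with q hq
      exact κ.form_coordField x₀ hq b c
    rw [h1.fderiv_eq, fderiv_clm_apply (by fun_prop) (by fun_prop),
      fderiv_clm_apply (by fun_prop) (by fun_prop)]
    simp
  have h := κ.closed x₀ _ hy u v w
  rwa [key, key, key] at h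

end KahlerForm

end LocalMetric

/-! ### The Hermitian determinant as Riemannian volume density -/

section VolumeDensity

variable {E : Type*} [NormedAddCommGroup E] [NormedSpace ℂ E]

theorem I_smul_I_smul (u : E) : Complex.I • Complex.I • u = -u := by
  simp [smul_smul]

variable [FiniteDimensional ℂ E]

variable (E) in
/-- The real basis of `E` given by a complex basis `b` and `√-1 b`. -/
noncomputable def realBasis : Basis (Fin 2 × Fin (finrank ℂ E)) ℝ E :=
  Complex.basisOneI.smulTower (finBasis ℂ E)

/-- The Hermitian matrix of an invariant metric. -/
noncomputable def hermMatrix (g : E →L[ℝ] E →L[ℝ] ℝ) :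
    Matrix (Fin (finrank ℂ E)) (Fin (finrank ℂ E)) ℂ :=
  Matrix.of fun j k ↦ (g (finBasis ℂ E j) (finBasis ℂ E k) : ℂ) +
    Complex.I * (g (finBasis ℂ E j) (Complex.I • finBasis ℂ E k) : ℂ)

-- The matrix represents the Hermitian form h(u,w) = g(u,w) + √-1 g(u,√-1w), whose value at (v,v) is
-- g(v,v) because g(v,√-1v) = 0.
open scoped ComplexOrder in
theorem hermMatrix_posDef (g : E →L[ℝ] E →L[ℝ] ℝ) (hs : ∀ u w, g u w = g w u)
    (hI : ∀ u w, g (Complex.I • u) (Complex.I • w) = g u w) (hpos : ∀ u, u ≠ 0 → 0 < g u u) :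
    (hermMatrix g).PosDef := by
  have hI2 (u w : E) : g u (Complex.I • w) = - g w (Complex.I • u) := by
    rw [← hI, I_smul_I_smul, map_neg, hs]
  rw [Matrix.posDef_iff_dotProduct_mulVec]
  refine ⟨?_, fun x hx ↦ ?_⟩
  · ext j k
    simp only [hermMatrix, Matrix.conjTranspose_apply, Matrix.of_apply, map_add, map_mul,
      RCLike.star_def, Complex.conj_ofReal, Complex.conj_I]
    rw [hI2 (finBasis ℂ E k), hs (finBasis ℂ E k)]
    push_cast
    ring
  -- Conjugate coefficients, since h is linear in the first variable and antilinear in the second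
  -- while x*Mx conjugates the first.
  · set v : E := ∑ j, (starRingEnd ℂ (x j)) • finBasis ℂ E j with hv
    have hv0 : v ≠ 0 := by
      intro h
      refine hx (funext fun j ↦ ?_)
      have h2 := Fintype.linearIndependent_iff.1 (finBasis ℂ E).linearIndependent _ (hv ▸ h) j
      simpa using h2
    have hz (z z' : ℂ) (u w : E) : ((g (z • u) (z' • w) : ℂ) +
        Complex.I * (g (z • u) (Complex.I • z' • w) : ℂ)) =
        z * starRingEnd ℂ z' * ((g u w : ℂ) + Complex.I * (g u (Complex.I • w) : ℂ)) := by
      have e1 (c : ℂ) (y : E) : c • y = c.re • y + c.im • (Complex.I • y) := by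
        conv_lhs => rw [← Complex.re_add_im c]
        rw [add_smul, mul_smul]; simp
      rw [smul_comm Complex.I z' w, e1 z u, e1 z' w, e1 z' (Complex.I • w), I_smul_I_smul]
      simp only [map_add, map_smul, add_apply, smul_apply, smul_eq_mul, map_neg, hI]
      have h3 : g (Complex.I • u) w = - g u (Complex.I • w) := by
        rw [← hI, I_smul_I_smul, map_neg, neg_apply]
      rw [h3]
      apply Complex.ext <;> simp <;> ring
    have hsum : star x ⬝ᵥ (hermMatrix g).mulVec x =
        (g v v : ℂ) + Complex.I * (g v (Complex.I • v) : ℂ) := by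
      rw [hv]
      simp only [dotProduct, Matrix.mulVec, Finset.smul_sum, map_sum, sum_apply,
        Complex.ofReal_sum, Finset.mul_sum]
      rw [← Finset.sum_add_distrib]
      rw [Finset.sum_comm]
      refine Finset.sum_congr rfl fun k _ ↦ ?_
      rw [← Finset.sum_add_distrib]
      refine Finset.sum_congr rfl fun j _ ↦ ?_
      rw [hz]
      simp only [hermMatrix, Matrix.of_apply, Pi.star_apply, RCLike.star_def, Complex.conj_conj]
      ring
    have hzero : g v (Complex.I • v) = 0 := by
      have := hI2 v v
      linarith
    rw [hsum, hzero]
    simpa using hpos v hv0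

theorem repr_realBasis (v : E) (i : Fin 2 × Fin (finrank ℂ E)) :
    (realBasis E).repr v i = Complex.basisOneI.repr ((finBasis ℂ E).repr v i.2) i.1 := by
  rw [realBasis, Basis.smulTower_repr]

-- In the real basis (b, √-1b) the Gram matrix is the transpose of the realification of a complex
-- endomorphism with determinant det h. A realification has determinant |det h|², and det h is
-- positive.
open scoped ComplexOrder in
theorem sqrt_det_gram_eq (g : E →L[ℝ] E →L[ℝ] ℝ) (hs : ∀ u w, g u w = g w u)
    (hI : ∀ u w, g (Complex.I • u) (Complex.I • w) = g u w) (hpos : ∀ u, u ≠ 0 → 0 < g u u) :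
    0 < (hermMatrix g).det.re ∧
      (hermMatrix g).det.re = √(gram (realBasis E) (fun u w ↦ g u w)).det := by
  have hdet := (hermMatrix_posDef g hs hI hpos).det_pos
  obtain ⟨hre, him⟩ := Complex.pos_iff.1 hdet
  refine ⟨hre, ?_⟩
  let b := finBasis ℂ E
  let M : E →ₗ[ℂ] E := Matrix.toLin b b (hermMatrix g).transpose
  have hM : (gram (realBasis E) (fun u w ↦ g u w)) =
      (LinearMap.toMatrix (realBasis E) (realBasis E) (M.restrictScalars ℝ)).transpose := by
    ext ⟨a, j⟩ ⟨c, k⟩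
    rw [Matrix.transpose_apply, LinearMap.toMatrix_apply, repr_realBasis]
    have h1 : (finBasis ℂ E).repr (M (realBasis E (a, j))) k =
        Complex.basisOneI a * hermMatrix g j k := by
      rw [realBasis, Basis.smulTower_apply, map_smul, map_smul]
      simp only [Finsupp.smul_apply, smul_eq_mul]
      congr 1
      rw [show M ((finBasis ℂ E) j) = ∑ i, (hermMatrix g).transpose i j • b i from
        Matrix.toLin_self b b (hermMatrix g).transpose j]
      simp [b, Finsupp.single_apply]
    simp only [LinearMap.restrictScalars_apply, h1]
    have h3 (u w : E) : g (Complex.I • u) w = - g u (Complex.I • w) := by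
      rw [← hI, I_smul_I_smul, map_neg, neg_apply]
    simp only [gram, Matrix.of_apply, realBasis, Basis.smulTower_apply]
    fin_cases a <;> fin_cases c <;> simp [Complex.basisOneI, hermMatrix, hI, h3]
  have hd : (gram (realBasis E) (fun u w ↦ g u w)).det = Complex.normSq (hermMatrix g).det := by
    rw [hM, Matrix.det_transpose, LinearMap.det_toMatrix, LinearMap.det_restrictScalars,
      Algebra.norm_complex_apply]
    congr 1
    rw [LinearMap.det_toLin, Matrix.det_transpose]
  rw [hd, Complex.normSq_apply, ← him]
  simp [hre.le]

variable {X : Type*} [TopologicalSpace X] [ChartedSpace E X] [IsManifold 𝓘(ℂ, E) ω X]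

namespace KahlerForm

variable (κ : KahlerForm E X)

theorem volumeDensity_symm_chart (x₀ : X) {p : E} (hp : p ∈ (chartAt E x₀).target) :
    κ.volumeDensity x₀ ((chartAt E x₀).symm p) = (hermMatrix (κ.localMetric x₀ p)).det.re := by
  have hy := (chartAt E x₀).map_target hp
  unfold volumeDensity hermMatrix
  congr 3
  funext j k
  rw [κ.form_coordField x₀ hp, ← κ.localMetric_apply x₀ hp]
  have h := κ.localMetric_I x₀ hp (Complex.I • finBasis ℂ E j) (finBasis ℂ E k)
  rw [I_smul_I_smul, map_neg, neg_apply] at h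
  rw [← h]
  push_cast
  ring

theorem volumeDensity_pos (x₀ : X) {p : E} (hp : p ∈ (chartAt E x₀).target) :
    0 < κ.volumeDensity x₀ ((chartAt E x₀).symm p) := by
  rw [κ.volumeDensity_symm_chart x₀ hp]
  exact (sqrt_det_gram_eq _ (κ.localMetric_symm x₀ hp) (κ.localMetric_I x₀ hp)
    fun u ↦ κ.localMetric_pos x₀ hp).1

theorem volumeDensity_eq_sqrt (x₀ : X) {p : E} (hp : p ∈ (chartAt E x₀).target) :
    κ.volumeDensity x₀ ((chartAt E x₀).symm p) =
      √(gram (realBasis E) (fun u w ↦ κ.localMetric x₀ p u w)).det := by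
  rw [κ.volumeDensity_symm_chart x₀ hp]
  exact (sqrt_det_gram_eq _ (κ.localMetric_symm x₀ hp) (κ.localMetric_I x₀ hp)
    fun u ↦ κ.localMetric_pos x₀ hp).2

theorem det_gram_pos (x₀ : X) {p : E} (hp : p ∈ (chartAt E x₀).target) :
    0 < (gram (realBasis E) (fun u w ↦ κ.localMetric x₀ p u w)).det := by
  have h := κ.volumeDensity_pos x₀ hp
  rw [κ.volumeDensity_eq_sqrt x₀ hp] at h
  exact Real.sqrt_pos.1 h

/-- As the square root of a Gram determinant, the density picks up the absolute Jacobian of the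
transition map; this makes the chart measures agree on overlaps. -/
theorem volumeDensity_change (x₀ x₁ : X) {p : E} (hp : p ∈ (chartAt E x₀).target)
    (h₁ : (chartAt E x₀).symm p ∈ (chartAt E x₁).source) :
    κ.volumeDensity x₀ ((chartAt E x₀).symm p) =
      |(fderiv ℝ (transition E x₀ x₁) p).det| *
        κ.volumeDensity x₁ ((chartAt E x₁).symm (transition E x₀ x₁ p)) := by
  have hq : transition E x₀ x₁ p ∈ (chartAt E x₁).target := (chartAt E x₁).map_source h₁
  rw [κ.volumeDensity_eq_sqrt x₀ hp, κ.volumeDensity_eq_sqrt x₁ hq]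
  have h := det_gram_comp (realBasis E) (toBilin (κ.localMetric x₁ (transition E x₀ x₁ p)))
    (fderiv ℝ (transition E x₀ x₁) p : E →ₗ[ℝ] E)
  simp only [toBilin_apply, ContinuousLinearMap.coe_coe] at h
  simp only [κ.localMetric_change x₀ x₁ hp h₁]
  rw [h, Real.sqrt_mul (sq_nonneg _), Real.sqrt_sq_eq_abs]

theorem contDiffOn_volumeDensity (x₀ : X) :
    ContDiffOn ℝ ∞ (fun p ↦ κ.volumeDensity x₀ ((chartAt E x₀).symm p))
      (chartAt E x₀).target := by
  have hg := κ.contDiffOn_localMetric x₀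
  have hdet : ContDiffOn ℝ ∞ (fun p ↦ (gram (realBasis E)
      (fun u w ↦ κ.localMetric x₀ p u w)).det) (chartAt E x₀).target := by
    simp only [Matrix.det_apply]
    refine ContDiffOn.sum fun σ _ ↦ ContDiffOn.const_smul _ ?_
    refine contDiffOn_prod fun i _ ↦ ?_
    simp only [gram, Matrix.of_apply]
    exact (hg.clm_apply contDiffOn_const).clm_apply contDiffOn_const
  exact (hdet.sqrt fun p hp ↦ (κ.det_gram_pos x₀ hp).ne').congr
    fun p hp ↦ κ.volumeDensity_eq_sqrt x₀ hp

end KahlerForm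

end VolumeDensity

/-! ### The Kähler volume as a glued measure -/

section SupMeasure

variable {X : Type*} [MeasurableSpace X]

/-- A family of measures, supported on sets covering the space and compatible on overlaps, glues to
its supremum. -/
theorem iSup_restrict_eq {ι : Type*} (μ : ι → Measure X) (U : ι → Set X)
    (hU : ∀ i, MeasurableSet (U i)) (hμ : ∀ i, (μ i).restrict (U i) = μ i)
    (hcomp : ∀ i j, (μ i).restrict (U j) = (μ j).restrict (U i))
    (c : ℕ → ι) (hc : ⋃ n, U (c n) = univ) (j : ι) :
    (⨆ i, μ i).restrict (U j) = μ j := by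
  let W : ℕ → Set X := disjointed fun n ↦ U (c n)
  have hWm (n : ℕ) : MeasurableSet (W n) := MeasurableSet.disjointed (fun n ↦ hU _) n
  have hWU (n : ℕ) : W n ⊆ U (c n) := disjointed_subset _ _
  have hWd : Pairwise (Function.onFun Disjoint W) := disjoint_disjointed _
  have hWun : ⋃ n, W n = univ := by rw [iUnion_disjointed, hc]
  -- Gluing over disjoint pieces gives a measure restricting to every `μ j`. It dominates the
  -- supremum, which in turn dominates each `μ j`; so the two agree on each `U j`.
  let ν : Measure X := Measure.sum fun n ↦ (μ (c n)).restrict (W n)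
  have hν (j : ι) : ν.restrict (U j) = μ j := by
    rw [Measure.restrict_sum _ (hU j)]
    have h1 (n : ℕ) : ((μ (c n)).restrict (W n)).restrict (U j) = (μ j).restrict (W n) := by
      rw [Measure.restrict_restrict (hU j), inter_comm, ← Measure.restrict_restrict (hWm n),
        hcomp, Measure.restrict_restrict (hWm n), inter_eq_left.2 (hWU n)]
    simp only [h1]
    rw [← Measure.restrict_iUnion hWd hWm, hWun, Measure.restrict_univ]
  have hle : ⨆ i, μ i ≤ ν := iSup_le fun i ↦ by
    rw [← hν i]
    exact Measure.restrict_le_self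
  refine le_antisymm ?_ ?_
  · calc (⨆ i, μ i).restrict (U j) ≤ ν.restrict (U j) := Measure.restrict_mono le_rfl hle
      _ = μ j := hν j
  · rw [← hμ j]
    exact Measure.restrict_mono le_rfl (le_iSup μ j)

end SupMeasure

namespace KahlerForm

section Volume

variable {E : Type*} [NormedAddCommGroup E] [NormedSpace ℂ E] [FiniteDimensional ℂ E]
  [MeasurableSpace E] [BorelSpace E]
  {X : Type*} [TopologicalSpace X] [ChartedSpace E X] [IsManifold 𝓘(ℂ, E) ω X]
  [MeasurableSpace X] [BorelSpace X]
  (κ : KahlerForm E X)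

instance isAddHaarMeasure_lebesgue : (lebesgue E).IsAddHaarMeasure := by
  unfold lebesgue
  infer_instance

/-- The inverse chart is continuous only on the target; extended by a constant it becomes globally
measurable. -/
theorem measurableSet_chart_preimage (x₀ : X) {S : Set X} (hS : MeasurableSet S) :
    MeasurableSet ((chartAt E x₀).symm ⁻¹' S ∩ (chartAt E x₀).target) := by
  classical
  have hT := (chartAt E x₀).open_target.measurableSet
  have hm : Measurable ((chartAt E x₀).target.piecewise (chartAt E x₀).symm fun _ ↦ x₀) :=
    ContinuousOn.measurable_piecewise (chartAt E x₀).symm.continuousOn continuousOn_const hT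
  have : (chartAt E x₀).symm ⁻¹' S ∩ (chartAt E x₀).target =
      ((chartAt E x₀).target.piecewise (chartAt E x₀).symm fun _ ↦ x₀) ⁻¹' S ∩
        (chartAt E x₀).target := by
    ext p
    by_cases hp : p ∈ (chartAt E x₀).target <;> simp [hp]
  rw [this]
  exact (hm hS).inter hT

theorem aemeasurable_chart_symm (x₀ : X) (f : E → ENNReal) :
    AEMeasurable (chartAt E x₀).symm
      (((lebesgue E).restrict (chartAt E x₀).target).withDensity f) :=
  ((chartAt E x₀).symm.continuousOn.aemeasurable
    (chartAt E x₀).open_target.measurableSet).mono_ac (withDensity_absolutelyContinuous _ _)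

theorem chartMeasure_apply (x₀ : X) {S : Set X} (hS : MeasurableSet S) :
    κ.chartMeasure x₀ S = ∫⁻ p in (chartAt E x₀).symm ⁻¹' S ∩ (chartAt E x₀).target,
      ENNReal.ofReal (κ.volumeDensity x₀ ((chartAt E x₀).symm p)) ∂(lebesgue E) := by
  have : FiniteDimensional ℝ E := FiniteDimensional.complexToReal E
  rw [chartMeasure, Measure.map_apply_of_aemeasurable (aemeasurable_chart_symm x₀ _) hS,
    withDensity_apply', Measure.restrict_restrict' (chartAt E x₀).open_target.measurableSet]

/-- Change of variables along the transition map, whose Jacobian cancels that of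
`volumeDensity_change`. -/
theorem chartMeasure_overlap (x₀ x₁ : X) {S : Set X} (hS : MeasurableSet S)
    (h₀ : S ⊆ (chartAt E x₀).source) (h₁ : S ⊆ (chartAt E x₁).source) :
    κ.chartMeasure x₀ S = κ.chartMeasure x₁ S := by
  have : FiniteDimensional ℝ E := FiniteDimensional.complexToReal E
  rw [chartMeasure_apply κ x₀ hS, chartMeasure_apply κ x₁ hS]
  set A := (chartAt E x₀).symm ⁻¹' S ∩ (chartAt E x₀).target with hA
  have hAm : MeasurableSet A := measurableSet_chart_preimage x₀ hS
  have himage : (chartAt E x₁).symm ⁻¹' S ∩ (chartAt E x₁).target = transition E x₀ x₁ '' A := by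
    ext q
    constructor
    · rintro ⟨hq, hqt⟩
      refine ⟨transition E x₁ x₀ q, ⟨?_, ?_⟩, ?_⟩
      · simpa [transition, (chartAt E x₀).left_inv (h₀ hq)] using hq
      · exact (chartAt E x₀).map_source (h₀ hq)
      · simp [transition, (chartAt E x₀).left_inv (h₀ hq), (chartAt E x₁).right_inv hqt]
    · rintro ⟨p, ⟨hp, hpt⟩, rfl⟩
      refine ⟨?_, (chartAt E x₁).map_source (h₁ hp)⟩
      simpa [transition, (chartAt E x₁).left_inv (h₁ hp)] using hp
  have hderiv (p : E) (hp : p ∈ A) : HasFDerivWithinAt (transition E x₀ x₁)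
      (fderiv ℝ (transition E x₀ x₁) p) A p := by
    have h := (contDiffAt_transition E x₀ x₁ _ (h₀ hp.1) (h₁ hp.1)).differentiableAt (by simp)
    rw [(chartAt E x₀).right_inv hp.2] at h
    exact h.hasFDerivAt.hasFDerivWithinAt
  have hinj : InjOn (transition E x₀ x₁) A := by
    intro p hp q hq hpq
    have h := (chartAt E x₁).injOn (h₁ hp.1) (h₁ hq.1) hpq
    rw [← (chartAt E x₀).right_inv hp.2, h, (chartAt E x₀).right_inv hq.2]
  rw [himage, lintegral_image_eq_lintegral_abs_det_fderiv_mul (lebesgue E) hAm hderiv hinj]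
  refine setLIntegral_congr_fun hAm fun p hp ↦ ?_
  rw [κ.volumeDensity_change x₀ x₁ hp.2 (h₁ hp.1), ENNReal.ofReal_mul (abs_nonneg _)]

theorem chartMeasure_restrict_source (x₀ : X) :
    (κ.chartMeasure x₀).restrict (chartAt E x₀).source = κ.chartMeasure x₀ := by
  ext S hS
  have hU := (chartAt E x₀).open_source.measurableSet
  rw [Measure.restrict_apply hS, chartMeasure_apply κ x₀ (hS.inter hU), chartMeasure_apply κ x₀ hS]
  congr 2
  ext p
  simp only [mem_inter_iff, mem_preimage]
  constructor
  · rintro ⟨⟨h, _⟩, h2⟩; exact ⟨h, h2⟩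
  · rintro ⟨h, h2⟩; exact ⟨⟨h, (chartAt E x₀).map_target h2⟩, h2⟩

theorem chartMeasure_restrict_comm (x₀ x₁ : X) :
    (κ.chartMeasure x₀).restrict (chartAt E x₁).source =
      (κ.chartMeasure x₁).restrict (chartAt E x₀).source := by
  have hU (x : X) := (chartAt E x).open_source.measurableSet
  rw [← chartMeasure_restrict_source κ x₀, ← chartMeasure_restrict_source κ x₁,
    Measure.restrict_restrict (hU _), Measure.restrict_restrict (hU _), inter_comm]
  ext S hS
  have hm := hS.inter ((hU x₀).inter (hU x₁))
  rw [Measure.restrict_apply hS, Measure.restrict_apply hS]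
  exact chartMeasure_overlap κ x₀ x₁ hm (fun _ h ↦ h.2.1) fun _ h ↦ h.2.2

variable [CompactSpace X]

/-- On the domain of a chart, the volume is given by the volume density of the chart. -/
theorem vol_restrict_source (x₀ : X) :
    κ.vol.restrict (chartAt E x₀).source = κ.chartMeasure x₀ := by
  have : Nonempty X := ⟨x₀⟩
  obtain ⟨t, ht⟩ := isCompact_univ.elim_finite_subcover (fun x : X ↦ (chartAt E x).source)
    (fun x ↦ (chartAt E x).open_source) fun x _ ↦ mem_iUnion.2 ⟨x, mem_chart_source E x⟩
  obtain ⟨c, hc⟩ := t.countable_toSet.exists_eq_range (by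
    by_contra h
    rw [not_nonempty_iff_eq_empty] at h
    have := ht (mem_univ x₀)
    simp [Finset.coe_eq_empty.1 h] at this)
  refine iSup_restrict_eq κ.chartMeasure (fun x ↦ (chartAt E x).source)
    (fun x ↦ (chartAt E x).open_source.measurableSet) (chartMeasure_restrict_source κ)
    (chartMeasure_restrict_comm κ) c ?_ x₀
  refine eq_univ_of_univ_subset fun x _ ↦ ?_
  obtain ⟨y, hy⟩ := mem_iUnion.1 (ht (mem_univ x))
  obtain ⟨hyt, hxy⟩ := mem_iUnion.1 hy
  obtain ⟨n, hn⟩ : y ∈ range c := hc ▸ hyt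
  exact mem_iUnion.2 ⟨n, hn ▸ hxy⟩

/-- The density is continuous, hence integrable on a compact neighbourhood inside a chart;
compactness of `X` turns local finiteness into finiteness. -/
instance isFiniteMeasure_vol : IsFiniteMeasure κ.vol := by
  have : FiniteDimensional ℝ E := FiniteDimensional.complexToReal E
  refine ⟨isCompact_univ.measure_lt_top_of_nhdsWithin fun x _ ↦ ?_⟩
  rw [nhdsWithin_univ]
  -- a compact neighbourhood in the chart
  have hT := (chartAt E x).open_target.mem_nhds (mem_chart_target E x)
  obtain ⟨C, hC, hCT, hCc⟩ := local_compact_nhds hT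
  have hN : (chartAt E x).source ∩ chartAt E x ⁻¹' C ∈ 𝓝 x :=
    Filter.inter_mem ((chartAt E x).open_source.mem_nhds (mem_chart_source E x))
      ((chartAt E x).continuousAt (mem_chart_source E x) hC)
  have hint : ContinuousOn (fun p ↦ κ.volumeDensity x ((chartAt E x).symm p)) C :=
    (κ.contDiffOn_volumeDensity x).continuousOn.mono hCT
  obtain ⟨N, hNx, hNo, hxN⟩ := mem_nhds_iff.1 hN
  refine ⟨N, hNo.mem_nhds hxN, ?_⟩
  have hNs : N ⊆ (chartAt E x).source := fun y hy ↦ (hNx hy).1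
  have h1 : κ.vol N = κ.chartMeasure x N := by
    rw [← κ.vol_restrict_source x, Measure.restrict_apply hNo.measurableSet,
      inter_eq_left.2 hNs]
  rw [h1, chartMeasure_apply κ x hNo.measurableSet]
  refine (lintegral_mono_set (t := C) ?_).trans_lt ?_
  · rintro p ⟨hp, hpt⟩
    have := (hNx hp).2
    rwa [mem_preimage, (chartAt E x).right_inv hpt] at this
  · have := (hint.integrableOn_compact (μ := lebesgue E) hCc).lintegral_lt_top
    exact this

/-- The integral of a function supported in the domain of a chart. -/
theorem integral_vol_eq {W : Type*} [NormedAddCommGroup W] [NormedSpace ℝ W] (x₀ : X) {f : X → W}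
    (hf : AEStronglyMeasurable f κ.vol) (hsupp : ∀ x ∉ (chartAt E x₀).source, f x = 0) :
    ∫ x, f x ∂κ.vol = ∫ p in (chartAt E x₀).target,
      κ.volumeDensity x₀ ((chartAt E x₀).symm p) • f ((chartAt E x₀).symm p) ∂(lebesgue E) := by
  have : FiniteDimensional ℝ E := FiniteDimensional.complexToReal E
  have hT := (chartAt E x₀).open_target.measurableSet
  rw [← setIntegral_eq_integral_of_forall_compl_eq_zero hsupp, κ.vol_restrict_source x₀]
  have hf' : AEStronglyMeasurable f (κ.chartMeasure x₀) := by
    rw [← κ.vol_restrict_source x₀]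
    exact hf.restrict
  have hdens : AEMeasurable (fun p ↦ ENNReal.ofReal (κ.volumeDensity x₀ ((chartAt E x₀).symm p)))
      ((lebesgue E).restrict (chartAt E x₀).target) :=
    ((κ.contDiffOn_volumeDensity x₀).continuousOn.aemeasurable hT).ennreal_ofReal
  rw [chartMeasure, integral_map (aemeasurable_chart_symm x₀ _) hf',
    integral_withDensity_eq_integral_toReal_smul₀ hdens (by simp)]
  refine setIntegral_congr_fun hT fun p hp ↦ ?_
  rw [ENNReal.toReal_ofReal (κ.volumeDensity_pos x₀ hp).le]

theorem integrable_of_continuous {W : Type*} [NormedAddCommGroup W] {f : X → W} [T2Space X]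
    (hf : Continuous f) : Integrable f κ.vol := by
  rw [← integrableOn_univ]
  exact hf.continuousOn.integrableOn_compact isCompact_univ

end Volume

end KahlerForm

/-! ### Dual vector fields and metric traces in a chart -/

section Sharp

variable {E : Type*} [NormedAddCommGroup E] [NormedSpace ℂ E]
  {X : Type*} [TopologicalSpace X] [ChartedSpace E X] [IsManifold 𝓘(ℂ, E) ω X]

namespace KahlerForm

variable (κ : KahlerForm E X)

/-- The Kähler metric on the tangent space as an iterated linear map. -/
noncomputable def tangentMetric (y : X) :
    TangentSpace 𝓘(ℝ, E) y →ₗ[ℝ] TangentSpace 𝓘(ℝ, E) y →ₗ[ℝ] ℝ :=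
  LinearMap.mk₂ ℝ (fun u w ↦ κ.toFun y u (J E y w)) (fun u v w ↦ by simp) (fun c u w ↦ by simp)
    (fun u v w ↦ by simp) (fun c u w ↦ by simp)

theorem tangentMetric_symm (y : X) (u w : TangentSpace 𝓘(ℝ, E) y) :
    κ.tangentMetric y u w = κ.tangentMetric y w u := κ.form_J_comm y u w

theorem tangentMetric_J (y : X) (u w : TangentSpace 𝓘(ℝ, E) y) :
    κ.tangentMetric y (J E y u) (J E y w) = κ.tangentMetric y u w :=
  κ.invariant y u (J E y w)

theorem localMetric_eq_tangentMetric (x₀ : X) {p : E} (hp : p ∈ (chartAt E x₀).target) (u w : E) :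
    κ.localMetric x₀ p u w =
      κ.tangentMetric ((chartAt E x₀).symm p) (coordField E x₀ u ((chartAt E x₀).symm p))
        (coordField E x₀ w ((chartAt E x₀).symm p)) :=
  κ.localMetric_apply x₀ hp u w

variable [FiniteDimensional ℂ E]

theorem tangentMetric_frame (y : X) (a b) :
    κ.tangentMetric y (κ.frame y a) (κ.frame y b) = if a = b then 1 else 0 :=
  onBasis_inner (κ.metric y) a b

/-- Traces over the frame are invariant under `J`. -/
theorem sum_frame_J {W : Type*} [AddCommGroup W] [Module ℝ W] (y : X)
    (B : TangentSpace 𝓘(ℝ, E) y →ₗ[ℝ] TangentSpace 𝓘(ℝ, E) y →ₗ[ℝ] W) :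
    ∑ a, B (J E y (κ.frame y a)) (J E y (κ.frame y a)) = ∑ a, B (κ.frame y a) (κ.frame y a) :=
  sum_orthonormal_J (κ.frame y) (κ.tangentMetric y) (κ.tangentMetric_frame y)
    (κ.tangentMetric_symm y) (J E y) (J_J E y) (κ.tangentMetric_J y) B

/-- The vector field dual to a covector field, in the chart around `x₀`. -/
noncomputable def sharp (x₀ : X) (p : E) (β : E →L[ℝ] ℝ) : E :=
  (κ.localMetric x₀ p).inverse β

theorem isInvertible_localMetric (x₀ : X) {p : E} (hp : p ∈ (chartAt E x₀).target) :
    (κ.localMetric x₀ p).IsInvertible := by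
  have : FiniteDimensional ℝ E := FiniteDimensional.complexToReal E
  have hinj : Function.Injective (κ.localMetric x₀ p) := by
    rw [injective_iff_map_eq_zero]
    intro u hu
    by_contra h
    have := κ.localMetric_pos x₀ hp h
    rw [hu] at this
    simp at this
  have hrank : finrank ℝ E = finrank ℝ (E →L[ℝ] ℝ) := by
    rw [← (LinearMap.toContinuousLinearMap (𝕜 := ℝ) (E := E) (F' := ℝ)).finrank_eq]
    exact (Subspace.dual_finrank_eq (K := ℝ) (V := E)).symm
  refine ⟨(LinearEquiv.ofInjectiveOfFinrankEq
    (κ.localMetric x₀ p : E →ₗ[ℝ] E →L[ℝ] ℝ) hinj hrank).toContinuousLinearEquiv, ?_⟩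
  ext u w
  rfl

theorem localMetric_sharp (x₀ : X) {p : E} (hp : p ∈ (chartAt E x₀).target) (β : E →L[ℝ] ℝ) :
    κ.localMetric x₀ p (κ.sharp x₀ p β) = β :=
  ((κ.isInvertible_localMetric x₀ hp).inverse_apply_eq.1 rfl).symm

theorem contDiffAt_sharp {n : ℕ∞} (x₀ : X) {p : E} (hp : p ∈ (chartAt E x₀).target)
    {β : E → E →L[ℝ] ℝ} (hβ : ContDiffAt ℝ n β p) :
    ContDiffAt ℝ n (fun q ↦ κ.sharp x₀ q (β q)) p := by
  have : FiniteDimensional ℝ E := FiniteDimensional.complexToReal E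
  have : CompleteSpace E := FiniteDimensional.complete ℝ E
  have hg : ContDiffAt ℝ n (κ.localMetric x₀) p := ((κ.contDiffOn_localMetric x₀).contDiffAt
    ((chartAt E x₀).open_target.mem_nhds hp)).of_le (by exact_mod_cast le_top)
  exact (((κ.isInvertible_localMetric x₀ hp).contDiffAt_map_inverse).comp p hg).clm_apply hβ

theorem localMetric_eq_tangentMetric_of_mem (x₀ : X) {y : X} (hy : y ∈ (chartAt E x₀).source)
    (u w : E) : κ.localMetric x₀ (chartAt E x₀ y) u w =
      κ.tangentMetric y (coordField E x₀ u y) (coordField E x₀ w y) := by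
  have h := κ.localMetric_eq_tangentMetric x₀ ((chartAt E x₀).map_source hy) u w
  rwa [(chartAt E x₀).left_inv hy] at h

/-- The metric trace in the chart around `x₀`. -/
theorem sum_frame_eq {W : Type*} [AddCommGroup W] [Module ℝ W] (x₀ : X) {y : X}
    (hy : y ∈ (chartAt E x₀).source) {κ' : Type*} [Fintype κ'] (b : Basis κ' ℝ E)
    (B : TangentSpace 𝓘(ℝ, E) y →ₗ[ℝ] TangentSpace 𝓘(ℝ, E) y →ₗ[ℝ] W) (β : κ' → E →L[ℝ] ℝ)
    (hβ : ∀ c w, β c w = b.repr w c) :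
    ∑ a, B (κ.frame y a) (κ.frame y a) =
      ∑ c, B (coordField E x₀ (b c) y)
        (coordField E x₀ (κ.sharp x₀ (chartAt E x₀ y) (β c)) y) := by
  have h := sum_orthonormal_eq (κ.frame y) (κ.tangentMetric y) (κ.tangentMetric_frame y)
    (b.map (coordEquiv E x₀ y hy).toLinearEquiv)
    (fun c ↦ coordField E x₀ (κ.sharp x₀ (chartAt E x₀ y) (β c)) y) (fun c w ↦ by
      obtain ⟨w, rfl⟩ := (coordEquiv E x₀ y hy).surjective w
      rw [coordEquiv_apply, ← κ.localMetric_eq_tangentMetric_of_mem x₀ hy,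
        κ.localMetric_sharp x₀ ((chartAt E x₀).map_source hy), hβ]
      simp only [Basis.map_repr, LinearEquiv.trans_apply]
      rw [← coordEquiv_apply E x₀ y hy]
      congr 2
      exact ((coordEquiv E x₀ y hy).symm_apply_apply w).symm) B
  rw [h]
  refine Finset.sum_congr rfl fun c _ ↦ ?_
  rw [Basis.map_apply]
  rfl

end KahlerForm

end Sharp

/-! ### The divergence of a 1-form and its independence of the chart -/

section OneForm

variable {E : Type*} [NormedAddCommGroup E] [NormedSpace ℂ E]
  {X : Type*} [TopologicalSpace X] [ChartedSpace E X] [IsManifold 𝓘(ℂ, E) ω X]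
  {W : Type*} [NormedAddCommGroup W] [NormedSpace ℝ W]

/-- A `1`-form in the chart around `x₀`. -/
noncomputable def localOneForm (α : ∀ x : X, TangentSpace 𝓘(ℝ, E) x →L[ℝ] W) (x₀ : X) (p : E) :
    E →L[ℝ] W :=
  ContinuousLinearMap.comp (α ((chartAt E x₀).symm p) : E →L[ℝ] W)
    (coordMap E x₀ ((chartAt E x₀).symm p))

theorem localOneForm_apply (α : ∀ x : X, TangentSpace 𝓘(ℝ, E) x →L[ℝ] W) (x₀ : X) {p : E}
    (hp : p ∈ (chartAt E x₀).target) (u : E) :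
    localOneForm α x₀ p u =
      α ((chartAt E x₀).symm p) (coordField E x₀ u ((chartAt E x₀).symm p)) := by
  rw [coordField_eq_fderiv E x₀ _ ((chartAt E x₀).map_target hp)]
  rfl

/-- A `1`-form is continuously differentiable; it is enough to check this at the centres of the
charts. -/
def IsC1OneForm (α : ∀ x : X, TangentSpace 𝓘(ℝ, E) x →L[ℝ] W) : Prop :=
  ∀ x, ContDiffAt ℝ 1 (localOneForm α x) (chartAt E x x)

theorem localOneForm_change (α : ∀ x : X, TangentSpace 𝓘(ℝ, E) x →L[ℝ] W) (x₀ x₁ : X) {p : E}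
    (hp : p ∈ (chartAt E x₀).target) (h₁ : (chartAt E x₀).symm p ∈ (chartAt E x₁).source) :
    localOneForm α x₀ p =
      (localOneForm α x₁ (transition E x₀ x₁ p)).comp (fderiv ℝ (transition E x₀ x₁) p) := by
  have hy := (chartAt E x₀).map_target hp
  have hq : transition E x₀ x₁ p ∈ (chartAt E x₁).target := (chartAt E x₁).map_source h₁
  have hqy : (chartAt E x₁).symm (transition E x₀ x₁ p) = (chartAt E x₀).symm p :=
    (chartAt E x₁).left_inv h₁
  ext u
  rw [ContinuousLinearMap.comp_apply, localOneForm_apply α x₀ hp, localOneForm_apply α x₁ hq,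
    hqy, coordField_change E x₀ x₁ _ hy h₁, (chartAt E x₀).right_inv hp]

theorem eventually_localOneForm_change (α : ∀ x : X, TangentSpace 𝓘(ℝ, E) x →L[ℝ] W) (x₀ x₁ : X)
    {p : E} (hp : p ∈ (chartAt E x₀).target)
    (h₁ : (chartAt E x₀).symm p ∈ (chartAt E x₁).source) :
    localOneForm α x₀ =ᶠ[𝓝 p] fun q ↦
      (localOneForm α x₁ (transition E x₀ x₁ q)).comp (fderiv ℝ (transition E x₀ x₁) q) := by
  have := ((chartAt E x₀).symm.trans (chartAt E x₁)).open_source.mem_nhds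
      (x := p) (by simp [hp, h₁])
  filter_upwards [this] with q hq
  simp only [OpenPartialHomeomorph.trans_source, OpenPartialHomeomorph.symm_source,
    mem_inter_iff, mem_preimage] at hq
  exact localOneForm_change α x₀ x₁ hq.1 hq.2

theorem contDiffAt_transition_of_mem (x₀ x₁ : X) {p : E} (hp : p ∈ (chartAt E x₀).target)
    (h₁ : (chartAt E x₀).symm p ∈ (chartAt E x₁).source) :
    ContDiffAt ℝ ∞ (transition E x₀ x₁) p := by
  have h := contDiffAt_transition E x₀ x₁ _ ((chartAt E x₀).map_target hp) h₁
  rwa [(chartAt E x₀).right_inv hp] at h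

theorem IsC1OneForm.contDiffAt {α : ∀ x : X, TangentSpace 𝓘(ℝ, E) x →L[ℝ] W}
    (hα : IsC1OneForm α) (x₀ : X) {p : E} (hp : p ∈ (chartAt E x₀).target) :
    ContDiffAt ℝ 1 (localOneForm α x₀) p := by
  set y := (chartAt E x₀).symm p with hy
  have h₁ := mem_chart_source E y
  have ht := contDiffAt_transition_of_mem x₀ y hp h₁
  refine ContDiffAt.congr_of_eventuallyEq ?_ (eventually_localOneForm_change α x₀ y hp h₁)
  refine ContDiffAt.clm_comp ?_ (ht.fderiv_right (by norm_cast))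
  have h2 : ContDiffAt ℝ 1 (localOneForm α y) (transition E x₀ y p) := hα y
  exact h2.comp p (ht.of_le (by norm_cast))

/-- The divergence `∑ₐ (∂_{eₐ} α)(eₐ)` in holomorphic coordinates, over an orthonormal frame. -/
noncomputable def KahlerForm.divergence [FiniteDimensional ℂ E] (κ : KahlerForm E X)
    (α : ∀ x : X, TangentSpace 𝓘(ℝ, E) x →L[ℝ] W) (x : X) : W :=
  ∑ a, fderiv ℝ (localOneForm α x) (chartAt E x x) (κ.frame x a) (κ.frame x a)

/-- In holomorphic coordinates the trace of the second derivative of a coordinate change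
vanishes. -/
theorem sum_frame_fderiv_transition [FiniteDimensional ℂ E] (κ : KahlerForm E X) (y x₀ : X)
    (h₀ : y ∈ (chartAt E x₀).source) :
    ∑ a, fderiv ℝ (fderiv ℝ (transition E y x₀)) (chartAt E y y) (κ.frame y a) (κ.frame y a) =
      0 := by
  have hC := contDiffAt_transition E y x₀ y (mem_chart_source E y) h₀
  set f := transition E y x₀
  set q := chartAt E y y
  have hs : IsSymmSndFDerivAt ℝ f q := hC.isSymmSndFDerivAt (by
    rw [minSmoothness_of_isRCLikeNormedField]; norm_cast)
  have hd : DifferentiableAt ℝ (fderiv ℝ f) q :=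
    (hC.fderiv_right (m := 1) (by norm_cast)).differentiableAt (by simp)
  -- The first derivative is complex linear at all nearby points, so the second is complex linear in
  -- its second slot, and by symmetry in both.
  have hI (u w : E) : fderiv ℝ (fderiv ℝ f) q u (Complex.I • w) =
      Complex.I • fderiv ℝ (fderiv ℝ f) q u w := by
    have h1 : (fun r ↦ fderiv ℝ f r (Complex.I • w)) =ᶠ[𝓝 q]
        fun r ↦ mulI E (fderiv ℝ f r w) := by
      have := ((chartAt E y).symm.trans (chartAt E x₀)).open_source.mem_nhds
        (x := q) (by simp [q, h₀])
      filter_upwards [this] with r hr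
      simp only [OpenPartialHomeomorph.trans_source, OpenPartialHomeomorph.symm_source,
        mem_inter_iff, mem_preimage] at hr
      have := fderiv_transition_I_smul E y x₀ _ ((chartAt E y).map_target hr.1) hr.2 w
      rwa [(chartAt E y).right_inv hr.1] at this
    have h2 := h1.fderiv_eq (𝕜 := ℝ)
    have h3 : HasFDerivAt (fun r ↦ mulI E (fderiv ℝ f r w))
        ((mulI E).comp ((ContinuousLinearMap.apply ℝ E w).comp (fderiv ℝ (fderiv ℝ f) q))) q :=
      (mulI E).hasFDerivAt.comp q
        ((ContinuousLinearMap.apply ℝ E w).hasFDerivAt.comp q hd.hasFDerivAt)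
    have h4 : HasFDerivAt (fun r ↦ fderiv ℝ f r (Complex.I • w))
        ((ContinuousLinearMap.apply ℝ E (Complex.I • w)).comp (fderiv ℝ (fderiv ℝ f) q)) q :=
      (ContinuousLinearMap.apply ℝ E (Complex.I • w)).hasFDerivAt.comp q hd.hasFDerivAt
    rw [h3.fderiv, h4.fderiv] at h2
    exact congrArg (fun L ↦ L u) h2
  let B : TangentSpace 𝓘(ℝ, E) y →ₗ[ℝ] TangentSpace 𝓘(ℝ, E) y →ₗ[ℝ] E :=
    toBilin (fderiv ℝ (fderiv ℝ f) q)
  have hJ := κ.sum_frame_J y B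
  -- Complex bilinearity gives √-1·√-1 = -1, whereas a metric trace does not change under J; hence
  -- the trace is its own negative.
  have hneg (u : E) : B (J E y u) (J E y u) = -B u u := by
    change fderiv ℝ (fderiv ℝ f) q (Complex.I • u) (Complex.I • u) =
      -fderiv ℝ (fderiv ℝ f) q u u
    rw [hI, hs.eq, hI, I_smul_I_smul]
  have h5 : ∑ a, B (J E y (κ.frame y a)) (J E y (κ.frame y a)) =
      -∑ a, B (κ.frame y a) (κ.frame y a) := by
    rw [← Finset.sum_neg_distrib]
    exact Finset.sum_congr rfl fun a _ ↦ hneg (κ.frame y a)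
  rw [h5] at hJ
  have h6 : (2 : ℝ) • ∑ a, B (κ.frame y a) (κ.frame y a) = 0 := by
    rw [two_smul]
    nth_rewrite 1 [← hJ]
    exact neg_add_cancel _
  exact (smul_eq_zero.1 h6).resolve_left two_ne_zero

/-- The divergence can be computed in any holomorphic chart. -/
theorem KahlerForm.divergence_eq [FiniteDimensional ℂ E] (κ : KahlerForm E X)
    {α : ∀ x : X, TangentSpace 𝓘(ℝ, E) x →L[ℝ] W} (hα : IsC1OneForm α) (x₀ y : X)
    (h₀ : y ∈ (chartAt E x₀).source) :
    κ.divergence α y = ∑ a, fderiv ℝ (localOneForm α x₀) (chartAt E x₀ y)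
      ((coordEquiv E x₀ y h₀).symm (κ.frame y a)) ((coordEquiv E x₀ y h₀).symm (κ.frame y a)) := by
  have hC := contDiffAt_transition E y x₀ y (mem_chart_source E y) h₀
  have hp : chartAt E x₀ y ∈ (chartAt E x₀).target := (chartAt E x₀).map_source h₀
  have hq := mem_chart_target E y
  have hpq : transition E y x₀ (chartAt E y y) = chartAt E x₀ y := by simp [transition]
  have hsymm (u : TangentSpace 𝓘(ℝ, E) y) :
      fderiv ℝ (transition E y x₀) (chartAt E y y) u = (coordEquiv E x₀ y h₀).symm u := by
    refine ((coordEquiv E x₀ y h₀).eq_symm_apply).2 ?_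
    exact (coordField_change E y x₀ y (mem_chart_source E y) h₀ u).symm.trans
      (coordField_self E y u)
  have hd : DifferentiableAt ℝ (fderiv ℝ (transition E y x₀)) (chartAt E y y) :=
    (hC.fderiv_right (m := 1) (by norm_cast)).differentiableAt (by simp)
  have hαd : DifferentiableAt ℝ (localOneForm α x₀) (transition E y x₀ (chartAt E y y)) := by
    rw [hpq]
    exact (hα.contDiffAt x₀ hp).differentiableAt (by simp)
  have hcomp := hαd.hasFDerivAt.comp (chartAt E y y) (hC.differentiableAt (by simp)).hasFDerivAt
  have hkey := hcomp.clm_comp hd.hasFDerivAt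
  have h₁ : (chartAt E y).symm (chartAt E y y) ∈ (chartAt E x₀).source := by
    rwa [(chartAt E y).left_inv (mem_chart_source E y)]
  have hev := eventually_localOneForm_change α y x₀ hq h₁
  have hfd : fderiv ℝ (localOneForm α y) (chartAt E y y) = _ :=
    (hkey.congr_of_eventuallyEq hev).fderiv
  unfold KahlerForm.divergence
  rw [hfd]
  -- Differentiating α_y = (α_{x₀} ∘ f)·Df yields a tensorial term and a term in D²f; the latter has
  -- zero trace because the charts are holomorphic.
  have hterm (u : TangentSpace 𝓘(ℝ, E) y) : (((ContinuousLinearMap.compL ℝ E E W)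
      ((localOneForm α x₀ ∘ transition E y x₀) (chartAt E y y)) ∘L
        fderiv ℝ (fderiv ℝ (transition E y x₀)) (chartAt E y y) +
      ((ContinuousLinearMap.compL ℝ E E W).flip
        (fderiv ℝ (transition E y x₀) (chartAt E y y))) ∘L
        (fderiv ℝ (localOneForm α x₀) (transition E y x₀ (chartAt E y y)) ∘L
          fderiv ℝ (transition E y x₀) (chartAt E y y))) u) u =
      localOneForm α x₀ (chartAt E x₀ y)
        (fderiv ℝ (fderiv ℝ (transition E y x₀)) (chartAt E y y) u u) +
      fderiv ℝ (localOneForm α x₀) (chartAt E x₀ y)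
        ((coordEquiv E x₀ y h₀).symm u) ((coordEquiv E x₀ y h₀).symm u) := by
    rw [← hsymm, ← hpq]
    rfl
  refine (Finset.sum_congr rfl fun a _ ↦ hterm (κ.frame y a)).trans ?_
  rw [Finset.sum_add_distrib, ← map_sum, sum_frame_fderiv_transition κ y x₀ h₀, map_zero, zero_add]

end OneForm

/-! ### The divergence theorem -/

section Divergence

variable {E : Type*} [NormedAddCommGroup E] [NormedSpace ℂ E] [FiniteDimensional ℂ E]
  {X : Type*} [TopologicalSpace X] [ChartedSpace E X] [IsManifold 𝓘(ℂ, E) ω X]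
  {W : Type*} [NormedAddCommGroup W] [NormedSpace ℝ W]
  {W' : Type*} [NormedAddCommGroup W'] [NormedSpace ℝ W']

theorem KahlerForm.divergence_eq_sum (κ : KahlerForm E X)
    {α : ∀ x : X, TangentSpace 𝓘(ℝ, E) x →L[ℝ] W} (hα : IsC1OneForm α) (x₀ : X) {y : X}
    (h₀ : y ∈ (chartAt E x₀).source) {ι : Type*} [Fintype ι] (b : Basis ι ℝ E)
    (β : ι → E →L[ℝ] ℝ) (hβ : ∀ c w, β c w = b.repr w c) :
    κ.divergence α y = ∑ c, fderiv ℝ (localOneForm α x₀) (chartAt E x₀ y) (b c)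
      (κ.sharp x₀ (chartAt E x₀ y) (β c)) := by
  rw [κ.divergence_eq hα x₀ y h₀]
  let B : TangentSpace 𝓘(ℝ, E) y →ₗ[ℝ] TangentSpace 𝓘(ℝ, E) y →ₗ[ℝ] W :=
    (toBilin (fderiv ℝ (localOneForm α x₀) (chartAt E x₀ y))).compl₁₂
      ((coordEquiv E x₀ y h₀).symm : TangentSpace 𝓘(ℝ, E) y →ₗ[ℝ] E)
      ((coordEquiv E x₀ y h₀).symm : TangentSpace 𝓘(ℝ, E) y →ₗ[ℝ] E)
  refine (κ.sum_frame_eq x₀ h₀ b B β hβ).trans (Finset.sum_congr rfl fun c _ ↦ ?_)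
  have h (u : E) : (coordEquiv E x₀ y h₀).symm (coordField E x₀ u y) = u := by
    rw [← coordEquiv_apply E x₀ y h₀, ContinuousLinearEquiv.symm_apply_apply]
  change fderiv ℝ (localOneForm α x₀) (chartAt E x₀ y) ((coordEquiv E x₀ y h₀).symm _)
    ((coordEquiv E x₀ y h₀).symm _) = _
  rw [h, h]

/-- The orthonormal frame is chosen point by point and need not be continuous, and the defining
chart varies with the point. Near `x₀` both are traded for a fixed basis in one chart and its dual
vectors under `sharp`. -/
theorem KahlerForm.continuous_divergence (κ : KahlerForm E X)
    {α : ∀ x : X, TangentSpace 𝓘(ℝ, E) x →L[ℝ] W} (hα : IsC1OneForm α) :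
    Continuous (κ.divergence α) := by
  have : FiniteDimensional ℝ E := FiniteDimensional.complexToReal E
  rw [continuous_iff_continuousAt]
  intro x₀
  let b := finBasis ℝ E
  let β (c) : E →L[ℝ] ℝ := LinearMap.toContinuousLinearMap (b.coord c)
  have hev : κ.divergence α =ᶠ[𝓝 x₀] fun y ↦
      ∑ c, fderiv ℝ (localOneForm α x₀) (chartAt E x₀ y) (b c)
      (κ.sharp x₀ (chartAt E x₀ y) (β c)) := by
    filter_upwards [(chartAt E x₀).open_source.mem_nhds (mem_chart_source E x₀)] with y hy
    exact κ.divergence_eq_sum hα x₀ hy b β fun c w ↦ rfl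
  refine ContinuousAt.congr ?_ hev.symm
  refine tendsto_finsetSum _ fun c _ ↦ ?_
  have hp := mem_chart_target E x₀
  have h1 : ContinuousAt (fderiv ℝ (localOneForm α x₀)) (chartAt E x₀ x₀) :=
    (hα x₀).continuousAt_fderiv (by simp)
  have h2 : ContinuousAt (fun q ↦ κ.sharp x₀ q (β c)) (chartAt E x₀ x₀) :=
    (κ.contDiffAt_sharp (n := 0) x₀ hp contDiffAt_const).continuousAt
  have h3 := (h1.clm_apply (continuousAt_const (y := b c))).clm_apply h2
  exact h3.comp (f := chartAt E x₀) ((chartAt E x₀).continuousAt (mem_chart_source E x₀))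

theorem localOneForm_clm_comp (T : W →L[ℝ] W') (α : ∀ x : X, TangentSpace 𝓘(ℝ, E) x →L[ℝ] W)
    (x₀ : X) : localOneForm (fun x ↦ T.comp (α x)) x₀ = fun p ↦ T.comp (localOneForm α x₀ p) := rfl

theorem IsC1OneForm.clm_comp (T : W →L[ℝ] W') {α : ∀ x : X, TangentSpace 𝓘(ℝ, E) x →L[ℝ] W}
    (hα : IsC1OneForm α) : IsC1OneForm (fun x ↦ T.comp (α x)) := fun x ↦ by
  rw [localOneForm_clm_comp]
  exact contDiffAt_const.clm_comp (hα x)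

theorem KahlerForm.divergence_clm_comp (κ : KahlerForm E X) (T : W →L[ℝ] W')
    {α : ∀ x : X, TangentSpace 𝓘(ℝ, E) x →L[ℝ] W} (hα : IsC1OneForm α) (x : X) :
    κ.divergence (fun x ↦ T.comp (α x)) x = T (κ.divergence α x) := by
  unfold KahlerForm.divergence
  rw [localOneForm_clm_comp, map_sum]
  refine Finset.sum_congr rfl fun a _ ↦ ?_
  have h : HasFDerivAt (fun p ↦ T.comp (localOneForm α x p))
      ((ContinuousLinearMap.compL ℝ E W W' T).comp (fderiv ℝ (localOneForm α x) (chartAt E x x)))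
      (chartAt E x x) :=
    (ContinuousLinearMap.compL ℝ E W W' T).hasFDerivAt.comp _
      ((hα x).differentiableAt (by simp)).hasFDerivAt
  rw [h.fderiv]
  rfl

theorem IsC1OneForm.smul {α : ∀ x : X, TangentSpace 𝓘(ℝ, E) x →L[ℝ] W} (hα : IsC1OneForm α)
    {f : X → ℝ} (hf : ContMDiff 𝓘(ℝ, E) 𝓘(ℝ, ℝ) ∞ f) : IsC1OneForm (fun x ↦ f x • α x) := fun x ↦ by
  have h : localOneForm (fun x ↦ f x • α x) x =
      fun p ↦ (f ∘ (chartAt E x).symm) p • localOneForm α x p := rfl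
  rw [h]
  have h2 := (contMDiffAt_iff_contDiffAt_chart (n := ⊤) E x x (mem_chart_source E x)).1 (hf x)
  exact (h2.of_le (by norm_cast)).smul (hα x)

theorem KahlerForm.divergence_sum (κ : KahlerForm E X) {ι : Type*} (t : Finset ι)
    {α : ι → ∀ x : X, TangentSpace 𝓘(ℝ, E) x →L[ℝ] W} (hα : ∀ i ∈ t, IsC1OneForm (α i)) (x : X) :
    κ.divergence (fun x ↦ ∑ i ∈ t, α i x) x = ∑ i ∈ t, κ.divergence (α i) x := by
  unfold KahlerForm.divergence
  have h : localOneForm (fun x ↦ ∑ i ∈ t, α i x) x = fun p ↦ ∑ i ∈ t, localOneForm (α i) x p := by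
    funext p
    exact ContinuousLinearMap.finsetSum_comp
      (g := fun i ↦ (α i ((chartAt E x).symm p) : E →L[ℝ] W)) _
  rw [h, Finset.sum_comm]
  refine Finset.sum_congr rfl fun a _ ↦ ?_
  rw [fderiv_fun_sum fun i hi ↦ (hα i hi x).differentiableAt (by simp)]
  have h2 (u : E) : (∑ i ∈ t, fderiv ℝ (localOneForm (α i) x) (chartAt E x x)) u u =
      ∑ i ∈ t, fderiv ℝ (localOneForm (α i) x) (chartAt E x x) u u := by
    rw [sum_apply, sum_apply]
  exact h2 _

theorem KahlerForm.divergence_eq_zero_of_eventuallyEq (κ : KahlerForm E X)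
    {α : ∀ x : X, TangentSpace 𝓘(ℝ, E) x →L[ℝ] W} {x : X} (h : ∀ᶠ y in 𝓝 x, α y = 0) :
    κ.divergence α x = 0 := by
  have hc := ((chartAt E x).continuousAt_symm (mem_chart_target E x)).tendsto
  rw [(chartAt E x).left_inv (mem_chart_source E x)] at hc
  have h1 : localOneForm α x =ᶠ[𝓝 (chartAt E x x)] fun _ ↦ 0 := by
    filter_upwards [hc.eventually h] with p hp
    simp only [localOneForm]
    erw [hp]
    exact ContinuousLinearMap.zero_comp _
  unfold KahlerForm.divergence
  rw [h1.fderiv_eq (𝕜 := ℝ), fderiv_const_apply]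
  exact Finset.sum_eq_zero fun _ _ ↦ rfl

/-- Integration by parts of each component against the constant 1. -/
theorem integral_sum_fderiv_eq_zero {G : Type*} [NormedAddCommGroup G] [NormedSpace ℝ G]
    [FiniteDimensional ℝ G] [MeasurableSpace G] [BorelSpace G] (μ : Measure G)
    [μ.IsAddHaarMeasure] {ι : Type*} [Fintype ι] (b : Basis ι ℝ G) {v : G → G}
    (hv : ContDiff ℝ 1 v) (hc : HasCompactSupport v) :
    ∫ p, ∑ i, b.repr (fderiv ℝ v p (b i)) i ∂μ = 0 := by
  let β (i) : G →L[ℝ] ℝ := LinearMap.toContinuousLinearMap (b.coord i)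
  have hβ (i) : ContDiff ℝ 1 (fun p ↦ β i (v p)) := (β i).contDiff.comp hv
  have hβc (i) : HasCompactSupport (fun p ↦ β i (v p)) := hc.comp_left (map_zero (β i))
  have hfd (i) (p) : fderiv ℝ (fun p ↦ β i (v p)) p (b i) = b.repr (fderiv ℝ v p (b i)) i := by
    have := (β i).hasFDerivAt.comp p (hv.differentiable (by simp) p).hasFDerivAt
    rw [show (fun p ↦ β i (v p)) = β i ∘ v from rfl, this.fderiv]
    rfl
  have hint (i) : Integrable (fun p ↦ fderiv ℝ (fun p ↦ β i (v p)) p (b i)) μ := by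
    refine Continuous.integrable_of_hasCompactSupport ?_ ?_
    · exact ((hβ i).continuous_fderiv (by simp)).clm_apply continuous_const
    · exact (hβc i).fderiv_apply ℝ (b i)
  simp only [← hfd]
  rw [integral_finsetSum _ fun i _ ↦ hint i]
  refine Finset.sum_eq_zero fun i _ ↦ ?_
  have h := integral_mul_fderiv_eq_neg_fderiv_mul_of_integrable (μ := μ) (v := b i)
    (f := fun _ ↦ (1 : ℝ)) (g := fun p ↦ β i (v p)) (by simp) (by simpa using hint i)
    (by simpa using (hβ i).continuous.integrable_of_hasCompactSupport (hβc i))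
    (by simp) (fun p _ ↦ (hβ i).differentiable (by simp) p)
  simpa using h

variable [MeasurableSpace E] [BorelSpace E] [MeasurableSpace X] [BorelSpace X] [CompactSpace X]
  [T2Space X]

/-- The divergence theorem for `1`-forms supported in a chart. -/
theorem KahlerForm.integral_divergence_eq_zero_of_support (κ : KahlerForm E X)
    {α : ∀ x : X, TangentSpace 𝓘(ℝ, E) x →L[ℝ] ℝ} (hα : IsC1OneForm α) (x₀ : X) {C : Set X}
    (hC : IsClosed C) (hCs : C ⊆ (chartAt E x₀).source) (hαC : ∀ x ∉ C, α x = 0) :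
    ∫ x, κ.divergence α x ∂κ.vol = 0 := by
  have : FiniteDimensional ℝ E := FiniteDimensional.complexToReal E
  set φ := chartAt E x₀
  have hdiv (x) (hx : x ∉ C) : κ.divergence α x = 0 :=
    κ.divergence_eq_zero_of_eventuallyEq (by
      filter_upwards [hC.isOpen_compl.mem_nhds hx] with y hy using hαC y hy)
  rw [κ.integral_vol_eq x₀ (κ.continuous_divergence hα).aestronglyMeasurable
    fun x hx ↦ hdiv x fun h ↦ hx (hCs h)]
  set C' := φ '' C
  have hC' : IsCompact C' := hC.isCompact.image_of_continuousOn (φ.continuousOn.mono hCs)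
  have hC't : C' ⊆ φ.target := by
    rintro _ ⟨x, hx, rfl⟩
    exact φ.map_source (hCs hx)
  have hnot {p} (hp : p ∈ φ.target) (hpC : p ∉ C') : φ.symm p ∉ C :=
    fun h ↦ hpC ⟨_, h, φ.right_inv hp⟩
  let ξ (p : E) : E := κ.sharp x₀ p (localOneForm α x₀ p)
  -- The field ρξ extended by zero: it is C¹ on all of `E`, because α vanishes off a compact set
  -- inside the chart target.
  let v (p : E) : E := φ.target.indicator
    (fun q ↦ κ.volumeDensity x₀ (φ.symm q) • ξ q) p
  have hv0 (p) (hp : p ∉ C') : v p = 0 := by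
    by_cases hpt : p ∈ φ.target
    · simp only [v, indicator_of_mem hpt]
      have h1 : localOneForm α x₀ p = 0 := by
        simp only [localOneForm]
        erw [hαC _ (hnot hpt hp)]
        exact ContinuousLinearMap.zero_comp _
      have h2 : ξ p = 0 := by
        simp only [ξ, h1, KahlerForm.sharp]
        exact map_zero _
      rw [h2, smul_zero]
    · simp [v, indicator_of_notMem hpt]
  have hξ {p} (hp : p ∈ φ.target) : ContDiffAt ℝ 1 ξ p :=
    κ.contDiffAt_sharp x₀ hp (hα.contDiffAt x₀ hp)
  have hvev {p} (hp : p ∈ φ.target) :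
      v =ᶠ[𝓝 p] fun q ↦ κ.volumeDensity x₀ (φ.symm q) • ξ q := by
    filter_upwards [φ.open_target.mem_nhds hp] with q hq using indicator_of_mem hq _
  have hv : ContDiff ℝ 1 v := by
    rw [contDiff_iff_contDiffAt]
    intro p
    by_cases hpt : p ∈ φ.target
    · refine ContDiffAt.congr_of_eventuallyEq ?_ (hvev hpt)
      exact (((κ.contDiffOn_volumeDensity x₀).contDiffAt
        (φ.open_target.mem_nhds hpt)).of_le (by norm_cast)).smul (hξ hpt)
    · refine ContDiffAt.congr_of_eventuallyEq (contDiffAt_const (c := (0 : E))) ?_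
      filter_upwards [hC'.isClosed.isOpen_compl.mem_nhds fun h ↦ hpt (hC't h)] with q hq
      exact hv0 q hq
  have hvc : HasCompactSupport v := HasCompactSupport.intro hC' hv0
  let b := realBasis E
  have hkey {p} (hp : p ∈ φ.target) :
      κ.volumeDensity x₀ (φ.symm p) • κ.divergence α (φ.symm p) =
        ∑ i, b.repr (fderiv ℝ v p (b i)) i := by
    have hy := φ.map_target hp
    set y := φ.symm p
    have hpy : φ y = p := φ.right_inv hp
    let e₀ : Basis _ ℝ E := (κ.frame y).map (coordEquiv E x₀ y hy).symm.toLinearEquiv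
    -- `kahler_divergence` compares two bases with a common index type, whereas the frame and
    -- `realBasis` are indexed differently.
    let e := e₀.reindex (e₀.indexEquiv b)
    have hnhds := φ.open_target.mem_nhds hp
    have hg : HasFDerivAt (κ.localMetric x₀) (fderiv ℝ (κ.localMetric x₀) p) p :=
      (((κ.contDiffOn_localMetric x₀).contDiffAt hnhds).differentiableAt (by simp)).hasFDerivAt
    have he0 (i j) : κ.localMetric x₀ p (e₀ i) (e₀ j) = if i = j then 1 else 0 := by
      have h (i) : coordField E x₀ (e₀ i) y = κ.frame y i := by
        rw [← coordEquiv_apply E x₀ y hy]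
        exact (coordEquiv E x₀ y hy).apply_symm_apply _
      rw [← hpy, κ.localMetric_eq_tangentMetric_of_mem x₀ hy, h, h, κ.tangentMetric_frame]
    have he (i j) : κ.localMetric x₀ p (e i) (e j) = if i = j then 1 else 0 := by
      simp only [e, Basis.reindex_apply, he0, EmbeddingLike.apply_eq_iff_eq]
    have hmain := kahler_divergence hg
      (by filter_upwards [hnhds] with q hq using κ.localMetric_symm x₀ hq)
      (mulI E) mulI_mulI
      (by filter_upwards [hnhds] with q hq using κ.localMetric_I x₀ hq)
      (κ.localMetric_closed x₀ hp) b e he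
      ((hα.contDiffAt x₀ hp).differentiableAt (by simp)).hasFDerivAt
      ((hξ hp).differentiableAt (by simp)).hasFDerivAt
      (by filter_upwards [hnhds] with q hq using κ.localMetric_sharp x₀ hq _)
    have hdens := κ.volumeDensity_eq_sqrt x₀ hp
    rw [(hvev hp).fderiv_eq (𝕜 := ℝ)]
    have hfun : (fun q ↦ κ.volumeDensity x₀ (φ.symm q) • ξ q) =ᶠ[𝓝 p]
        fun q ↦ √(gram b (fun u w ↦ κ.localMetric x₀ q u w)).det • ξ q := by
      filter_upwards [hnhds] with q hq
      rw [κ.volumeDensity_eq_sqrt x₀ hq]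
    rw [hfun.fderiv_eq (𝕜 := ℝ), ← hmain, smul_eq_mul, hdens, κ.divergence_eq hα x₀ y hy, hpy]
    congr 1
    refine ((e₀.indexEquiv b).symm.sum_comp fun a ↦
      fderiv ℝ (localOneForm α x₀) p (e₀ a) (e₀ a)).symm.trans ?_
    simp only [e, Basis.reindex_apply]
  rw [setIntegral_congr_fun φ.open_target.measurableSet fun p hp ↦ hkey hp,
    setIntegral_eq_integral_of_forall_compl_eq_zero]
  · exact integral_sum_fderiv_eq_zero (lebesgue E) b hv hvc
  · intro p hp
    have : v =ᶠ[𝓝 p] fun _ ↦ 0 := by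
      filter_upwards [hC'.isClosed.isOpen_compl.mem_nhds fun h ↦ hp (hC't h)] with q hq
      exact hv0 q hq
    rw [this.fderiv_eq (𝕜 := ℝ)]
    simp

/-- The divergence theorem on a compact Kähler manifold. -/
theorem KahlerForm.integral_divergence_real (κ : KahlerForm E X)
    {α : ∀ x : X, TangentSpace 𝓘(ℝ, E) x →L[ℝ] ℝ} (hα : IsC1OneForm α) :
    ∫ x, κ.divergence α x ∂κ.vol = 0 := by
  have : FiniteDimensional ℝ E := FiniteDimensional.complexToReal E
  obtain ⟨t, ht⟩ := isCompact_univ.elim_nhds_subcover (fun x : X ↦ (chartAt E x).source)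
    fun x _ ↦ (chartAt E x).open_source.mem_nhds (mem_chart_source E x)
  obtain ⟨f, hf⟩ := SmoothPartitionOfUnity.exists_isSubordinate 𝓘(ℝ, E) (isClosed_univ (X := X))
    (fun i : t ↦ (chartAt E (i : X)).source) (fun i ↦ (chartAt E (i : X)).open_source)
    (fun x hx ↦ by simpa using ht.2 hx)
  have hsum (x : X) : ∑ i, f i x = 1 := by
    rw [← finsum_eq_sum_of_fintype]
    exact f.sum_eq_one (mem_univ x)
  have hαf (i) : IsC1OneForm (fun x ↦ f i x • α x) := hα.smul (f i).contMDiff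
  have hdec : α = fun x ↦ ∑ i, f i x • α x := by
    funext x
    rw [← Finset.sum_smul, hsum, one_smul]
  rw [hdec]
  simp only [κ.divergence_sum Finset.univ fun i _ ↦ hαf i]
  rw [integral_finsetSum _ fun i _ ↦ κ.integrable_of_continuous (κ.continuous_divergence (hαf i))]
  refine Finset.sum_eq_zero fun i _ ↦ κ.integral_divergence_eq_zero_of_support (hαf i) i
    (isClosed_tsupport (f i)) (hf i) fun x hx ↦ ?_
  rw [image_eq_zero_of_notMem_tsupport hx, zero_smul]

theorem KahlerForm.integral_divergence_eq_zero (κ : KahlerForm E X)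
    {α : ∀ x : X, TangentSpace 𝓘(ℝ, E) x →L[ℝ] ℂ} (hα : IsC1OneForm α) :
    ∫ x, κ.divergence α x ∂κ.vol = 0 := by
  have hi := κ.integrable_of_continuous (κ.continuous_divergence hα)
  have hre := κ.integral_divergence_real (hα.clm_comp Complex.reCLM)
  have him := κ.integral_divergence_real (hα.clm_comp Complex.imCLM)
  simp only [κ.divergence_clm_comp _ hα] at hre him
  rw [ContinuousLinearMap.integral_comp_comm _ hi] at hre him
  exact Complex.ext hre him

end Divergence

/-! ### Matrix identities for unitary connections and the contracted pseudo-curvature -/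

section LocalCalculus

variable {E : Type*} [NormedAddCommGroup E] [NormedSpace ℂ E]
  {𝒜 : Type*} [NormedRing 𝒜] [NormedAlgebra ℂ 𝒜] [StarRing 𝒜] [NormedStarGroup 𝒜]
  [StarModule ℂ 𝒜]

/-- Complex conjugation of endomorphisms as a real linear map. -/
noncomputable def starReal (𝒜 : Type*) [NormedRing 𝒜] [NormedAlgebra ℂ 𝒜] [StarRing 𝒜]
    [NormedStarGroup 𝒜] [StarModule ℂ 𝒜] : 𝒜 →L[ℝ] 𝒜 :=
  ((starL' ℝ : 𝒜 ≃L[ℝ] 𝒜) : 𝒜 →L[ℝ] 𝒜)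

@[simp] theorem starReal_apply (a : 𝒜) : starReal 𝒜 a = star a := rfl

theorem hasFDerivAt_apply {φ : E → E →L[ℝ] 𝒜} {φ' : E →L[ℝ] E →L[ℝ] 𝒜} {p : E}
    (h : HasFDerivAt φ φ' p) (w : E) : HasFDerivAt (fun q ↦ φ q w) (φ'.flip w) p :=
  ((ContinuousLinearMap.apply ℝ 𝒜 w).hasFDerivAt.comp p h).congr_fderiv rfl

/-- The covariant derivative of a self-adjoint form, with respect to a unitary connection, is
self-adjoint. -/
theorem star_covariant_mul {η : E → 𝒜} {Γ ψ : E → E →L[ℝ] 𝒜} {ψ' : E →L[ℝ] E →L[ℝ] 𝒜} {p : E}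
    {η' : E →L[ℝ] 𝒜} (hη : HasFDerivAt η η' p) (hψ : HasFDerivAt ψ ψ' p)
    (hΓ : ∀ u, η' u = star (Γ p u) * η p + η p * Γ p u)
    (hsa : ∀ᶠ q in 𝓝 p, ∀ w, star (ψ q w) * η q = η q * ψ q w) (u w : E) :
    star (ψ' u w + (Γ p u * ψ p w - ψ p w * Γ p u)) * η p =
      η p * (ψ' u w + (Γ p u * ψ p w - ψ p w * Γ p u)) := by
  have hψw := hasFDerivAt_apply hψ w
  have h1 := ((starReal 𝒜).hasFDerivAt.comp p hψw).mul' hη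
  have h2 := hη.mul' hψw
  have h3 : (fun q ↦ starReal 𝒜 (ψ q w) * η q) =ᶠ[𝓝 p] fun q ↦ η q * ψ q w := by
    filter_upwards [hsa] with q hq using hq w
  have h4 := congrArg (fun T ↦ T u) ((h1.congr_of_eventuallyEq h3.symm).unique h2)
  have h5 := hsa.self_of_nhds w
  have h6 : star (ψ p w) * η' u + star (ψ' u w) * η p = η p * ψ' u w + η' u * ψ p w := h4
  rw [hΓ] at h6
  simp only [star_add, star_sub, star_mul, add_mul, sub_mul, mul_add, mul_sub] at h6 ⊢
  have e1 : star (ψ p w) * (η p * Γ p u) = η p * ψ p w * Γ p u := by rw [← mul_assoc, h5]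
  have e2 : star (Γ p u) * star (ψ p w) * η p = star (Γ p u) * η p * ψ p w := by
    rw [mul_assoc, h5, ← mul_assoc]
  rw [e1] at h6
  rw [e2]
  simp only [← mul_assoc] at h6 ⊢
  linear_combination (norm := abel) h6

/-- The curvature of a unitary connection is skew-adjoint. -/
theorem star_curvature_mul {η : E → 𝒜} {Γ : E → E →L[ℝ] 𝒜} {Γ' : E →L[ℝ] E →L[ℝ] 𝒜} {p : E}
    (hη : ContDiffAt ℝ 2 η p) (hΓ' : HasFDerivAt Γ Γ' p)
    (hΓ : ∀ᶠ q in 𝓝 p, ∀ u, fderiv ℝ η q u = star (Γ q u) * η q + η q * Γ q u) (u w : E) :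
    star (Γ' u w - Γ' w u + (Γ p u * Γ p w - Γ p w * Γ p u)) * η p =
      -(η p * (Γ' u w - Γ' w u + (Γ p u * Γ p w - Γ p w * Γ p u))) := by
  have hs : IsSymmSndFDerivAt ℝ η p := hη.isSymmSndFDerivAt (by
    rw [minSmoothness_of_isRCLikeNormedField])
  have hd : HasFDerivAt (fderiv ℝ η) (fderiv ℝ (fderiv ℝ η) p) p :=
    ((hη.fderiv_right (m := 1) (by norm_cast)).differentiableAt (by simp)).hasFDerivAt
  have hη1 : HasFDerivAt η (fderiv ℝ η p) p := (hη.differentiableAt (by simp)).hasFDerivAt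
  have hp := hΓ.self_of_nhds
  -- Differentiate ∂η = Γ*η + ηΓ once more; symmetry of the second derivative of η is the claim
  -- about the curvature of Γ.
  have key (u w : E) : fderiv ℝ (fderiv ℝ η) p u w =
      (star (Γ p w) * fderiv ℝ η p u + star (Γ' u w) * η p) +
        (η p * Γ' u w + fderiv ℝ η p u * Γ p w) := by
    have hΓw := hasFDerivAt_apply hΓ' w
    have h1 := (((starReal 𝒜).hasFDerivAt.comp p hΓw).mul' hη1).add (hη1.mul' hΓw)
    have h2 : (fun q ↦ fderiv ℝ η q w) =ᶠ[𝓝 p]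
        fun q ↦ starReal 𝒜 (Γ q w) * η q + η q * Γ q w := by
      filter_upwards [hΓ] with q hq using hq w
    exact congrArg (fun T ↦ T u) ((hasFDerivAt_apply hd w).unique (h1.congr_of_eventuallyEq h2))
  have h := hs.eq u w
  rw [key, key, hp, hp] at h
  simp only [star_add, star_sub, star_mul, add_mul, sub_mul, mul_add, mul_sub, ← mul_assoc] at h ⊢
  linear_combination (norm := abel) h

/-- The contraction of the pseudo-curvature, for a Yang-Mills connection. The family `e` plays the
role of an orthonormal frame. -/
theorem contract_pseudoCurvature {ι : Type*} [Fintype ι] (e : ι → E)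
    (hJ : ∀ B : E →L[ℝ] E →L[ℝ] 𝒜,
      ∑ a, B (Complex.I • e a) (Complex.I • e a) = ∑ a, B (e a) (e a))
    {η : E → 𝒜} {A ψ : E → E →L[ℝ] 𝒜} {A' ψ' : E →L[ℝ] E →L[ℝ] 𝒜} {p : E}
    (hη : ContDiffAt ℝ 2 η p) (hu : IsUnit (η p)) (hA : HasFDerivAt A A' p)
    (hψ : HasFDerivAt ψ ψ' p)
    (hΓ : ∀ᶠ q in 𝓝 p, ∀ u, fderiv ℝ η q u = star (A q u - ψ q u) * η q + η q * (A q u - ψ q u))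
    (hsa : ∀ᶠ q in 𝓝 p, ∀ w, star (ψ q w) * η q = η q * ψ q w)
    {F G : E → E → 𝒜} {C : E → 𝒜} {C' : E → E → 𝒜}
    (hF : ∀ u w, F u w = A' u w - A' w u + (A p u * A p w - A p w * A p u))
    (hC : ∀ u, C u = (1 / 2 : ℂ) • A p u + (Complex.I / 2) • A p (Complex.I • u) -
      Complex.I • ψ p (Complex.I • u))
    (hC' : ∀ u w, C' u w = (1 / 2 : ℂ) • A' u w + (Complex.I / 2) • A' u (Complex.I • w) -
      Complex.I • ψ' u (Complex.I • w))
    (hG : ∀ u w, G u w = ((1 / 2 : ℂ) • C' u w + (Complex.I / 2) • C' (Complex.I • u) w) -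
      ((1 / 2 : ℂ) • C' w u + (Complex.I / 2) • C' (Complex.I • w) u) + (C u * C w - C w * C u))
    (c : ℝ) (hYM : ∑ a, F (e a) (Complex.I • e a) = (Complex.I * c) • (1 : 𝒜)) :
    (-2 * Complex.I) • ∑ a, G (e a) (Complex.I • e a) =
      (2 : ℂ) • ∑ a, (ψ' (e a) (e a) + (A p (e a) * ψ p (e a) - ψ p (e a) * A p (e a))) := by
  -- The connection form of D_H. Below, `N` is the D_H-covariant derivative of ψ in coordinates,
  -- self-adjoint with respect to η.
  let Γ (q : E) : E →L[ℝ] 𝒜 := A q - ψ q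
  have hΓ' : HasFDerivAt Γ (A' - ψ') p := hA.sub hψ
  let N (u w : E) : 𝒜 := ψ' u w + (Γ p u * ψ p w - ψ p w * Γ p u)
  have hη1 : HasFDerivAt η (fderiv ℝ η p) p := (hη.differentiableAt (by simp)).hasFDerivAt
  have hN (u w : E) : star (N u w) * η p = η p * N u w :=
    star_covariant_mul (Γ := Γ) hη1 hψ hΓ.self_of_nhds hsa u w
  have hFΓ := star_curvature_mul (Γ := Γ) hη hΓ' hΓ
  have hsp := hsa.self_of_nhds
  have hI (u : E) : Complex.I • Complex.I • u = -u := I_smul_I_smul u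
  -- bilinear form `N` and its traces
  let NB : E →L[ℝ] E →L[ℝ] 𝒜 := ψ' + ((ContinuousLinearMap.mul ℝ 𝒜).bilinearComp (Γ p) (ψ p) -
    ((ContinuousLinearMap.mul ℝ 𝒜).bilinearComp (ψ p) (Γ p)).flip)
  have hNB (u w : E) : NB u w = N u w := rfl
  let mI : E →L[ℝ] E := mulI E
  have hN1 : ∑ a, N (Complex.I • e a) (Complex.I • e a) = ∑ a, N (e a) (e a) := hJ NB
  have hN2 : ∑ a, N (Complex.I • e a) (e a) = -∑ a, N (e a) (Complex.I • e a) := by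
    have h := hJ (NB.bilinearComp (ContinuousLinearMap.id ℝ E) (mulI E))
    have h' : ∑ a, N (Complex.I • e a) (Complex.I • Complex.I • e a) =
      ∑ a, N (e a) (Complex.I • e a) := h
    rw [← h', ← Finset.sum_neg_distrib]
    refine Finset.sum_congr rfl fun a _ ↦ ?_
    rw [hI, ← hNB, ← hNB, map_neg, neg_neg]
  -- the self-adjoint part of the Yang-Mills equation
  have hN0 : ∑ a, N (e a) (Complex.I • e a) = 0 := by
    -- The curvature of D_H plus ψ∧ψ: the skew-adjoint part of F, the self-adjoint part being the
    -- antisymmetrization of `N`. Since √-1c·1 is skew-adjoint for real `c`, the self-adjoint part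
    -- of the contracted equation is zero.
    let R (u w : E) : 𝒜 := ((A' - ψ') u w - (A' - ψ') w u + (Γ p u * Γ p w - Γ p w * Γ p u)) +
      (ψ p u * ψ p w - ψ p w * ψ p u)
    have hR (u w : E) : star (R u w) * η p = -(η p * R u w) := by
      have h1 := hFΓ u w
      have h2 := hsp u
      have h3 := hsp w
      simp only [R, add_mul, star_add, mul_add] at h1 ⊢
      have h4 : star (ψ p u * ψ p w - ψ p w * ψ p u) * η p =
          -(η p * (ψ p u * ψ p w - ψ p w * ψ p u)) := by
        simp only [star_sub, star_mul, sub_mul, mul_sub, mul_assoc, h2, h3]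
        simp only [← mul_assoc, h2, h3]
        abel
      rw [h4]
      linear_combination (norm := abel) h1
    have hFR (u w : E) : F u w = R u w + (N u w - N w u) := by
      rw [hF]
      simp only [R, N, Γ, sub_apply]
      noncomm_ring
    have hsum : ∑ a, R (e a) (Complex.I • e a) + (2 : ℂ) • ∑ a, N (e a) (Complex.I • e a) =
        (Complex.I * c) • (1 : 𝒜) := by
      rw [← hYM]
      simp only [hFR, Finset.sum_add_distrib, Finset.sum_sub_distrib, hN2]
      rw [two_smul]; abel
    set SR := ∑ a, R (e a) (Complex.I • e a)
    set SN := ∑ a, N (e a) (Complex.I • e a)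
    have hSR : star SR * η p = -(η p * SR) := by
      simp only [SR, star_sum, Finset.sum_mul, Finset.mul_sum, hR, Finset.sum_neg_distrib]
    have hSN : star SN * η p = η p * SN := by
      simp only [SN, star_sum, Finset.sum_mul, Finset.mul_sum, hN]
    have hstar := congrArg (fun T ↦ star T * η p) hsum
    have hmul := congrArg (fun T ↦ η p * T) hsum
    simp only [star_add, star_smul, add_mul, smul_mul_assoc, hSR, hSN, star_one, one_mul,
      mul_add, mul_smul_comm, mul_one] at hstar hmul
    have h2 : star (2 : ℂ) = 2 := by simp
    have h3 : star (Complex.I * c) = -(Complex.I * c) := by simp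
    rw [h2, h3] at hstar
    have h4 : (4 : ℂ) • (η p * SN) = 0 := by
      have := congrArg₂ (· + ·) hstar hmul
      simp only [neg_smul, neg_add_cancel] at this
      rw [← this]
      module
    have h5 : η p * SN = 0 := (smul_eq_zero.1 h4).resolve_left (by norm_num)
    exact (hu.mul_right_eq_zero).1 h5
  -- Forms of type (2,0) and (0,2) vanish on (u, √-1u), so neither ψ^{1,0}∧ψ^{1,0} nor ∂̄_H² is
  -- seen; only the (1,1)-part, a combination of values of `N`, remains.
  have hGN (u : E) : G u (Complex.I • u) = (Complex.I / 2) • (N u u +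
      N (Complex.I • u) (Complex.I • u)) + (1 / 2 : ℂ) • (N u (Complex.I • u) -
      N (Complex.I • u) u) := by
    rw [hG]
    simp only [hC, hC', hI, N, Γ, sub_apply, map_neg, neg_apply, smul_add, smul_sub, mul_add,
      mul_sub, add_mul, sub_mul, smul_mul_assoc, mul_smul_comm, smul_neg, neg_mul, mul_neg,
      smul_smul]
    match_scalars <;> ring_nf <;> simp only [Complex.I_sq] <;> ring_nf
  -- On the diagonal D and D_H act alike on ψ, since they differ by [ψ(u), ψ(u)] = 0.
  have hND (u : E) : ψ' u u + (A p u * ψ p u - ψ p u * A p u) = N u u := by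
    simp only [N, Γ, sub_apply]
    noncomm_ring
  simp only [hGN, hND, Finset.sum_add_distrib, ← Finset.smul_sum, Finset.sum_sub_distrib, hN0, hN1,
    hN2]
  simp only [neg_zero, sub_zero, smul_zero, add_zero, ← two_smul ℂ, smul_smul]
  congr 1
  ring_nf
  simp [Complex.I_sq]

end LocalCalculus

/-! ### Time and space derivatives on [0,1] × U -/

section TimeSpace

variable {E : Type*} [NormedAddCommGroup E] [NormedSpace ℝ E]
  {W : Type*} [NormedAddCommGroup W] [NormedSpace ℝ W]

/-- The time derivative of a function on `[0,1] × U`. -/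
noncomputable def timeDeriv (U : Set E) (f : ℝ × E → W) (z : ℝ × E) : W :=
  fderivWithin ℝ f (Icc (0 : ℝ) 1 ×ˢ U) z (1, 0)

/-- The space derivative of a function on `[0,1] × U`. -/
noncomputable def spaceDeriv (U : Set E) (f : ℝ × E → W) (z : ℝ × E) : E →L[ℝ] W :=
  (fderivWithin ℝ f (Icc (0 : ℝ) 1 ×ˢ U) z).comp (ContinuousLinearMap.inr ℝ ℝ E)

variable {U : Set E} (hU : IsOpen U) {f : ℝ × E → W}
  (hf : ContDiffOn ℝ ∞ f (Icc (0 : ℝ) 1 ×ˢ U))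

include hU in
theorem uniqueDiffOn_Icc_prod : UniqueDiffOn ℝ (Icc (0 : ℝ) 1 ×ˢ U) :=
  (uniqueDiffOn_Icc zero_lt_one).prod hU.uniqueDiffOn

include hU hf in
theorem contDiffOn_timeDeriv : ContDiffOn ℝ ∞ (timeDeriv U f) (Icc (0 : ℝ) 1 ×ˢ U) :=
  (hf.fderivWithin (uniqueDiffOn_Icc_prod hU) (by norm_cast)).clm_apply contDiffOn_const

include hU hf in
theorem contDiffOn_spaceDeriv : ContDiffOn ℝ ∞ (spaceDeriv U f) (Icc (0 : ℝ) 1 ×ˢ U) :=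
  (hf.fderivWithin (uniqueDiffOn_Icc_prod hU) (by norm_cast)).clm_comp contDiffOn_const

include hf in
theorem hasDerivWithinAt_time {t : ℝ} (ht : t ∈ Icc (0 : ℝ) 1) {p : E} (hp : p ∈ U) :
    HasDerivWithinAt (fun τ ↦ f (τ, p)) (timeDeriv U f (t, p)) (Icc 0 1) t := by
  have h := (hf.differentiableOn (by simp) (t, p) ⟨ht, hp⟩).hasFDerivWithinAt
  have h2 : HasDerivWithinAt (fun τ : ℝ ↦ (τ, p)) (1, 0) (Icc 0 1) t :=
    (hasDerivWithinAt_id t _).prodMk (hasDerivWithinAt_const t _ p)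
  have hm : MapsTo (fun τ : ℝ ↦ (τ, p)) (Icc 0 1) (Icc (0 : ℝ) 1 ×ˢ U) := fun τ hτ ↦ ⟨hτ, hp⟩
  exact h.comp_hasDerivWithinAt t h2 hm

include hU hf in
theorem hasFDerivAt_space {t : ℝ} (ht : t ∈ Icc (0 : ℝ) 1) {p : E} (hp : p ∈ U) :
    HasFDerivAt (fun q ↦ f (t, q)) (spaceDeriv U f (t, p)) p := by
  have h := (hf.differentiableOn (by simp) (t, p) ⟨ht, hp⟩).hasFDerivWithinAt
  have h2 : HasFDerivWithinAt (fun q : E ↦ (t, q)) (ContinuousLinearMap.inr ℝ ℝ E) U p :=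
    ((hasFDerivAt_const t p).prodMk (hasFDerivAt_id p)).hasFDerivWithinAt
  exact (h.comp p h2 fun q hq ↦ ⟨ht, hq⟩).hasFDerivAt (hU.mem_nhds hp)

include hU hf in
/-- Time and space derivatives commute, up to the boundary. -/
theorem spaceDeriv_timeDeriv {t : ℝ} (ht : t ∈ Icc (0 : ℝ) 1) {p : E} (hp : p ∈ U) (u : E) :
    spaceDeriv U (timeDeriv U f) (t, p) u = timeDeriv U (fun z ↦ spaceDeriv U f z u) (t, p) := by
  have hz : (t, p) ∈ Icc (0 : ℝ) 1 ×ˢ U := ⟨ht, hp⟩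
  have hS := uniqueDiffOn_Icc_prod hU
  -- Symmetry of the second derivative persists at t = 0 and t = 1 because every point of [0,1] × U
  -- lies in the closure of the interior.
  have hsymm : IsSymmSndFDerivWithinAt ℝ f (Icc (0 : ℝ) 1 ×ˢ U) (t, p) := by
    refine (hf (t, p) hz).isSymmSndFDerivWithinAt (n := ∞) ?_ hS ?_ hz
    · rw [minSmoothness_of_isRCLikeNormedField]; norm_cast
    · rw [interior_prod_eq, closure_prod_eq, interior_Icc, closure_Ioo (by norm_num),
        hU.interior_eq]
      exact ⟨ht, subset_closure hp⟩
  have hd : HasFDerivWithinAt (fderivWithin ℝ f (Icc (0 : ℝ) 1 ×ˢ U))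
      (fderivWithin ℝ (fderivWithin ℝ f (Icc (0 : ℝ) 1 ×ˢ U)) (Icc (0 : ℝ) 1 ×ˢ U) (t, p))
      (Icc (0 : ℝ) 1 ×ˢ U) (t, p) :=
    ((hf.fderivWithin (m := 1) hS (by norm_cast)).differentiableOn (by simp) (t, p)
      hz).hasFDerivWithinAt
  have happ (v : ℝ × E) : HasFDerivWithinAt (fun z ↦ fderivWithin ℝ f (Icc (0 : ℝ) 1 ×ˢ U) z v)
      ((fderivWithin ℝ (fderivWithin ℝ f (Icc (0 : ℝ) 1 ×ˢ U)) (Icc (0 : ℝ) 1 ×ˢ U) (t, p)).flip v)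
      (Icc (0 : ℝ) 1 ×ˢ U) (t, p) :=
    ((ContinuousLinearMap.apply ℝ W v).hasFDerivAt.comp_hasFDerivWithinAt (t, p) hd).congr_fderiv
      rfl
  have h1 := (happ (1, 0)).fderivWithin (hS _ hz)
  have h2 := (happ (0, u)).fderivWithin (hS _ hz)
  have e1 : spaceDeriv U (timeDeriv U f) (t, p) u =
      fderivWithin ℝ (fun z ↦ fderivWithin ℝ f (Icc (0 : ℝ) 1 ×ˢ U) z (1, 0))
        (Icc (0 : ℝ) 1 ×ˢ U) (t, p) (0, u) := rfl
  have e2 : timeDeriv U (fun z ↦ spaceDeriv U f z u) (t, p) =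
      fderivWithin ℝ (fun z ↦ fderivWithin ℝ f (Icc (0 : ℝ) 1 ×ˢ U) z (0, u))
        (Icc (0 : ℝ) 1 ×ˢ U) (t, p) (1, 0) := rfl
  rw [e1, e2, h1, h2]
  exact hsymm (0, u) (1, 0)

end TimeSpace

/-! ### The self-adjoint part of a connection and its variation with the metric -/

section Potential

variable {E : Type*} [NormedAddCommGroup E] [NormedSpace ℝ E]
  {𝒜 : Type*} [NormedRing 𝒜] [NormedAlgebra ℂ 𝒜] [StarRing 𝒜] [NormedStarGroup 𝒜]
  [StarModule ℂ 𝒜]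

/-- The covariant derivative of a Hermitian form `η` with derivative `η'` for a connection with
connection form `A`. -/
noncomputable def formDeriv (η : 𝒜) (η' A : E →L[ℝ] 𝒜) : E →L[ℝ] 𝒜 :=
  η' - ((ContinuousLinearMap.mul ℝ 𝒜).flip η).comp ((starReal 𝒜).comp A) -
    (ContinuousLinearMap.mul ℝ 𝒜 η).comp A

@[simp] theorem formDeriv_apply (η : 𝒜) (η' A : E →L[ℝ] 𝒜) (u : E) :
    formDeriv η η' A u = η' u - star (A u) * η - η * A u := rfl

/-- The self-adjoint part of a connection with connection form `A`, for the metric `η`. -/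
noncomputable def selfAdjointForm (η : 𝒜) (η' A : E →L[ℝ] 𝒜) : E →L[ℝ] 𝒜 :=
  -((1 / 2 : ℝ) • (ContinuousLinearMap.mul ℝ 𝒜 (Ring.inverse η)).comp (formDeriv η η' A))

theorem selfAdjointForm_apply (η : 𝒜) (η' A : E →L[ℝ] 𝒜) (u : E) :
    selfAdjointForm η η' A u = -((1 / 2 : ℝ) • (Ring.inverse η * formDeriv η η' A u)) := rfl

/-- The conditions ψ*η = ηψ and η' = (A-ψ)*η + η(A-ψ) force 2ηψ = A*η + ηA - η'. Keeping the factor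
η on the left avoids differentiating an inverse later. -/
theorem mul_selfAdjointForm {η : 𝒜} (hη : IsUnit η) (η' A : E →L[ℝ] 𝒜) (u : E) :
    η * selfAdjointForm η η' A u = -((1 / 2 : ℝ) • formDeriv η η' A u) := by
  rw [selfAdjointForm_apply, mul_neg, mul_smul_comm, ← mul_assoc, Ring.mul_inverse_cancel η hη,
    one_mul]

theorem star_formDeriv {η : 𝒜} (hs : star η = η) {η' : E →L[ℝ] 𝒜} (hs' : ∀ u, star (η' u) = η' u)
    (A : E →L[ℝ] 𝒜) (u : E) : star (formDeriv η η' A u) = formDeriv η η' A u := by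
  simp only [formDeriv_apply, star_sub, star_mul, star_star, hs, hs']
  abel

theorem star_selfAdjointForm_mul {η : 𝒜} (hη : IsUnit η) (hs : star η = η) {η' : E →L[ℝ] 𝒜}
    (hs' : ∀ u, star (η' u) = η' u) (A : E →L[ℝ] 𝒜) (u : E) :
    star (selfAdjointForm η η' A u) * η = η * selfAdjointForm η η' A u := by
  have h := congrArg star (mul_selfAdjointForm hη η' A u)
  have h2 : star (1 / 2 : ℝ) = 1 / 2 := star_trivial _
  rw [star_mul, hs, star_neg, star_smul, star_formDeriv hs hs', h2] at h
  rw [h, mul_selfAdjointForm hη]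

theorem deriv_eq_unitary {η : 𝒜} (hη : IsUnit η) (hs : star η = η) {η' : E →L[ℝ] 𝒜}
    (hs' : ∀ u, star (η' u) = η' u) (A : E →L[ℝ] 𝒜) (u : E) :
    η' u = star (A u - selfAdjointForm η η' A u) * η + η * (A u - selfAdjointForm η η' A u) := by
  rw [star_sub, sub_mul, mul_sub, star_selfAdjointForm_mul hη hs hs', mul_selfAdjointForm hη,
    formDeriv_apply]
  module

variable {W : Type*} [NormedAddCommGroup W] [NormedSpace ℝ W]

theorem contDiffOn_formDeriv {n : WithTop ℕ∞} {s : Set W} {η : W → 𝒜} {η' A : W → E →L[ℝ] 𝒜}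
    (hη : ContDiffOn ℝ n η s) (hη' : ContDiffOn ℝ n η' s) (hA : ContDiffOn ℝ n A s) :
    ContDiffOn ℝ n (fun z ↦ formDeriv (η z) (η' z) (A z)) s := by
  unfold NHYM.formDeriv
  refine (hη'.sub ?_).sub ?_
  · exact (((ContinuousLinearMap.mul ℝ 𝒜).flip.contDiff.comp_contDiffOn hη)).clm_comp
      (contDiffOn_const.clm_comp hA)
  · exact ((ContinuousLinearMap.mul ℝ 𝒜).contDiff.comp_contDiffOn hη).clm_comp hA

variable [CompleteSpace 𝒜]

theorem contDiffOn_ringInverse {n : WithTop ℕ∞} {s : Set W} {η : W → 𝒜}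
    (hη : ContDiffOn ℝ n η s) (hu : ∀ z ∈ s, IsUnit (η z)) :
    ContDiffOn ℝ n (fun z ↦ Ring.inverse (η z)) s := fun z hz ↦ by
  obtain ⟨v, hv⟩ := hu z hz
  have h : ContDiffAt ℝ n Ring.inverse (η z) := hv ▸ contDiffAt_ringInverse ℝ v
  exact h.comp_contDiffWithinAt z (hη z hz)

theorem contDiffOn_selfAdjointForm {n : WithTop ℕ∞} {s : Set W} {η : W → 𝒜}
    {η' A : W → E →L[ℝ] 𝒜} (hη : ContDiffOn ℝ n η s) (hη' : ContDiffOn ℝ n η' s)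
    (hA : ContDiffOn ℝ n A s) (hu : ∀ z ∈ s, IsUnit (η z)) :
    ContDiffOn ℝ n (fun z ↦ selfAdjointForm (η z) (η' z) (A z)) s := by
  unfold NHYM.selfAdjointForm
  have h : ContDiffOn ℝ n (fun z ↦ (ContinuousLinearMap.mul ℝ 𝒜 (Ring.inverse (η z))).comp
      (NHYM.formDeriv (η z) (η' z) (A z))) s :=
    ((ContinuousLinearMap.mul ℝ 𝒜).contDiff.comp_contDiffOn
      (contDiffOn_ringInverse hη hu)).clm_comp (contDiffOn_formDeriv hη hη' hA)
  exact (h.const_smul (1 / 2 : ℝ)).neg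

/-- The variation of the self-adjoint part of a connection along a path of metrics. -/
theorem hasDerivWithinAt_selfAdjointForm {U : Set E} (hU : IsOpen U) {η : ℝ × E → 𝒜}
    (hη : ContDiffOn ℝ ∞ η (Icc (0 : ℝ) 1 ×ˢ U)) {A : E → E →L[ℝ] 𝒜} (hA : ContDiffOn ℝ ∞ A U)
    (hu : ∀ z ∈ Icc (0 : ℝ) 1 ×ˢ U, IsUnit (η z)) {t : ℝ} (ht : t ∈ Icc (0 : ℝ) 1) {p : E}
    (hp : p ∈ U) {v : E → 𝒜} (hv : ∀ q ∈ U, η (t, q) * v q = timeDeriv U η (t, q)) (u : E) :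
    HasDerivWithinAt
      (fun τ ↦ selfAdjointForm (η (τ, p)) (spaceDeriv U η (τ, p)) (A p) u)
      (-((1 / 2 : ℝ) • (fderiv ℝ v p u + (A p u * v p - v p * A p u))) -
        (v p * selfAdjointForm (η (t, p)) (spaceDeriv U η (t, p)) (A p) u -
          selfAdjointForm (η (t, p)) (spaceDeriv U η (t, p)) (A p) u * v p)) (Icc 0 1) t := by
  have hz : (t, p) ∈ Icc (0 : ℝ) 1 ×ˢ U := ⟨ht, hp⟩
  have hS := contDiffOn_spaceDeriv hU hη
  have hT := contDiffOn_timeDeriv hU hη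
  have hA2 : ContDiffOn ℝ ∞ (fun z : ℝ × E ↦ A z.2) (Icc (0 : ℝ) 1 ×ˢ U) :=
    hA.comp contDiffOn_snd fun z hz ↦ hz.2
  have hψ := contDiffOn_selfAdjointForm hη hS hA2 hu
  set ψ : ℝ × E → E →L[ℝ] 𝒜 := fun z ↦ selfAdjointForm (η z) (spaceDeriv U η z) (A z.2) with hψdef
  have hψu : ContDiffOn ℝ ∞ (fun z ↦ ψ z u) (Icc (0 : ℝ) 1 ×ˢ U) := hψ.clm_apply contDiffOn_const
  have hSu : ContDiffOn ℝ ∞ (fun z ↦ spaceDeriv U η z u) (Icc (0 : ℝ) 1 ×ˢ U) :=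
    hS.clm_apply contDiffOn_const
  have h1 := hasDerivWithinAt_time hψu ht hp
  refine h1.congr_deriv ?_
  have hη1 := hasDerivWithinAt_time hη ht hp
  have hS1 := hasDerivWithinAt_time hSu ht hp
  -- differentiate `η ψ = -½ (∂η - A* η - η A)` in time
  have hleft := hη1.mul h1
  have hright := (((hS1.sub (hη1.const_mul (star (A p u)))).sub
    (hη1.mul_const (A p u))).const_smul (1 / 2 : ℝ)).neg
  have heq : EqOn (fun τ ↦ η (τ, p) * ψ (τ, p) u) (fun τ ↦ -((1 / 2 : ℝ) •
      (spaceDeriv U η (τ, p) u - star (A p u) * η (τ, p) - η (τ, p) * A p u))) (Icc 0 1) :=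
    fun τ hτ ↦ mul_selfAdjointForm (hu _ ⟨hτ, hp⟩) _ _ u
  have hE1 := (uniqueDiffOn_Icc zero_lt_one t ht).eq_deriv _ hleft
    (hright.congr heq (heq ht))
  rw [← spaceDeriv_timeDeriv hU hη ht hp] at hE1
  -- differentiate `η v = ∂ₜ η` in space
  have hvd : HasFDerivAt v (fderiv ℝ v p) p := by
    have h2 : ContDiffOn ℝ ∞ (fun q ↦ Ring.inverse (η (t, q)) * timeDeriv U η (t, q)) U := by
      have hmap : MapsTo (fun q : E ↦ (t, q)) U (Icc (0 : ℝ) 1 ×ˢ U) := fun q hq ↦ ⟨ht, hq⟩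
      have hpair : ContDiffOn ℝ ∞ (fun q : E ↦ (t, q)) U :=
        contDiffOn_const.prodMk contDiffOn_id
      exact ((contDiffOn_ringInverse hη hu).comp hpair hmap).mul (hT.comp hpair hmap)
    have h3 : EqOn v (fun q ↦ Ring.inverse (η (t, q)) * timeDeriv U η (t, q)) U := fun q hq ↦ by
      simp only [← hv q hq, ← mul_assoc, Ring.inverse_mul_cancel _ (hu (t, q) ⟨ht, hq⟩), one_mul]
    exact (((h2.congr h3).contDiffAt (hU.mem_nhds hp)).differentiableAt (by simp)).hasFDerivAt
  have hL := (hasFDerivAt_space hU hη ht hp).mul' hvd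
  have hR := hasFDerivAt_space hU hT ht hp
  have hev : (fun q ↦ η (t, q) * v q) =ᶠ[𝓝 p] fun q ↦ timeDeriv U η (t, q) := by
    filter_upwards [hU.mem_nhds hp] with q hq using hv q hq
  have hE2 := congrArg (fun T ↦ T u) (hL.unique (hR.congr_of_eventuallyEq hev))
  have hE2' : η (t, p) * fderiv ℝ v p u + spaceDeriv U η (t, p) u * v p =
      spaceDeriv U (timeDeriv U η) (t, p) u := hE2
  have hv0 := hv p hp
  have hmul : η (t, p) * ψ (t, p) u = -((1 / 2 : ℝ) •
      (spaceDeriv U η (t, p) u - star (A p u) * η (t, p) - η (t, p) * A p u)) := heq ht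
  -- The variation formula is checked after multiplication by η, where the two differentiated
  -- identities can be substituted.
  refine (hu _ hz).mul_left_cancel ?_
  change η (t, p) * timeDeriv U (fun z ↦ ψ z u) (t, p) = η (t, p) *
    (-((1 / 2 : ℝ) • (fderiv ℝ v p u + (A p u * v p - v p * A p u))) -
        (v p * ψ (t, p) u - ψ (t, p) u * v p))
  have hX : η (t, p) * timeDeriv U (fun z ↦ ψ z u) (t, p) = -((1 / 2 : ℝ) •
      (spaceDeriv U (timeDeriv U η) (t, p) u - star (A p u) * timeDeriv U η (t, p) -
        timeDeriv U η (t, p) * A p u)) - timeDeriv U η (t, p) * ψ (t, p) u := by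
    rw [eq_sub_iff_add_eq, ← hE1]
    abel
  have hXv : η (t, p) * (ψ (t, p) u * v p) = -((1 / 2 : ℝ) •
      (spaceDeriv U η (t, p) u * v p - star (A p u) * (η (t, p) * v p) -
        η (t, p) * (A p u * v p))) := by
    rw [← mul_assoc, hmul]
    simp only [neg_mul, smul_mul_assoc, sub_mul, mul_assoc]
  rw [hX, ← hE2', ← hv0]
  simp only [mul_sub, mul_neg, mul_smul_comm, mul_add, hXv, mul_assoc]
  module

end Potential

/-! ### A Hilbert model of the fibre and its endomorphism algebra -/

section ModelFiber

/-- A Hilbert space isomorphic to the model fibre. -/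
abbrev ModelFiber (F : Type*) [AddCommGroup F] [Module ℂ F] : Type :=
  EuclideanSpace ℂ (Fin (finrank ℂ F))

/-- The endomorphism algebra of the model fibre. -/
abbrev ModelEnd (F : Type*) [AddCommGroup F] [Module ℂ F] : Type :=
  ModelFiber F →L[ℂ] ModelFiber F

variable (F : Type*) [NormedAddCommGroup F] [NormedSpace ℂ F]

/-- An identification of the model fibre with a Hilbert space. -/
noncomputable def modelEquiv [FiniteDimensional ℂ F] : ModelFiber F ≃L[ℂ] F :=
  ContinuousLinearEquiv.ofFinrankEq finrank_euclideanSpace_fin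

variable {F}

/-- The matrix units of the model fibre. -/
noncomputable def matrixUnit (i j : Fin (finrank ℂ F)) : ModelEnd F :=
  (innerSL ℂ (EuclideanSpace.single j (1 : ℂ))).smulRight (EuclideanSpace.single i (1 : ℂ))

theorem eq_sum_single (g : ModelFiber F) : g = ∑ i, g i • EuclideanSpace.single i (1 : ℂ) := by
  ext k
  simp [Finset.sum_apply, Pi.single_apply]

theorem eq_sum_matrixUnit (T : ModelEnd F) :
    T = ∑ i, ∑ j, (T (EuclideanSpace.single j 1) i) • matrixUnit (F := F) i j := by
  ext g k
  conv_lhs => rw [eq_sum_single g]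
  simp [matrixUnit, Finset.sum_apply, Pi.single_apply, mul_comm, EuclideanSpace.inner_single_left]

variable {P : Type*} [NormedAddCommGroup P] [NormedSpace ℝ P]

/-- In finite dimension smoothness of the matrix entries suffices; metrics and connections supply
smoothness only in this form. -/
theorem contDiffOn_of_inner {n : WithTop ℕ∞} {s : Set P} {T : P → ModelEnd F}
    (h : ∀ f g : ModelFiber F, ContDiffOn ℝ n (fun z ↦ inner ℂ f (T z g)) s) :
    ContDiffOn ℝ n T s := by
  have hT (z : P) : T z = ∑ i, ∑ j, (inner ℂ (EuclideanSpace.single i (1 : ℂ))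
      (T z (EuclideanSpace.single j 1))) • matrixUnit (F := F) i j := by
    conv_lhs => rw [eq_sum_matrixUnit (T z)]
    simp [EuclideanSpace.inner_single_left]
  have hfun : T = fun z ↦ ∑ i, ∑ j, (inner ℂ (EuclideanSpace.single i (1 : ℂ))
      (T z (EuclideanSpace.single j 1))) • matrixUnit (F := F) i j := funext hT
  rw [hfun]
  exact ContDiffOn.sum fun i _ ↦ ContDiffOn.sum fun j _ ↦ (h _ _).smul contDiffOn_const

theorem ModelEnd.ext_inner {S T : ModelEnd F} (h : ∀ f g, inner ℂ f (S g) = inner ℂ f (T g)) :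
    S = T := by
  ext1 g
  exact ext_inner_left ℂ fun f ↦ h f g

end ModelFiber

/-! ### Local frames made of global smooth sections -/

section Frame

variable (E : Type*) [NormedAddCommGroup E] [NormedSpace ℂ E]
  {X : Type*} [TopologicalSpace X] [ChartedSpace E X]
  (F : Type*) [NormedAddCommGroup F] [NormedSpace ℂ F]
  (V : X → Type*) [TopologicalSpace (TotalSpace F V)] [∀ x, AddCommGroup (V x)]
  [∀ x, Module ℂ (V x)] [∀ x, TopologicalSpace (V x)]
  [FiberBundle F V]

/-- A frame of a complex vector bundle near `x₀`, given by global smooth sections. -/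
structure LocalFrame (x₀ : X) where
  /-- the domain on which the sections form a frame -/
  nhd : Set X
  isOpen_nhd : IsOpen nhd
  mem_nhd : x₀ ∈ nhd
  nhd_subset : nhd ⊆ (chartAt E x₀).source
  /-- the sections -/
  sec (y : X) : ModelFiber F →ₗ[ℂ] V y
  /-- the coordinates with respect to the frame -/
  coord (y : X) : V y →ₗ[ℂ] ModelFiber F
  coord_sec (y : X) (hy : y ∈ nhd) (g : ModelFiber F) : coord y (sec y g) = g
  sec_coord (y : X) (hy : y ∈ nhd) (v : V y) : sec y (coord y v) = v
  smooth_sec (g : ModelFiber F) : IsSmooth E F (fun y ↦ sec y g)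
  smooth_coord (σ : ∀ y, V y) (y : X) (hy : y ∈ nhd)
    (hσ : ContMDiffAt 𝓘(ℝ, E) (𝓘(ℝ, E).prod 𝓘(ℝ, F)) ∞ (fun x ↦ TotalSpace.mk' F x (σ x)) y) :
    ContMDiffAt 𝓘(ℝ, E) 𝓘(ℝ, ModelFiber F) ∞ (fun x ↦ coord x (σ x)) y

variable {E F V}

/-- The definitions test endomorphisms on global smooth sections only, so a trivializing frame is
multiplied by a bump function and used where that function equals 1. -/
theorem LocalFrame.exists [FiniteDimensional ℂ E] [FiniteDimensional ℂ F] [VectorBundle ℂ F V]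
    [IsManifold 𝓘(ℂ, E) ω X] [T2Space X]
    [ContMDiffVectorBundle ∞ F V 𝓘(ℝ, E)] (x₀ : X) : Nonempty (LocalFrame E F V x₀) := by
  have : FiniteDimensional ℝ E := FiniteDimensional.complexToReal E
  set e := trivializationAt F V x₀
  have hx₀ : x₀ ∈ e.baseSet := FiberBundle.mem_baseSet_trivializationAt' x₀
  have hU : e.baseSet ∩ (chartAt E x₀).source ∈ 𝓝 x₀ :=
    (e.open_baseSet.inter (chartAt E x₀).open_source).mem_nhds ⟨hx₀, mem_chart_source E x₀⟩
  obtain ⟨χ, -, hχ⟩ := (SmoothBumpFunction.nhds_basis_tsupport (I := 𝓘(ℝ, E)) x₀).mem_iff.1 hU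
  obtain ⟨N, hN1, hNo, hxN⟩ := eventually_nhds_iff.1 χ.eventuallyEq_one
  have hNb (y) (hy : y ∈ N) : y ∈ e.baseSet ∩ (chartAt E x₀).source := by
    refine hχ (subset_tsupport _ ?_)
    rw [Function.mem_support, hN1 y hy]
    exact one_ne_zero
  refine ⟨{
    nhd := N
    isOpen_nhd := hNo
    mem_nhd := hxN
    nhd_subset := fun y hy ↦ (hNb y hy).2
    sec := fun y ↦ ((χ y : ℝ) : ℂ) • (e.symmₗ ℂ y ∘ₗ (modelEquiv F : ModelFiber F →ₗ[ℂ] F))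
    coord := fun y ↦ ((modelEquiv F).symm : F →ₗ[ℂ] ModelFiber F) ∘ₗ e.linearMapAt ℂ y
    coord_sec := fun y hy g ↦ ?_
    sec_coord := fun y hy v ↦ ?_
    smooth_sec := fun g ↦ ?_
    smooth_coord := fun σ y hy hσ ↦ ?_ }⟩
  · have h1 : (χ y : ℝ) = 1 := hN1 y hy
    simp only [h1, Complex.ofReal_one, one_smul, LinearMap.comp_apply,
      e.linearMapAt_symmₗ (hNb y hy).1]
    exact (modelEquiv F).symm_apply_apply g
  · have h1 : (χ y : ℝ) = 1 := hN1 y hy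
    simp only [h1, Complex.ofReal_one, one_smul, LinearMap.comp_apply]
    have h2 : (modelEquiv F : ModelFiber F →ₗ[ℂ] F) (((modelEquiv F).symm : F →ₗ[ℂ] ModelFiber F)
      (e.linearMapAt ℂ y v)) = e.linearMapAt ℂ y v := (modelEquiv F).apply_symm_apply _
    rw [h2, e.symmₗ_linearMapAt (hNb y hy).1]
  · have h1 : ContMDiffOn 𝓘(ℝ, E) (𝓘(ℝ, E).prod 𝓘(ℝ, F)) ∞
        (fun y ↦ TotalSpace.mk' F y (e.symmₗ ℂ y (modelEquiv F g))) e.baseSet := by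
      intro y hy
      refine ((e.contMDiffAt_section_iff hy).2 ?_).contMDiffWithinAt
      refine contMDiffAt_const (c := modelEquiv F g) |>.congr_of_eventuallyEq ?_
      filter_upwards [e.open_baseSet.mem_nhds hy] with z hz
      rw [e.coe_symmₗ hz, e.apply_mk_symm hz]
    have h2 := ContMDiffOn.smul_section_of_tsupport (ψ := χ) (n := ∞) (I := 𝓘(ℝ, E))
      χ.contMDiff.contMDiffOn e.open_baseSet (fun y hy ↦ (hχ hy).1) h1
    exact h2
  · have h1 := (e.contMDiffAt_section_iff (hNb y hy).1).1 hσ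
    have h2 : ContMDiff 𝓘(ℝ, F) 𝓘(ℝ, ModelFiber F) ∞ (modelEquiv F).symm :=
      (((modelEquiv F).symm : F →L[ℂ] ModelFiber F).restrictScalars ℝ).contMDiff
    have h3 := h2.contMDiffAt.comp y h1
    refine h3.congr_of_eventuallyEq ?_
    filter_upwards [e.open_baseSet.mem_nhds (hNb y hy).1] with z hz
    simp only [LinearMap.comp_apply, e.coe_linearMapAt_of_mem hz]
    rfl

namespace LocalFrame

variable {x₀ : X} (fr : LocalFrame E F V x₀)

/-- The domain of the frame in the chart. -/
def dom : Set E := (chartAt E x₀).target ∩ (chartAt E x₀).symm ⁻¹' fr.nhd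

theorem isOpen_dom : IsOpen fr.dom :=
  (chartAt E x₀).isOpen_inter_preimage_symm fr.isOpen_nhd

theorem mem_dom_of_mem {y : X} (hy : y ∈ fr.nhd) : chartAt E x₀ y ∈ fr.dom := by
  refine ⟨(chartAt E x₀).map_source (fr.nhd_subset hy), ?_⟩
  rwa [mem_preimage, (chartAt E x₀).left_inv (fr.nhd_subset hy)]

theorem mem_dom : chartAt E x₀ x₀ ∈ fr.dom := fr.mem_dom_of_mem fr.mem_nhd

/-- The frame as an isomorphism. -/
noncomputable def equiv {y : X} (hy : y ∈ fr.nhd) : ModelFiber F ≃ₗ[ℂ] V y :=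
  LinearEquiv.ofLinearMap (fr.sec y) (fr.coord y) (LinearMap.ext fun v ↦ fr.sec_coord y hy v)
    (LinearMap.ext fun g ↦ fr.coord_sec y hy g)

/-- The matrix of an endomorphism of a fibre. -/
noncomputable def push (y : X) : Module.End ℂ (V y) →ₗ[ℂ] ModelEnd F where
  toFun S := LinearMap.toContinuousLinearMap (fr.coord y ∘ₗ S ∘ₗ fr.sec y)
  map_add' S T := by ext1 g; simp
  map_smul' c S := by ext1 g; simp

theorem push_apply (y : X) (S : Module.End ℂ (V y)) (g : ModelFiber F) :
    fr.push y S g = fr.coord y (S (fr.sec y g)) := rfl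

/-- The endomorphism with a given matrix. -/
noncomputable def lift (y : X) (T : ModelEnd F) : Module.End ℂ (V y) :=
  fr.sec y ∘ₗ (T : ModelFiber F →ₗ[ℂ] ModelFiber F) ∘ₗ fr.coord y

theorem lift_apply (y : X) (T : ModelEnd F) (v : V y) :
    fr.lift y T v = fr.sec y (T (fr.coord y v)) := rfl

section Nhd

variable {fr} {y : X} (hy : y ∈ fr.nhd)

include hy

theorem push_mul (S T : Module.End ℂ (V y)) : fr.push y (S * T) = fr.push y S * fr.push y T := by
  ext1 g
  simp [push_apply, fr.sec_coord y hy]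

theorem push_one : fr.push y 1 = 1 := by
  ext1 g
  simp [push_apply, fr.coord_sec y hy]

theorem lift_push (S : Module.End ℂ (V y)) : fr.lift y (fr.push y S) = S := by
  ext v
  simp [lift_apply, push_apply, fr.sec_coord y hy]

theorem push_lift (T : ModelEnd F) : fr.push y (fr.lift y T) = T := by
  ext1 g
  simp [lift_apply, push_apply, fr.coord_sec y hy]

theorem trace_push (S : Module.End ℂ (V y)) :
    LinearMap.trace ℂ (ModelFiber F) (fr.push y S : ModelFiber F →ₗ[ℂ] ModelFiber F) =
      LinearMap.trace ℂ (V y) S :=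
  LinearMap.trace_conj' S (fr.equiv hy).symm

end Nhd

/-- The matrix of a sesquilinear form on a fibre. -/
noncomputable def formMatrix (y : X) (B : V y →ₗ⋆[ℂ] V y →ₗ[ℂ] ℂ) : ModelEnd F :=
  LinearMap.toContinuousLinearMap (∑ i, ((B (fr.sec y (EuclideanSpace.single i 1))) ∘ₗ
    fr.sec y).smulRight (EuclideanSpace.single i (1 : ℂ)))

theorem inner_formMatrix (y : X) (B : V y →ₗ⋆[ℂ] V y →ₗ[ℂ] ℂ) (f g : ModelFiber F) :
    inner ℂ f (fr.formMatrix y B g) = B (fr.sec y f) (fr.sec y g) := by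
  conv_rhs => rw [eq_sum_single f]
  simp [formMatrix, EuclideanSpace.inner_single_right, mul_comm]

/-- A section in the frame and the chart. -/
noncomputable def localSec (σ : ∀ y, V y) (p : E) : ModelFiber F :=
  fr.coord ((chartAt E x₀).symm p) (σ ((chartAt E x₀).symm p))

/-- A field of endomorphisms in the frame and the chart. -/
noncomputable def localEnd (S : ∀ y, Module.End ℂ (V y)) (p : E) : ModelEnd F :=
  fr.push ((chartAt E x₀).symm p) (S ((chartAt E x₀).symm p))

/-- A Hermitian metric in the frame and the chart. -/
noncomputable def localMetric (H : HermitianMetric E F V) (p : E) : ModelEnd F :=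
  fr.formMatrix ((chartAt E x₀).symm p) (H.toFun ((chartAt E x₀).symm p))

theorem inner_localMetric (H : HermitianMetric E F V) (p : E) (f g : ModelFiber F) :
    inner ℂ f (fr.localMetric H p g) = H.toFun ((chartAt E x₀).symm p)
      (fr.sec ((chartAt E x₀).symm p) f) (fr.sec ((chartAt E x₀).symm p) g) :=
  fr.inner_formMatrix _ _ f g

variable [FiniteDimensional ℂ F]

theorem star_localMetric (H : HermitianMetric E F V) (p : E) :
    star (fr.localMetric H p) = fr.localMetric H p := by
  refine ModelEnd.ext_inner fun f g ↦ ?_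
  rw [ContinuousLinearMap.star_eq_adjoint, ContinuousLinearMap.adjoint_inner_right,
    inner_localMetric, ← inner_conj_symm, inner_localMetric]
  exact H.conj_symm _ _ _

/-- Positivity of the metric makes its matrix injective, and an injective endomorphism in finite
dimension is invertible. -/
theorem isUnit_localMetric (H : HermitianMetric E F V) {p : E} (hp : p ∈ fr.dom) :
    IsUnit (fr.localMetric H p) := by
  have hinj : Function.Injective (fr.localMetric H p) := by
    rw [injective_iff_map_eq_zero]
    intro g hg
    by_contra h0
    have h1 : fr.sec ((chartAt E x₀).symm p) g ≠ 0 := fun h ↦ h0 (by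
      rw [← fr.coord_sec _ hp.2 g, h, map_zero])
    have h2 := H.positive _ _ h1
    rw [← inner_localMetric, hg] at h2
    simp at h2
  let e := (LinearEquiv.ofInjectiveEndo (fr.localMetric H p : ModelFiber F →ₗ[ℂ] ModelFiber F)
    hinj).toContinuousLinearEquiv
  exact ⟨(ContinuousLinearEquiv.unitsEquiv ℂ (ModelFiber F)).symm e, by ext1 g; rfl⟩

variable [IsManifold 𝓘(ℂ, E) ω X]

theorem contDiffAt_localSec {σ : ∀ y, V y} {p : E} (hp : p ∈ fr.dom)
    (hσ : ContMDiffAt 𝓘(ℝ, E) (𝓘(ℝ, E).prod 𝓘(ℝ, F)) ∞ (fun x ↦ TotalSpace.mk' F x (σ x))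
      ((chartAt E x₀).symm p)) :
    ContDiffAt ℝ ∞ (fr.localSec σ) p := by
  have h := (contMDiffAt_iff_contDiffAt_chart (n := ⊤) E x₀ ((chartAt E x₀).symm p)
    ((chartAt E x₀).map_target hp.1)).1 (fr.smooth_coord σ _ hp.2 hσ)
  rw [(chartAt E x₀).right_inv hp.1] at h
  exact h

theorem contDiffOn_localEnd {S : ∀ y, Module.End ℂ (V y)} (hS : IsSmoothEnd E F S) :
    ContDiffOn ℝ ∞ (fr.localEnd S) fr.dom := by
  refine contDiffOn_of_inner fun f g p hp ↦ ?_
  have h := fr.contDiffAt_localSec hp (hS _ (fr.smooth_sec g) _)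
  exact (contDiffAt_const.inner ℂ h).contDiffWithinAt

theorem contDiffOn_localMetric (H : HermitianMetric E F V) :
    ContDiffOn ℝ ∞ (fr.localMetric H) fr.dom := by
  refine contDiffOn_of_inner fun f g p hp ↦ ContDiffAt.contDiffWithinAt ?_
  simp only [inner_localMetric]
  have h := (contMDiffAt_iff_contDiffAt_chart (n := ⊤) E x₀ ((chartAt E x₀).symm p)
    ((chartAt E x₀).map_target hp.1)).1 (H.smooth _ _ (fr.smooth_sec f) (fr.smooth_sec g) _)
  rw [(chartAt E x₀).right_inv hp.1] at h
  exact h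

end LocalFrame

end Frame

/-! ### The connection form in a frame -/

section ConnectionForm

variable {E : Type*} [NormedAddCommGroup E] [NormedSpace ℂ E]
  {X : Type*} [TopologicalSpace X] [ChartedSpace E X] [IsManifold 𝓘(ℂ, E) ω X]
  {F : Type*} [NormedAddCommGroup F] [NormedSpace ℂ F]
  {V : X → Type*} [TopologicalSpace (TotalSpace F V)] [∀ x, AddCommGroup (V x)]
  [∀ x, Module ℂ (V x)] [∀ x, TopologicalSpace (V x)]
  [∀ x, IsTopologicalAddGroup (V x)] [∀ x, ContinuousSMul ℝ (V x)]
  [FiberBundle F V] [VectorBundle ℂ F V]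

theorem IsSmooth.mdifferentiableAt {σ : ∀ x, V x} (hσ : IsSmooth E F σ) (x : X) :
    MDifferentiableAt 𝓘(ℝ, E) (𝓘(ℝ, E).prod 𝓘(ℝ, F)) (fun y ↦ TotalSpace.mk' F y (σ y)) x :=
  ContMDiff.mdifferentiable hσ (by simp) x

theorem mdifferentiableAt_smul {σ : ∀ x, V x} {f : X → ℝ} {x : X}
    (hf : MDifferentiableAt 𝓘(ℝ, E) 𝓘(ℝ, ℝ) f x)
    (hσ : MDifferentiableAt 𝓘(ℝ, E) (𝓘(ℝ, E).prod 𝓘(ℝ, F)) (fun y ↦ TotalSpace.mk' F y (σ y)) x) :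
    MDifferentiableAt 𝓘(ℝ, E) (𝓘(ℝ, E).prod 𝓘(ℝ, F))
      (fun y ↦ TotalSpace.mk' F y (f y • σ y)) x :=
  hf.smul_section hσ

theorem mdifferentiableAt_add {σ τ : ∀ x, V x} {x : X}
    (hσ : MDifferentiableAt 𝓘(ℝ, E) (𝓘(ℝ, E).prod 𝓘(ℝ, F)) (fun y ↦ TotalSpace.mk' F y (σ y)) x)
    (hτ : MDifferentiableAt 𝓘(ℝ, E) (𝓘(ℝ, E).prod 𝓘(ℝ, F)) (fun y ↦ TotalSpace.mk' F y (τ y)) x) :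
    MDifferentiableAt 𝓘(ℝ, E) (𝓘(ℝ, E).prod 𝓘(ℝ, F))
      (fun y ↦ TotalSpace.mk' F y (σ y + τ y)) x :=
  mdifferentiableAt_add_section hσ hτ

namespace Connection

variable (D : Connection E F V)

theorem toFun_add {σ τ : ∀ x, V x} {x : X}
    (hσ : MDifferentiableAt 𝓘(ℝ, E) (𝓘(ℝ, E).prod 𝓘(ℝ, F)) (fun y ↦ TotalSpace.mk' F y (σ y)) x)
    (hτ : MDifferentiableAt 𝓘(ℝ, E) (𝓘(ℝ, E).prod 𝓘(ℝ, F)) (fun y ↦ TotalSpace.mk' F y (τ y)) x)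
    (v : TangentSpace 𝓘(ℝ, E) x) :
    D.toFun (fun y ↦ σ y + τ y) x v = D.toFun σ x v + D.toFun τ x v :=
  congrArg (fun L ↦ L v) (D.isCovariantDerivativeOnUniv.add hσ hτ)

theorem toFun_smul {σ : ∀ x, V x} {f : X → ℝ} {x : X}
    (hσ : MDifferentiableAt 𝓘(ℝ, E) (𝓘(ℝ, E).prod 𝓘(ℝ, F)) (fun y ↦ TotalSpace.mk' F y (σ y)) x)
    (hf : MDifferentiableAt 𝓘(ℝ, E) 𝓘(ℝ, ℝ) f x) (v : TangentSpace 𝓘(ℝ, E) x) :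
    D.toFun (fun y ↦ f y • σ y) x v = f x • D.toFun σ x v + mvfderiv 𝓘(ℝ, E) f x v • σ x :=
  congrArg (fun L ↦ L v) (D.isCovariantDerivativeOnUniv.leibniz hσ hf)

theorem toFun_const_smul {σ : ∀ x, V x} (c : ℝ) {x : X}
    (hσ : MDifferentiableAt 𝓘(ℝ, E) (𝓘(ℝ, E).prod 𝓘(ℝ, F)) (fun y ↦ TotalSpace.mk' F y (σ y)) x)
    (v : TangentSpace 𝓘(ℝ, E) x) :
    D.toFun (fun y ↦ c • σ y) x v = c • D.toFun σ x v :=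
  congrArg (fun L ↦ L v) (D.isCovariantDerivativeOnUniv.smul_const c hσ)

end Connection

namespace LocalFrame

variable [FiniteDimensional ℂ E] {x₀ : X} (fr : LocalFrame E F V x₀) (D : Connection E F V)

theorem smul_real (y : X) (c : ℝ) (v : V y) : c • v = (c : ℂ) • v := rfl

/-- A connection is real linear and commutes with √-1; splitting `c` into real and imaginary parts
gives complex homogeneity. -/
theorem toFun_sec_smul (c : ℂ) (g : ModelFiber F) (y : X) (v : TangentSpace 𝓘(ℝ, E) y) :
    D.toFun (fun z ↦ fr.sec z (c • g)) y v = c • D.toFun (fun z ↦ fr.sec z g) y v := by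
  have h1 : (fun z ↦ fr.sec z (c • g)) = fun z ↦ c.re • fr.sec z g +
      c.im • fr.sec z (Complex.I • g) := by
    funext z
    rw [smul_real, smul_real, ← map_smul, ← map_smul, ← map_add, smul_smul, ← add_smul,
      Complex.re_add_im]
  have h2 : (fun z ↦ fr.sec z (Complex.I • g)) = fun z ↦ Complex.I • fr.sec z g := by
    funext z
    rw [map_smul]
  have hg (g) := (fr.smooth_sec g).mdifferentiableAt y
  rw [h1, D.toFun_add (mdifferentiableAt_smul mdifferentiableAt_const (hg g))
    (mdifferentiableAt_smul mdifferentiableAt_const (hg _)), D.toFun_const_smul _ (hg g),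
    D.toFun_const_smul _ (hg _), h2, D.complex_linear _ (fr.smooth_sec g), smul_real, smul_real,
    smul_smul, ← add_smul, Complex.re_add_im]

/-- The connection form in a frame. -/
noncomputable def connAt (y : X) : TangentSpace 𝓘(ℝ, E) y →ₗ[ℝ] ModelEnd F where
  toFun v := LinearMap.toContinuousLinearMap
    { toFun := fun g ↦ fr.coord y (D.toFun (fun z ↦ fr.sec z g) y v)
      map_add' := fun f g ↦ by
        simp only [map_add]
        rw [D.toFun_add ((fr.smooth_sec f).mdifferentiableAt y)
          ((fr.smooth_sec g).mdifferentiableAt y), map_add]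
      map_smul' := fun c g ↦ by
        rw [toFun_sec_smul, map_smul, RingHom.id_apply] }
  map_add' v w := by
    ext1 g
    exact (congrArg (fr.coord y) (map_add (D.toFun (fun z ↦ fr.sec z g) y) v w)).trans
      (map_add (fr.coord y) _ _)
  map_smul' c v := by
    ext1 g
    exact (congrArg (fr.coord y) (map_smul (D.toFun (fun z ↦ fr.sec z g) y) c v)).trans
      (map_smul (fr.coord y) (c : ℂ) _)

/-- The connection form in the frame and the chart. -/
noncomputable def conn (p : E) : E →L[ℝ] ModelEnd F :=
  haveI : FiniteDimensional ℝ E := FiniteDimensional.complexToReal E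
  LinearMap.toContinuousLinearMap
    (LinearMap.comp (fr.connAt D ((chartAt E x₀).symm p) : E →ₗ[ℝ] ModelEnd F)
      (coordMap E x₀ ((chartAt E x₀).symm p) : E →ₗ[ℝ] E))

theorem conn_apply {p : E} (hp : p ∈ (chartAt E x₀).target) (u : E) (g : ModelFiber F) :
    fr.conn D p u g = fr.coord ((chartAt E x₀).symm p) (D.toFun (fun z ↦ fr.sec z g)
      ((chartAt E x₀).symm p) (coordField E x₀ u ((chartAt E x₀).symm p))) := by
  rw [coordField_eq_fderiv E x₀ _ ((chartAt E x₀).map_target hp)]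
  rfl

variable [FiniteDimensional ℂ F]

theorem sec_localSec (σ : ∀ y, V y) {p : E} (hp : p ∈ fr.dom) :
    fr.sec ((chartAt E x₀).symm p) (fr.localSec σ p) = σ ((chartAt E x₀).symm p) :=
  fr.sec_coord _ hp.2 _

/-- The connection in the frame and the chart. -/
theorem toFun_eq {σ : ∀ y, V y} {p : E} (hp : p ∈ fr.dom) {σ' : E →L[ℝ] ModelFiber F}
    (hσ : HasFDerivAt (fr.localSec σ) σ' p) (u : E) :
    D.toFun σ ((chartAt E x₀).symm p) (coordField E x₀ u ((chartAt E x₀).symm p)) =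
      fr.sec ((chartAt E x₀).symm p) (σ' u + fr.conn D p u (fr.localSec σ p)) := by
  set φ := chartAt E x₀
  set y := φ.symm p
  have hy : y ∈ φ.source := φ.map_target hp.1
  have hyp : φ y = p := φ.right_inv hp.1
  let G := ModelFiber F
  let b (i) : G := EuclideanSpace.single i (1 : ℂ)
  let re (i : Fin (finrank ℂ F)) : G →L[ℝ] ℝ :=
    Complex.reCLM.comp ((EuclideanSpace.proj i : G →L[ℂ] ℂ).restrictScalars ℝ)
  let im (i : Fin (finrank ℂ F)) : G →L[ℝ] ℝ :=
    Complex.imCLM.comp ((EuclideanSpace.proj i : G →L[ℂ] ℂ).restrictScalars ℝ)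
  -- The Leibniz rule holds for real coefficients, so sections are expanded over the real frame b_i,
  -- √-1 b_i.
  have hdec (z : X) (g : G) : fr.sec z g =
      ∑ i, (re i g • fr.sec z (b i) + im i g • fr.sec z (Complex.I • b i)) := by
    conv_lhs => rw [eq_sum_single g]
    rw [map_sum]
    refine Finset.sum_congr rfl fun i _ ↦ ?_
    rw [smul_real, smul_real, ← map_smul, ← map_smul, ← map_add, smul_smul, ← add_smul]
    congr 2
    exact (Complex.re_add_im (g i)).symm
  -- the coefficients
  have hcoef (r : G →L[ℝ] ℝ) : MDifferentiableAt 𝓘(ℝ, E) 𝓘(ℝ, ℝ)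
        (fun z ↦ r (fr.localSec σ (φ z))) y ∧
      mvfderiv 𝓘(ℝ, E) (fun z ↦ r (fr.localSec σ (φ z))) y (coordField E x₀ u y) = r (σ' u) := by
    have hr : HasFDerivAt (fun q ↦ r (fr.localSec σ q)) (r.comp σ') p := r.hasFDerivAt.comp p hσ
    have hmd : MDifferentiableAt 𝓘(ℝ, E) 𝓘(ℝ, ℝ) (fun z ↦ r (fr.localSec σ (φ z))) y := by
      have h1 : MDifferentiableAt 𝓘(ℝ, E) 𝓘(ℝ, ℝ) (fun q ↦ r (fr.localSec σ q)) (φ y) := by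
        rw [hyp]
        exact hr.differentiableAt.mdifferentiableAt
      exact h1.comp y (mdifferentiableAt_atlas (chart_mem_atlas E x₀) hy)
    refine ⟨hmd, ?_⟩
    rw [mvfderiv_coordField E x₀ y hy u hmd, hyp]
    have hev : (fun z ↦ r (fr.localSec σ (φ z))) ∘ φ.symm =ᶠ[𝓝 p]
        fun q ↦ r (fr.localSec σ q) := by
      filter_upwards [φ.open_target.mem_nhds hp.1] with q hq
      simp only [Function.comp_apply, φ.right_inv hq]
    rw [hev.fderiv_eq (𝕜 := ℝ), hr.fderiv]
    rfl
  have hg (g) := (fr.smooth_sec g).mdifferentiableAt y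
  let term (i) (z : X) : V z := re i (fr.localSec σ (φ z)) • fr.sec z (b i) +
    im i (fr.localSec σ (φ z)) • fr.sec z (Complex.I • b i)
  have hterm (i) : MDifferentiableAt 𝓘(ℝ, E) (𝓘(ℝ, E).prod 𝓘(ℝ, F))
      (fun z ↦ TotalSpace.mk' F z (term i z)) y :=
    mdifferentiableAt_add (mdifferentiableAt_smul (hcoef (re i)).1 (hg _))
      (mdifferentiableAt_smul (hcoef (im i)).1 (hg _))
  have hsum (s : Finset (Fin (finrank ℂ F))) (v : TangentSpace 𝓘(ℝ, E) y) :
      D.toFun (fun z ↦ ∑ i ∈ s, term i z) y v = ∑ i ∈ s, D.toFun (term i) y v := by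
    classical
    induction s using Finset.induction_on with
    | empty =>
      simp only [Finset.sum_empty]
      exact congrArg (fun L ↦ L v) (D.isCovariantDerivativeOnUniv.zero (x := y))
    | insert i s hi ih =>
      simp only [Finset.sum_insert hi]
      rw [D.toFun_add (hterm i) (MDifferentiableAt.sum_section fun j _ ↦ hterm j), ih]
  -- The expansion holds only where the sections form a frame; locality of the connection makes this
  -- enough.
  have hev : ∀ᶠ z in 𝓝 y, σ z = ∑ i, term i z := by
    filter_upwards [fr.isOpen_nhd.mem_nhds hp.2] with z hz
    have hz' : φ.symm (φ z) = z := φ.left_inv (fr.nhd_subset hz)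
    have h1 : fr.localSec σ (φ z) = fr.coord z (σ z) := by
      unfold localSec
      rw [hz']
    rw [← hdec z (fr.localSec σ (φ z)), h1, fr.sec_coord z hz]
  have hτ : MDifferentiableAt 𝓘(ℝ, E) (𝓘(ℝ, E).prod 𝓘(ℝ, F))
      (fun z ↦ TotalSpace.mk' F z (∑ i, term i z)) y :=
    MDifferentiableAt.sum_section fun i _ ↦ hterm i
  have hσm : MDifferentiableAt 𝓘(ℝ, E) (𝓘(ℝ, E).prod 𝓘(ℝ, F))
      (fun z ↦ TotalSpace.mk' F z (σ z)) y := by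
    refine hτ.congr_of_eventuallyEq ?_
    filter_upwards [hev] with z hz
    rw [hz]
  have hD : D.toFun σ y = D.toFun (fun z ↦ ∑ i, term i z) y :=
    D.isCovariantDerivativeOnUniv.congr_of_eventuallyEq hσm hτ Filter.univ_mem hev
  rw [hD, hsum]
  have hsec (g : G) : fr.sec y (fr.conn D p u g) =
      D.toFun (fun z ↦ fr.sec z g) y (coordField E x₀ u y) := by
    rw [fr.conn_apply D hp.1, fr.sec_coord y hp.2]
  have hterm' (i) : D.toFun (term i) y (coordField E x₀ u y) =
      (re i (fr.localSec σ p) • fr.sec y (fr.conn D p u (b i)) +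
        re i (σ' u) • fr.sec y (b i)) +
      (im i (fr.localSec σ p) • fr.sec y (fr.conn D p u (Complex.I • b i)) +
        im i (σ' u) • fr.sec y (Complex.I • b i)) := by
    simp only [term]
    rw [D.toFun_add (mdifferentiableAt_smul (hcoef (re i)).1 (hg _)) (mdifferentiableAt_smul (hcoef (im i)).1 (hg _)),
      D.toFun_smul (hg _) (hcoef _).1, D.toFun_smul (hg _) (hcoef _).1, (hcoef _).2, (hcoef _).2,
      hsec, hsec, hyp]
  rw [Finset.sum_congr rfl fun i _ ↦ hterm' i, map_add, hdec y (σ' u)]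
  have hA : fr.sec y (fr.conn D p u (fr.localSec σ p)) =
      ∑ i, (re i (fr.localSec σ p) • fr.sec y (fr.conn D p u (b i)) +
        im i (fr.localSec σ p) • fr.sec y (fr.conn D p u (Complex.I • b i))) := by
    conv_lhs => rw [eq_sum_single (fr.localSec σ p)]
    rw [map_sum, map_sum]
    refine Finset.sum_congr rfl fun i _ ↦ ?_
    rw [smul_real, smul_real, map_smul (fr.conn D p u) Complex.I, map_smul, map_smul, map_smul,
      smul_smul, ← add_smul]
    congr 1
    exact (Complex.re_add_im _).symm
  rw [hA, ← Finset.sum_add_distrib]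
  refine Finset.sum_congr rfl fun i _ ↦ ?_
  abel

theorem contDiffOn_conn : ContDiffOn ℝ ∞ (fr.conn D) fr.dom := by
  have : FiniteDimensional ℝ E := FiniteDimensional.complexToReal E
  rw [contDiffOn_clm_apply]
  intro u
  refine contDiffOn_of_inner fun f g p hp ↦ ContDiffAt.contDiffWithinAt ?_
  set y := (chartAt E x₀).symm p
  have hy : y ∈ (chartAt E x₀).source := (chartAt E x₀).map_target hp.1
  have h1 : ContMDiffAt 𝓘(ℝ, E) (𝓘(ℝ, E).prod 𝓘(ℝ, F)) ∞ (fun z ↦ TotalSpace.mk' F z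
      (D.toFun (fun z ↦ fr.sec z g) z (coordField E x₀ u z))) y := by
    -- A smooth connection loses one derivative, which costs nothing here since ∞ + 1 = ∞.
    have hs : ContMDiffOn 𝓘(ℝ, E) (𝓘(ℝ, E).prod 𝓘(ℝ, F)) (∞ + 1)
        (fun z ↦ TotalSpace.mk' F z (fr.sec z g)) univ := (fr.smooth_sec g).contMDiffOn
    have h2 := (D.smooth.contMDiff hs).contMDiffAt (x := y) Filter.univ_mem
    have h3 := (contMDiffOn_coordField E x₀ u).contMDiffAt
      ((chartAt E x₀).open_source.mem_nhds hy)
    exact ContMDiffAt.clm_bundle_apply h2 h3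
  have h4 := fr.contDiffAt_localSec (σ := fun z ↦ D.toFun (fun z ↦ fr.sec z g) z
    (coordField E x₀ u z)) hp h1
  refine ((contDiffAt_const (c := f)).inner ℂ h4).congr_of_eventuallyEq ?_
  filter_upwards [fr.isOpen_dom.mem_nhds hp] with q hq
  rw [fr.conn_apply D hq.1]
  rfl

end LocalFrame

end ConnectionForm

/-! ### Frame expressions for ψ, the derivative of an endomorphism and squares of operators -/

section FrameFormulas

variable {E : Type*} [NormedAddCommGroup E] [NormedSpace ℂ E] [FiniteDimensional ℂ E]
  {X : Type*} [TopologicalSpace X] [ChartedSpace E X] [IsManifold 𝓘(ℂ, E) ω X]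
  {F : Type*} [NormedAddCommGroup F] [NormedSpace ℂ F] [FiniteDimensional ℂ F]
  {V : X → Type*} [TopologicalSpace (TotalSpace F V)] [∀ x, AddCommGroup (V x)]
  [∀ x, Module ℂ (V x)] [∀ x, TopologicalSpace (V x)]
  [∀ x, IsTopologicalAddGroup (V x)] [∀ x, ContinuousSMul ℝ (V x)]
  [FiberBundle F V] [VectorBundle ℂ F V]

namespace LocalFrame

variable {x₀ : X} (fr : LocalFrame E F V x₀) (D : Connection E F V) (H : HermitianMetric E F V)

/-- Every fibre vector is the value of a global smooth section, so at most one endomorphism meets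
the defining condition. -/
theorem endOf_eq {y : X} (hy : y ∈ fr.nhd) {P : (∀ z, V z) → V y} {A : Module.End ℂ (V y)}
    (hA : ∀ σ : ∀ z, V z, IsSmooth E F σ → A (σ y) = P σ) : endOf E F y P = A := by
  have h := Classical.epsilon_spec (p := fun A : Module.End ℂ (V y) ↦
    ∀ σ : ∀ z, V z, IsSmooth E F σ → A (σ y) = P σ) ⟨A, hA⟩
  ext v
  rw [← fr.sec_coord y hy v]
  exact (h _ (fr.smooth_sec (fr.coord y v))).trans (hA _ (fr.smooth_sec (fr.coord y v))).symm

theorem hasFDerivAt_localSec {σ : ∀ y, V y} (hσ : IsSmooth E F σ) {p : E} (hp : p ∈ fr.dom) :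
    HasFDerivAt (fr.localSec σ) (fderiv ℝ (fr.localSec σ) p) p :=
  ((fr.contDiffAt_localSec hp (hσ _)).differentiableAt (by simp)).hasFDerivAt

theorem hasFDerivAt_apply {P : Type*} [NormedAddCommGroup P] [NormedSpace ℝ P]
    {T : P → ModelEnd F} {T' : P →L[ℝ] ModelEnd F} {f : P → ModelFiber F}
    {f' : P →L[ℝ] ModelFiber F} {p : P} (hT : HasFDerivAt T T' p) (hf : HasFDerivAt f f' p) :
    ∃ L : P →L[ℝ] ModelFiber F, HasFDerivAt (fun q ↦ T q (f q)) L p ∧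
      ∀ u, L u = T' u (f p) + T p (f' u) := by
  have h := ((ContinuousLinearMap.restrictScalarsL ℂ (ModelFiber F) (ModelFiber F) ℝ
    ℝ).hasFDerivAt.comp p hT).clm_apply hf
  refine ⟨_, h, fun u ↦ ?_⟩
  exact add_comm _ _

/-- The self-adjoint part of the connection in the frame and the chart. -/
noncomputable def potential (p : E) : E →L[ℝ] ModelEnd F :=
  selfAdjointForm (fr.localMetric H p) (fderiv ℝ (fr.localMetric H) p) (fr.conn D p)

theorem star_fderiv_localMetric {p : E} (hp : p ∈ fr.dom) (u : E) :
    star (fderiv ℝ (fr.localMetric H) p u) = fderiv ℝ (fr.localMetric H) p u := by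
  have h : HasFDerivAt (fr.localMetric H) (fderiv ℝ (fr.localMetric H) p) p :=
    (((fr.contDiffOn_localMetric H).contDiffAt (fr.isOpen_dom.mem_nhds hp)).differentiableAt
      (by simp)).hasFDerivAt
  have h2 := (starReal (ModelEnd F)).hasFDerivAt.comp p h
  have h3 : starReal (ModelEnd F) ∘ fr.localMetric H = fr.localMetric H :=
    funext fun q ↦ fr.star_localMetric H q
  rw [h3] at h2
  exact congrArg (fun L ↦ L u) (h2.unique h)

theorem star_potential_mul {p : E} (hp : p ∈ fr.dom) (u : E) :
    star (fr.potential D H p u) * fr.localMetric H p =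
      fr.localMetric H p * fr.potential D H p u :=
  star_selfAdjointForm_mul (fr.isUnit_localMetric H hp) (fr.star_localMetric H p)
    (fr.star_fderiv_localMetric H hp) _ u

theorem fderiv_localMetric {p : E} (hp : p ∈ fr.dom) (u : E) :
    fderiv ℝ (fr.localMetric H) p u =
      star (fr.conn D p u - fr.potential D H p u) * fr.localMetric H p +
        fr.localMetric H p * (fr.conn D p u - fr.potential D H p u) :=
  deriv_eq_unitary (fr.isUnit_localMetric H hp) (fr.star_localMetric H p)
    (fr.star_fderiv_localMetric H hp) _ u

theorem contDiffOn_potential : ContDiffOn ℝ ∞ (fr.potential D H) fr.dom :=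
  contDiffOn_selfAdjointForm (fr.contDiffOn_localMetric H)
    ((fr.contDiffOn_localMetric H).fderiv_of_isOpen fr.isOpen_dom (by norm_cast))
    (fr.contDiffOn_conn D) fun _ hp ↦ fr.isUnit_localMetric H hp

theorem metric_sec {p : E} (f g : ModelFiber F) :
    H.toFun ((chartAt E x₀).symm p) (fr.sec _ f) (fr.sec _ g) =
      inner ℂ f (fr.localMetric H p g) := (fr.inner_localMetric H p f g).symm

theorem isSelfAdjointAt_lift {p : E} (hp : p ∈ fr.dom) {T : ModelEnd F}
    (hT : star T * fr.localMetric H p = fr.localMetric H p * T) :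
    H.IsSelfAdjointAt ((chartAt E x₀).symm p) (fr.lift _ T) := by
  intro v w
  obtain ⟨f, rfl⟩ := (fr.equiv hp.2).surjective v
  obtain ⟨g, rfl⟩ := (fr.equiv hp.2).surjective w
  change H.toFun _ (fr.lift _ T (fr.sec _ f)) (fr.sec _ g) =
    H.toFun _ (fr.sec _ f) (fr.lift _ T (fr.sec _ g))
  rw [lift_apply, lift_apply, fr.coord_sec _ hp.2, fr.coord_sec _ hp.2, metric_sec, metric_sec]
  have h := congrArg (fun S : ModelEnd F ↦ inner ℂ f (S g)) hT
  simp only [mul_apply_eq_comp, ContinuousLinearMap.star_eq_adjoint,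
    ContinuousLinearMap.adjoint_inner_right] at h
  exact h

/-- The form `ψ_H` in the frame and the chart. -/
theorem psi_eq {p : E} (hp : p ∈ fr.dom) (u : E) :
    D.psi H ((chartAt E x₀).symm p) (coordField E x₀ u ((chartAt E x₀).symm p)) =
      fr.lift _ (fr.potential D H p u) := by
  set y := (chartAt E x₀).symm p with hydef
  have hy : y ∈ (chartAt E x₀).source := (chartAt E x₀).map_target hp.1
  have hyp : chartAt E x₀ y = p := (chartAt E x₀).right_inv hp.1
  have hsa := fr.isSelfAdjointAt_lift H hp (fr.star_potential_mul D H hp u)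
  have hη : HasFDerivAt (fr.localMetric H) (fderiv ℝ (fr.localMetric H) p) p :=
    (((fr.contDiffOn_localMetric H).contDiffAt (fr.isOpen_dom.mem_nhds hp)).differentiableAt
      (by simp)).hasFDerivAt
  -- The matrix `potential` satisfies the conditions defining ψ_H; this is the product rule applied
  -- to ⟨σ, ητ⟩ in the frame.
  have hcand : ∀ σ τ : ∀ z, V z, IsSmooth E F σ → IsSmooth E F τ →
      mvfderiv 𝓘(ℝ, E) (fun z ↦ H.toFun z (σ z) (τ z)) y (coordField E x₀ u y) =
        H.toFun y (D.toFun σ y (coordField E x₀ u y) -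
          fr.lift y (fr.potential D H p u) (σ y)) (τ y) +
        H.toFun y (σ y) (D.toFun τ y (coordField E x₀ u y) -
          fr.lift y (fr.potential D H p u) (τ y)) := by
    intro σ τ hσ hτ
    have hσ' := fr.hasFDerivAt_localSec hσ hp
    have hτ' := fr.hasFDerivAt_localSec hτ hp
    rw [mvfderiv_coordField E x₀ y hy u ((H.smooth σ τ hσ hτ).mdifferentiable (by simp) y), hyp]
    have hev : (fun z ↦ H.toFun z (σ z) (τ z)) ∘ (chartAt E x₀).symm =ᶠ[𝓝 p]
        fun q ↦ inner ℂ (fr.localSec σ q) (fr.localMetric H q (fr.localSec τ q)) := by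
      filter_upwards [fr.isOpen_dom.mem_nhds hp] with q hq
      rw [inner_localMetric, fr.sec_localSec σ hq, fr.sec_localSec τ hq]
      rfl
    rw [hev.fderiv_eq (𝕜 := ℝ)]
    obtain ⟨L, hL, hL'⟩ := hasFDerivAt_apply hη hτ'
    rw [(hσ'.inner ℂ hL).fderiv, ContinuousLinearMap.comp_apply, ContinuousLinearMap.prod_apply,
      fderivInnerCLM_apply, hL', fr.toFun_eq D hp hσ', fr.toFun_eq D hp hτ', lift_apply,
      lift_apply, fr.fderiv_localMetric D H hp]
    change _ = H.toFun y (_ - fr.sec y (fr.potential D H p u (fr.localSec σ p))) (τ y) +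
      H.toFun y (σ y) (_ - fr.sec y (fr.potential D H p u (fr.localSec τ p)))
    rw [← map_sub, ← map_sub, ← fr.sec_localSec σ hp, ← fr.sec_localSec τ hp, metric_sec,
      metric_sec]
    simp only [add_apply, mul_apply_eq_comp,
      ContinuousLinearMap.star_eq_adjoint, ContinuousLinearMap.adjoint_inner_right, inner_add_right,
      inner_sub_left, inner_sub_right, inner_add_left, map_add, map_sub, sub_apply]
    ring
  have hspec := Classical.epsilon_spec (p := fun A : Module.End ℂ (V y) ↦ H.IsSelfAdjointAt y A ∧
    ∀ σ τ : ∀ z, V z, IsSmooth E F σ → IsSmooth E F τ →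
      mvfderiv 𝓘(ℝ, E) (fun z ↦ H.toFun z (σ z) (τ z)) y (coordField E x₀ u y) =
        H.toFun y (D.toFun σ y (coordField E x₀ u y) - A (σ y)) (τ y) +
        H.toFun y (σ y) (D.toFun τ y (coordField E x₀ u y) - A (τ y)))
    ⟨fr.lift y (fr.potential D H p u), hsa, hcand⟩
  change H.IsSelfAdjointAt y (D.psi H y (coordField E x₀ u y)) ∧ ∀ σ τ : ∀ z, V z,
    IsSmooth E F σ → IsSmooth E F τ →
      mvfderiv 𝓘(ℝ, E) (fun z ↦ H.toFun z (σ z) (τ z)) y (coordField E x₀ u y) =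
        H.toFun y (D.toFun σ y (coordField E x₀ u y) - D.psi H y (coordField E x₀ u y) (σ y))
          (τ y) +
        H.toFun y (σ y) (D.toFun τ y (coordField E x₀ u y) -
          D.psi H y (coordField E x₀ u y) (τ y)) at hspec
  obtain ⟨hsa', hspec⟩ := hspec
  ext w
  refine sub_eq_zero.1 ?_
  by_contra h0
  set w' := D.psi H y (coordField E x₀ u y) w - fr.lift y (fr.potential D H p u) w
  -- Uniqueness: subtracting the two metric conditions gives H(Δv,w) + H(v,Δw) = 0 for the
  -- difference Δ, and self-adjointness turns this into 2H(v,Δw) = 0.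
  have key (v : V y) : H.toFun y v w' = 0 := by
    have h1 := hspec _ _ (fr.smooth_sec (fr.coord y v)) (fr.smooth_sec (fr.coord y w))
    rw [hcand _ _ (fr.smooth_sec _) (fr.smooth_sec _)] at h1
    simp only [fr.sec_coord y hp.2, map_sub, LinearMap.sub_apply] at h1
    rw [hsa v w, hsa' v w] at h1
    simp only [w', map_sub]
    linear_combination (1 / 2 : ℂ) * h1
  have := H.positive y w' h0
  rw [key] at this
  simp at this

/-- The covariant derivative of an endomorphism in the frame and the chart. -/
theorem endDeriv_eq {S : ∀ y, Module.End ℂ (V y)} {p : E} (hp : p ∈ fr.dom)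
    (hS : DifferentiableAt ℝ (fr.localEnd S) p) (u : E) :
    D.endDeriv S ((chartAt E x₀).symm p) (coordField E x₀ u ((chartAt E x₀).symm p)) =
      fr.lift _ (fderiv ℝ (fr.localEnd S) p u + (fr.conn D p u * fr.localEnd S p -
        fr.localEnd S p * fr.conn D p u)) := by
  set y := (chartAt E x₀).symm p with hydef
  refine fr.endOf_eq hp.2 fun σ hσ ↦ ?_
  have hσ' := fr.hasFDerivAt_localSec hσ hp
  obtain ⟨L, hL, hL'⟩ := hasFDerivAt_apply hS.hasFDerivAt hσ'
  have hSσ : HasFDerivAt (fr.localSec fun z ↦ S z (σ z)) L p := by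
    refine hL.congr_of_eventuallyEq ?_
    filter_upwards [fr.isOpen_dom.mem_nhds hp] with q hq
    simp only [localEnd, push_apply]
    rw [fr.sec_localSec σ hq]
    rfl
  rw [fr.toFun_eq D hp hSσ, fr.toFun_eq D hp hσ', hL']
  have h1 (g : ModelFiber F) : S y (fr.sec y g) = fr.sec y (fr.localEnd S p g) := by
    simp only [localEnd, push_apply]
    rw [fr.sec_coord y hp.2]
  have h2 : fr.localSec (fun z ↦ S z (σ z)) p = fr.localEnd S p (fr.localSec σ p) := by
    simp only [localEnd, push_apply]
    rw [fr.sec_localSec σ hp]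
    rfl
  rw [h1, ← map_sub, h2, lift_apply]
  congr 1
  change (_ : ModelEnd F) (fr.localSec σ p) = _
  simp only [add_apply, sub_apply, mul_apply_eq_comp, map_add]
  abel

/-- The square of a first-order operator in the frame and the chart. -/
theorem endOf_square (z₁ z₂ : ℂ) {C : E → E →L[ℝ] ModelEnd F} {C' : E →L[ℝ] E →L[ℝ] ModelEnd F}
    (hC : HasFDerivAt C C' (chartAt E x₀ x₀))
    {P : (∀ x, V x) → ∀ x : X, TangentSpace 𝓘(ℝ, E) x → V x}
    (hP : ∀ (σ : ∀ x, V x) (p : E), p ∈ fr.dom → ∀ σ' : E →L[ℝ] ModelFiber F,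
      HasFDerivAt (fr.localSec σ) σ' p → ∀ u : E,
      P σ ((chartAt E x₀).symm p) (coordField E x₀ u ((chartAt E x₀).symm p)) =
        fr.sec _ (z₁ • σ' u + z₂ • σ' (Complex.I • u) + C p u (fr.localSec σ p)))
    (u w : E) :
    endOf E F x₀ (fun σ ↦ square P σ x₀ u w) =
      fr.lift x₀ ((z₁ • C' u w + z₂ • C' (Complex.I • u) w) -
        (z₁ • C' w u + z₂ • C' (Complex.I • w) u) +
        (C (chartAt E x₀ x₀) u * C (chartAt E x₀ x₀) w -
          C (chartAt E x₀ x₀) w * C (chartAt E x₀ x₀) u)) := by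
  set p := chartAt E x₀ x₀
  have hp : p ∈ fr.dom := fr.mem_dom
  have hx : (chartAt E x₀).symm p = x₀ := (chartAt E x₀).left_inv (mem_chart_source E x₀)
  refine fr.endOf_eq fr.mem_nhd fun σ hσ ↦ ?_
  have hsm : ContDiffAt ℝ ∞ (fr.localSec σ) p := fr.contDiffAt_localSec hp (hσ _)
  set f := fr.localSec σ
  set f'' := fderiv ℝ (fderiv ℝ f) p
  have hf : HasFDerivAt f (fderiv ℝ f p) p := fr.hasFDerivAt_localSec hσ hp
  have hf'' : HasFDerivAt (fderiv ℝ f) f'' p :=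
    ((hsm.fderiv_right (m := 1) (by norm_cast)).differentiableAt (by simp)).hasFDerivAt
  have hsymm : IsSymmSndFDerivAt ℝ f p := hsm.isSymmSndFDerivAt (by
    rw [minSmoothness_of_isRCLikeNormedField]; norm_cast)
  have hsec (w : E) : ∃ L : E →L[ℝ] ModelFiber F,
      HasFDerivAt (fr.localSec fun y ↦ P σ y (coordField E x₀ w y)) L p ∧
      (∀ v, L v = z₁ • f'' v w + z₂ • f'' v (Complex.I • w) + (C' v w (f p) +
        C p w (fderiv ℝ f p v))) ∧
      fr.localSec (fun y ↦ P σ y (coordField E x₀ w y)) p = z₁ • fderiv ℝ f p w +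
        z₂ • fderiv ℝ f p (Complex.I • w) + C p w (f p) := by
    have hval : ∀ q ∈ fr.dom, fr.localSec (fun y ↦ P σ y (coordField E x₀ w y)) q =
        z₁ • fderiv ℝ f q w + z₂ • fderiv ℝ f q (Complex.I • w) + C q w (f q) := fun q hq ↦ by
      simp only [localSec]
      rw [hP σ q hq _ (fr.hasFDerivAt_localSec hσ hq), fr.coord_sec _ hq.2]
    have hd (v : E) : HasFDerivAt (fun q ↦ fderiv ℝ f q v) (f''.flip v) p :=
      ((ContinuousLinearMap.apply ℝ (ModelFiber F) v).hasFDerivAt.comp p hf'').congr_fderiv rfl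
    obtain ⟨L, hL, hL'⟩ := hasFDerivAt_apply (NHYM.hasFDerivAt_apply hC w) hf
    refine ⟨_, ((((hd w).const_smul z₁).add ((hd (Complex.I • w)).const_smul z₂)).add
      hL).congr_of_eventuallyEq ?_, fun v ↦ ?_, hval p hp⟩
    · filter_upwards [fr.isOpen_dom.mem_nhds hp] with q hq using hval q hq
    · simp only [add_apply, hL']
      rfl
  have hPP (u w : E) : P (fun y ↦ P σ y (coordField E x₀ w y)) x₀ u =
      fr.sec x₀ (z₁ • (z₁ • f'' u w + z₂ • f'' u (Complex.I • w) + (C' u w (f p) +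
        C p w (fderiv ℝ f p u))) + z₂ • (z₁ • f'' (Complex.I • u) w +
        z₂ • f'' (Complex.I • u) (Complex.I • w) + (C' (Complex.I • u) w (f p) +
        C p w (fderiv ℝ f p (Complex.I • u)))) + C p u (z₁ • fderiv ℝ f p w +
        z₂ • fderiv ℝ f p (Complex.I • w) + C p w (f p))) := by
    obtain ⟨L, hL, hL', hval⟩ := hsec w
    have h := hP _ p hp L hL u
    rw [hx, hL', hL', hval] at h
    exact (congrArg (P _ x₀) (coordField_self E x₀ u).symm).trans h
  have hfp : fr.sec x₀ (f p) = σ x₀ := by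
    have := fr.sec_localSec σ hp
    rwa [hx] at this
  have hfc : fr.coord x₀ (σ x₀) = f p := by rw [← hfp, fr.coord_sec x₀ fr.mem_nhd]
  unfold square
  refine Eq.trans ?_ (congrArg₂ (· - ·) (hPP u w) (hPP w u)).symm
  rw [← map_sub, lift_apply, hfc]
  congr 1
  -- Antisymmetrization removes the second derivatives of the section by symmetry, and the terms
  -- with its first derivatives cancel in pairs; what is left depends on σ(x₀) alone.
  rw [hsymm.eq w u, hsymm.eq w (Complex.I • u),
    hsymm.eq (Complex.I • w) u, hsymm.eq (Complex.I • w) (Complex.I • u)]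
  simp only [add_apply, sub_apply, FunLike.coe_smul, Pi.smul_apply, mul_apply_eq_comp,
    map_add, map_smul]
  module

end LocalFrame

end FrameFormulas

/-! ### Traces, contractions and the pseudo-curvature in a frame -/

section ModelTrace

variable (F : Type*) [NormedAddCommGroup F] [NormedSpace ℂ F]

/-- The trace on the endomorphisms of the model fibre. -/
noncomputable def modelTrace : ModelEnd F →L[ℝ] ℂ :=
  haveI : FiniteDimensional ℝ (ModelEnd F) := FiniteDimensional.complexToReal _
  LinearMap.toContinuousLinearMap
    (((LinearMap.trace ℂ (ModelFiber F)) ∘ₗ (ContinuousLinearMap.coeLM ℂ)).restrictScalars ℝ)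

variable {F}

theorem modelTrace_mul_comm (S T : ModelEnd F) : modelTrace F (S * T) = modelTrace F (T * S) :=
  LinearMap.trace_mul_comm ℂ (S : ModelFiber F →ₗ[ℂ] ModelFiber F) T

theorem modelTrace_smul (c : ℂ) (T : ModelEnd F) : modelTrace F (c • T) = c * modelTrace F T :=
  map_smul (LinearMap.trace ℂ (ModelFiber F)) c _

end ModelTrace

section Contract

variable {E : Type*} [NormedAddCommGroup E] [NormedSpace ℂ E] [FiniteDimensional ℂ E]
  {X : Type*} [TopologicalSpace X] [ChartedSpace E X] [IsManifold 𝓘(ℂ, E) ω X]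

/-- The contraction of a bilinear form in terms of the complex structure. -/
theorem KahlerForm.contract_eq (κ : KahlerForm E X) {W : Type*} [AddCommGroup W] [Module ℂ W]
    (x : X) {B : TangentSpace 𝓘(ℝ, E) x → TangentSpace 𝓘(ℝ, E) x → W}
    (hB : ∀ u, IsLinearMap ℝ (B u)) :
    κ.contract x B = (1 / 2 : ℂ) • ∑ a, B (κ.frame x a) (J E x (κ.frame x a)) := by
  unfold KahlerForm.contract
  congr 1
  refine Finset.sum_congr rfl fun a _ ↦ ?_
  -- The coefficients of Jeₐ are g(Jeₐ, e_b) = κ(Jeₐ, Je_b) = κ(eₐ, e_b), so the inner sum of the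
  -- contraction evaluates the form on Jeₐ.
  have h : J E x (κ.frame x a) =
      ∑ b, κ.toFun x (κ.frame x a) (κ.frame x b) • κ.frame x b := by
    conv_lhs => rw [← (κ.frame x).sum_repr (J E x (κ.frame x a))]
    refine Finset.sum_congr rfl fun b _ ↦ ?_
    congr 1
    rw [repr_of_orthonormal (κ.frame x) (κ.tangentMetric x) (κ.tangentMetric_frame x)]
    exact κ.invariant x _ _
  have h' (w) : B (κ.frame x a) w = (hB (κ.frame x a)).mk' _ w := rfl
  conv_rhs => rw [h, h', map_sum]
  refine Finset.sum_congr rfl fun b _ ↦ ?_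
  rw [map_smul, ← h']
  rfl

theorem KahlerForm.map_contract (κ : KahlerForm E X) {W W' : Type*} [AddCommGroup W] [Module ℂ W]
    [AddCommGroup W'] [Module ℂ W'] (f : W →ₗ[ℂ] W') (x : X)
    (B : TangentSpace 𝓘(ℝ, E) x → TangentSpace 𝓘(ℝ, E) x → W) :
    f (κ.contract x B) = κ.contract x (fun u w ↦ f (B u w)) := by
  simp only [KahlerForm.contract, map_smul, map_sum]

/-- The frame of the Kähler metric, as a family of vectors in the model space. -/
noncomputable def KahlerForm.frameVec (κ : KahlerForm E X) (x : X)
    (a : Fin (finrank ℝ (TangentSpace 𝓘(ℝ, E) x))) : E :=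
  κ.frame x a

theorem KahlerForm.contract_eq_frameVec (κ : KahlerForm E X) {W : Type*} [AddCommGroup W]
    [Module ℂ W] (x : X) {B : TangentSpace 𝓘(ℝ, E) x → TangentSpace 𝓘(ℝ, E) x → W}
    {C : E → E → W} (hBC : ∀ u w : E, B u w = C u w) (hC : ∀ u, IsLinearMap ℝ (C u)) :
    κ.contract x B = (1 / 2 : ℂ) • ∑ a, C (κ.frameVec x a) (Complex.I • κ.frameVec x a) := by
  have h : B = fun u w ↦ C u w := funext₂ hBC
  rw [h]
  exact κ.contract_eq x hC

theorem KahlerForm.sum_frameVec_I (κ : KahlerForm E X) {W : Type*} [NormedAddCommGroup W]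
    [NormedSpace ℝ W] (x : X) (B : E →L[ℝ] E →L[ℝ] W) :
    ∑ a, B (Complex.I • κ.frameVec x a) (Complex.I • κ.frameVec x a) =
      ∑ a, B (κ.frameVec x a) (κ.frameVec x a) :=
  κ.sum_frame_J x (toBilin B)

end Contract

section CurvatureTrace

variable {E : Type*} [NormedAddCommGroup E] [NormedSpace ℂ E] [FiniteDimensional ℂ E]
  {X : Type*} [TopologicalSpace X] [ChartedSpace E X] [IsManifold 𝓘(ℂ, E) ω X]
  {F : Type*} [NormedAddCommGroup F] [NormedSpace ℂ F] [FiniteDimensional ℂ F]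
  {V : X → Type*} [TopologicalSpace (TotalSpace F V)] [∀ x, AddCommGroup (V x)]
  [∀ x, Module ℂ (V x)] [∀ x, TopologicalSpace (V x)]
  [∀ x, IsTopologicalAddGroup (V x)] [∀ x, ContinuousSMul ℝ (V x)]
  [FiberBundle F V] [VectorBundle ℂ F V]

namespace LocalFrame

variable {x₀ : X} (fr : LocalFrame E F V x₀) (D : Connection E F V) (H : HermitianMetric E F V)

theorem symm_chart_center : (chartAt E x₀).symm (chartAt E x₀ x₀) = x₀ :=
  (chartAt E x₀).left_inv (mem_chart_source E x₀)

theorem psi_center (u : E) :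
    D.psi H x₀ u = fr.lift x₀ (fr.potential D H (chartAt E x₀ x₀) u) := by
  have h := fr.psi_eq D H fr.mem_dom u
  rw [symm_chart_center] at h
  exact (congrArg (D.psi H x₀) (coordField_self E x₀ u).symm).trans h

theorem endDeriv_center {S : ∀ y, Module.End ℂ (V y)}
    (hS : DifferentiableAt ℝ (fr.localEnd S) (chartAt E x₀ x₀)) (u : E) :
    D.endDeriv S x₀ u = fr.lift x₀ (fderiv ℝ (fr.localEnd S) (chartAt E x₀ x₀) u +
      (fr.conn D (chartAt E x₀ x₀) u * fr.localEnd S (chartAt E x₀ x₀) -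
        fr.localEnd S (chartAt E x₀ x₀) * fr.conn D (chartAt E x₀ x₀) u)) := by
  have h := fr.endDeriv_eq D fr.mem_dom hS u
  rw [symm_chart_center] at h
  exact (congrArg (D.endDeriv S x₀) (coordField_self E x₀ u).symm).trans h

theorem localEnd_center (S : ∀ y, Module.End ℂ (V y)) :
    fr.localEnd S (chartAt E x₀ x₀) = fr.push x₀ (S x₀) := by
  have h (y : X) (hy : y = x₀) : fr.push y (S y) = fr.push x₀ (S x₀) := by
    subst hy
    rfl
  exact h _ symm_chart_center

theorem trace_lift_mul {y : X} (hy : y ∈ fr.nhd) (T : ModelEnd F) (S : Module.End ℂ (V y)) :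
    LinearMap.trace ℂ (V y) (fr.lift y T * S) = modelTrace F (T * fr.push y S) := by
  rw [← trace_push hy, push_mul hy, push_lift hy]
  rfl

theorem hasFDerivAt_conn {p : E} (hp : p ∈ fr.dom) :
    HasFDerivAt (fr.conn D) (fderiv ℝ (fr.conn D) p) p :=
  (((fr.contDiffOn_conn D).contDiffAt (fr.isOpen_dom.mem_nhds hp)).differentiableAt
    (by simp)).hasFDerivAt

theorem hasFDerivAt_potential {p : E} (hp : p ∈ fr.dom) :
    HasFDerivAt (fr.potential D H) (fderiv ℝ (fr.potential D H) p) p :=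
  (((fr.contDiffOn_potential D H).contDiffAt (fr.isOpen_dom.mem_nhds hp)).differentiableAt
    (by simp)).hasFDerivAt

theorem curvature_eq (u w : E) :
    D.curvature x₀ u w = fr.lift x₀ (fderiv ℝ (fr.conn D) (chartAt E x₀ x₀) u w -
      fderiv ℝ (fr.conn D) (chartAt E x₀ x₀) w u +
      (fr.conn D (chartAt E x₀ x₀) u * fr.conn D (chartAt E x₀ x₀) w -
        fr.conn D (chartAt E x₀ x₀) w * fr.conn D (chartAt E x₀ x₀) u)) := by
  have h := fr.endOf_square 1 0 (fr.hasFDerivAt_conn D fr.mem_dom)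
    (P := fun τ y v ↦ D.toFun τ y v) (fun σ p hp σ' hσ u ↦ by
      rw [fr.toFun_eq D hp hσ, one_smul, zero_smul, add_zero]) u w
  simp only [one_smul, zero_smul, add_zero] at h
  exact h

/-- The connection form of the operator `D''_H`. -/
noncomputable def dbarForm (p : E) : E →L[ℝ] ModelEnd F :=
  (1 / 2 : ℂ) • fr.conn D p + (Complex.I / 2) • (fr.conn D p).comp (mulI E) -
    Complex.I • (fr.potential D H p).comp (mulI E)

/-- In the (0,1)-part of A - ψ plus the (1,0)-part of ψ, the terms in ψ(u) cancel and the two in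
ψ(√-1u) add up, which explains the shape of `dbarForm`. -/
theorem dbar_eq {σ : ∀ y, V y} {p : E} (hp : p ∈ fr.dom) {σ' : E →L[ℝ] ModelFiber F}
    (hσ : HasFDerivAt (fr.localSec σ) σ' p) (u : E) :
    D.dbar H σ ((chartAt E x₀).symm p) (coordField E x₀ u ((chartAt E x₀).symm p)) =
      fr.sec _ ((1 / 2 : ℂ) • σ' u + (Complex.I / 2) • σ' (Complex.I • u) +
        fr.dbarForm D H p u (fr.localSec σ p)) := by
  have hJ := J_coordField E x₀ _ ((chartAt E x₀).map_target hp.1) u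
  simp only [Connection.dbar, part01, part10, Connection.unitary]
  rw [hJ, fr.toFun_eq D hp hσ, fr.toFun_eq D hp hσ, fr.psi_eq D H hp, fr.psi_eq D H hp]
  have hc : fr.coord ((chartAt E x₀).symm p) (σ ((chartAt E x₀).symm p)) = fr.localSec σ p := rfl
  simp only [LinearMap.smul_apply, LinearMap.sub_apply, lift_apply, hc, ← map_sub, ← map_smul,
    ← map_add]
  congr 1
  have h : fr.dbarForm D H p u (fr.localSec σ p) =
      (1 / 2 : ℂ) • fr.conn D p u (fr.localSec σ p) +
      (Complex.I / 2) • fr.conn D p (Complex.I • u) (fr.localSec σ p) -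
      Complex.I • fr.potential D H p (Complex.I • u) (fr.localSec σ p) := rfl
  rw [h, (fr.potential D H p (Complex.I • u)).map_smul]
  match_scalars <;> ring_nf

theorem pseudoCurvature_eq (u w : E) {C' : E → E → ModelEnd F}
    (hC' : ∀ u w, C' u w = (1 / 2 : ℂ) • fderiv ℝ (fr.conn D) (chartAt E x₀ x₀) u w +
      (Complex.I / 2) • fderiv ℝ (fr.conn D) (chartAt E x₀ x₀) u (Complex.I • w) -
      Complex.I • fderiv ℝ (fr.potential D H) (chartAt E x₀ x₀) u (Complex.I • w)) :
    D.pseudoCurvature H x₀ u w = fr.lift x₀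
      (((1 / 2 : ℂ) • C' u w + (Complex.I / 2) • C' (Complex.I • u) w) -
      ((1 / 2 : ℂ) • C' w u + (Complex.I / 2) • C' (Complex.I • w) u) +
      (fr.dbarForm D H (chartAt E x₀ x₀) u * fr.dbarForm D H (chartAt E x₀ x₀) w -
        fr.dbarForm D H (chartAt E x₀ x₀) w * fr.dbarForm D H (chartAt E x₀ x₀) u)) := by
  have hA := fr.hasFDerivAt_conn D fr.mem_dom
  have hψ := fr.hasFDerivAt_potential D H fr.mem_dom
  let R : (E →L[ℝ] ModelEnd F) →L[ℝ] E →L[ℝ] ModelEnd F :=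
    (ContinuousLinearMap.compL ℝ E E (ModelEnd F)).flip (mulI E)
  have h1 := ((hA.const_smul (1 / 2 : ℂ)).add
    ((R.hasFDerivAt.comp _ hA).const_smul (Complex.I / 2))).sub
    ((R.hasFDerivAt.comp _ hψ).const_smul Complex.I)
  have h2 : HasFDerivAt (fr.dbarForm D H) _ (chartAt E x₀ x₀) := h1
  have h := fr.endOf_square (1 / 2) (Complex.I / 2) h2
    (P := D.dbar H) (fun σ p hp σ' hσ u ↦ fr.dbar_eq D H hp hσ u) u w
  simp only [hC']
  exact h

variable (κ : KahlerForm E X)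

theorem contract_curvature_eq (hD : D.IsNHYM κ) : ∃ c : ℝ,
    ∑ a, (fderiv ℝ (fr.conn D) (chartAt E x₀ x₀) (κ.frameVec x₀ a) (Complex.I • κ.frameVec x₀ a) -
      fderiv ℝ (fr.conn D) (chartAt E x₀ x₀) (Complex.I • κ.frameVec x₀ a) (κ.frameVec x₀ a) +
      (fr.conn D (chartAt E x₀ x₀) (κ.frameVec x₀ a) *
        fr.conn D (chartAt E x₀ x₀) (Complex.I • κ.frameVec x₀ a) -
        fr.conn D (chartAt E x₀ x₀) (Complex.I • κ.frameVec x₀ a) *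
        fr.conn D (chartAt E x₀ x₀) (κ.frameVec x₀ a))) = (Complex.I * c) • (1 : ModelEnd F) := by
  obtain ⟨c, hc⟩ := hD.yang_mills
  -- From √-1·½·∑ₐF(eₐ, Jeₐ) = c follows ∑ₐF(eₐ, Jeₐ) = √-1·(-2c).
  refine ⟨-2 * c, ?_⟩
  have h := congrArg (fr.push x₀) (hc x₀)
  rw [map_smul, map_smul, push_one fr.mem_nhd, κ.map_contract] at h
  have hB := fun u w : E ↦ (congrArg (fr.push x₀) (fr.curvature_eq D u w)).trans
    (push_lift fr.mem_nhd _)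
  have hc : κ.contract x₀ (fun u w ↦ fr.push x₀ (D.curvature x₀ u w)) = _ :=
    κ.contract_eq_frameVec x₀ hB ?_
  rw [hc] at h
  · have h2 := congrArg (fun z ↦ (-2 * Complex.I) • z) h
    simp only [smul_smul] at h2
    have h3 : -2 * Complex.I * (Complex.I * (1 / 2)) = 1 := by
      linear_combination (-1 : ℂ) * Complex.I_mul_I
    rw [← mul_assoc] at h2
    rw [mul_assoc, h3, one_smul] at h2
    refine h2.trans ?_
    congr 1
    push_cast
    ring
  · intro u
    constructor
    · intro w w'
      simp only [map_add, add_apply, mul_add, add_mul]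
      abel
    · intro r w
      simp only [map_smul, smul_apply, mul_smul_comm, smul_mul_assoc, smul_sub, smul_add]

/-- The contraction of the pseudo-curvature in a frame. -/
theorem contract_pseudoCurvature_eq (hD : D.IsNHYM κ) :
    fr.push x₀ ((-4 * Complex.I) • κ.contract x₀ (D.pseudoCurvature H x₀)) =
      (2 : ℂ) • ∑ a, (fderiv ℝ (fr.potential D H) (chartAt E x₀ x₀) (κ.frameVec x₀ a) (κ.frameVec x₀ a) +
        (fr.conn D (chartAt E x₀ x₀) (κ.frameVec x₀ a) *
          fr.potential D H (chartAt E x₀ x₀) (κ.frameVec x₀ a) -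
        fr.potential D H (chartAt E x₀ x₀) (κ.frameVec x₀ a) *
          fr.conn D (chartAt E x₀ x₀) (κ.frameVec x₀ a))) := by
  obtain ⟨c, hc⟩ := fr.contract_curvature_eq D κ hD
  have hdom := fr.isOpen_dom.mem_nhds fr.mem_dom
  have key := contract_pseudoCurvature (κ.frameVec x₀) ?_
    (((fr.contDiffOn_localMetric H).contDiffAt hdom).of_le (by norm_cast))
    (fr.isUnit_localMetric H fr.mem_dom) (fr.hasFDerivAt_conn D fr.mem_dom)
    (fr.hasFDerivAt_potential D H fr.mem_dom)
    (Filter.eventually_of_mem hdom fun q hq u ↦ fr.fderiv_localMetric D H hq u)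
    (Filter.eventually_of_mem hdom fun q hq u ↦ fr.star_potential_mul D H hq u)
    (fun _ _ ↦ rfl) (C := fun u ↦ fr.dbarForm D H (chartAt E x₀ x₀) u) (fun _ ↦ rfl)
    (fun _ _ ↦ rfl) (fun _ _ ↦ rfl) c hc
  · rw [← key, map_smul, κ.map_contract]
    have hB := fun u w : E ↦ (congrArg (fr.push x₀)
      (fr.pseudoCurvature_eq D H u w (fun _ _ ↦ rfl))).trans (push_lift fr.mem_nhd _)
    have hc : κ.contract x₀ (fun u w ↦ fr.push x₀ (D.pseudoCurvature H x₀ u w)) = _ :=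
      κ.contract_eq_frameVec x₀ hB ?_
    rw [hc, smul_smul]
    · congr 1
      ring
    · intro u
      constructor
      · intro w w'
        simp only [map_add, add_apply, mul_add, add_mul, smul_add, smul_sub]
        abel
      · intro r w
        simp only [map_smul, smul_apply, mul_smul_comm, smul_mul_assoc, smul_sub, smul_add,
          smul_comm _ r]
  · exact κ.sum_frameVec_I x₀

end LocalFrame

end CurvatureTrace

/-! ### The curvature trace as a divergence plus a first-order term -/

section TraceFormula

variable {E : Type*} [NormedAddCommGroup E] [NormedSpace ℂ E] [FiniteDimensional ℂ E]
  {X : Type*} [TopologicalSpace X] [ChartedSpace E X] [IsManifold 𝓘(ℂ, E) ω X]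
  {F : Type*} [NormedAddCommGroup F] [NormedSpace ℂ F] [FiniteDimensional ℂ F]
  {V : X → Type*} [TopologicalSpace (TotalSpace F V)] [∀ x, AddCommGroup (V x)]
  [∀ x, Module ℂ (V x)] [∀ x, TopologicalSpace (V x)]
  [∀ x, IsTopologicalAddGroup (V x)] [∀ x, ContinuousSMul ℝ (V x)]
  [FiberBundle F V] [VectorBundle ℂ F V]

/-- Sections of the endomorphism bundle which are continuously differentiable; it is enough to
have a frame around every point in which this holds at the point. -/
def IsC1End (E : Type*) [NormedAddCommGroup E] [NormedSpace ℂ E]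
    {X : Type*} [TopologicalSpace X] [ChartedSpace E X]
    (F : Type*) [NormedAddCommGroup F] [NormedSpace ℂ F]
    {V : X → Type*} [TopologicalSpace (TotalSpace F V)] [∀ x, AddCommGroup (V x)]
    [∀ x, Module ℂ (V x)] [∀ x, TopologicalSpace (V x)] [FiberBundle F V]
    (v : ∀ x, Module.End ℂ (V x)) : Prop :=
  ∀ x, ∃ fr : LocalFrame E F V x, ContDiffAt ℝ 1 (fr.localEnd v) (chartAt E x x)

theorem _root_.LinearMap.isLinearMap_of_eq {U W : Type*} [AddCommGroup U] [Module ℝ U]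
    [AddCommGroup W] [Module ℝ W] (L : U →ₗ[ℝ] W) {f : U → W} (h : ∀ u, f u = L u) :
    IsLinearMap ℝ f :=
  ⟨fun u w ↦ by rw [h, h, h, map_add], fun r u ↦ by rw [h, h, map_smul]⟩

namespace LocalFrame

variable {x₀ : X} (fr : LocalFrame E F V x₀)

/-- The endomorphism with a given matrix, as a linear map. -/
noncomputable def liftLinear (y : X) : ModelEnd F →ₗ[ℂ] Module.End ℂ (V y) where
  toFun := fr.lift y
  map_add' S T := by ext v; simp [lift_apply]
  map_smul' c S := by ext v; simp [lift_apply]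

end LocalFrame

variable (D : Connection E F V) (H : HermitianMetric E F V)

section Linear

variable [T2Space X] [ContMDiffVectorBundle ∞ F V 𝓘(ℝ, E)]

/-- The endomorphism ψ_H(v) is chosen separately for each `v`; linearity in `v` is visible only
through the frame formula. -/
theorem isLinearMap_psi (x : X) : IsLinearMap ℝ (D.psi H x) := by
  obtain ⟨fr⟩ := LocalFrame.exists (E := E) (F := F) (V := V) x
  exact LinearMap.isLinearMap_of_eq (U := E) (((fr.liftLinear x).restrictScalars ℝ) ∘ₗ
    (fr.potential D H (chartAt E x x) : E →ₗ[ℝ] ModelEnd F)) (fr.psi_center D H)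

end Linear

theorem isLinearMap_endDeriv {v : ∀ x, Module.End ℂ (V x)} (hv : IsC1End E F v) (x : X) :
    IsLinearMap ℝ (D.endDeriv v x) := by
  obtain ⟨fr, h⟩ := hv x
  refine LinearMap.isLinearMap_of_eq (U := E) (((fr.liftLinear x).restrictScalars ℝ) ∘ₗ
    ((fderiv ℝ (fr.localEnd v) (chartAt E x x) +
      ((ContinuousLinearMap.mul ℝ (ModelEnd F)).flip (fr.localEnd v (chartAt E x x)) -
      ContinuousLinearMap.mul ℝ (ModelEnd F) (fr.localEnd v (chartAt E x x))).comp
      (fr.conn D (chartAt E x x)) : E →L[ℝ] ModelEnd F) : E →ₗ[ℝ] ModelEnd F))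
    (fr.endDeriv_center D (h.differentiableAt one_ne_zero))

/-- The form `tr (ψ_H v)`. -/
noncomputable def traceForm [T2Space X] [ContMDiffVectorBundle ∞ F V 𝓘(ℝ, E)]
    (v : ∀ x, Module.End ℂ (V x)) (x : X) : TangentSpace 𝓘(ℝ, E) x →L[ℝ] ℂ :=
  haveI : T2Space (TangentSpace 𝓘(ℝ, E) x) := inferInstanceAs (T2Space E)
  LinearMap.toContinuousLinearMap (((LinearMap.trace ℂ (V x)).restrictScalars ℝ) ∘ₗ
    ((LinearMap.mulRight ℂ (v x)).restrictScalars ℝ) ∘ₗ (isLinearMap_psi D H x).mk')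

/-- The function `∑ₐ tr (ψ_H(eₐ) D_{eₐ} v)`. -/
noncomputable def traceDeriv (κ : KahlerForm E X) (v : ∀ x, Module.End ℂ (V x)) (x : X) : ℂ :=
  ∑ a, LinearMap.trace ℂ (V x) (D.psi H x (κ.frame x a) * D.endDeriv v x (κ.frame x a))

variable [T2Space X] [ContMDiffVectorBundle ∞ F V 𝓘(ℝ, E)]

theorem LocalFrame.localOneForm_traceForm {x₀ : X} (fr : LocalFrame E F V x₀)
    (v : ∀ x, Module.End ℂ (V x)) {p : E} (hp : p ∈ fr.dom) :
    localOneForm (traceForm D H v) x₀ p = (modelTrace F).comp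
      (((ContinuousLinearMap.mul ℝ (ModelEnd F)).flip (fr.localEnd v p)).comp
        (fr.potential D H p)) := by
  ext u
  rw [localOneForm_apply _ _ hp.1]
  change LinearMap.trace ℂ _ (D.psi H _ _ * v _) = modelTrace F (fr.potential D H p u * _)
  rw [fr.psi_eq D H hp, fr.trace_lift_mul hp.2]
  rfl

theorem isC1OneForm_traceForm {v : ∀ x, Module.End ℂ (V x)} (hv : IsC1End E F v) :
    IsC1OneForm (traceForm D H v) := fun x ↦ by
  obtain ⟨fr, h⟩ := hv x
  have hdom := fr.isOpen_dom.mem_nhds fr.mem_dom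
  refine ContDiffAt.congr_of_eventuallyEq ?_
    (Filter.eventually_of_mem hdom fun p hp ↦ fr.localOneForm_traceForm D H v hp)
  have hψ : ContDiffAt ℝ 1 (fr.potential D H) (chartAt E x x) :=
    ((fr.contDiffOn_potential D H).contDiffAt hdom).of_le (by norm_cast)
  exact contDiffAt_const.clm_comp
    (((ContinuousLinearMap.mul ℝ (ModelEnd F)).flip.contDiff.contDiffAt.comp _ h).clm_comp hψ)

/-- The curvature term as a divergence plus a term of first order. -/
theorem curvatureTrace_eq (κ : KahlerForm E X) (hD : D.IsNHYM κ) {v : ∀ x, Module.End ℂ (V x)}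
    (hv : IsC1End E F v) (x : X) :
    curvatureTrace κ D H v x =
      2 * κ.divergence (traceForm D H v) x - 2 * traceDeriv D H κ v x := by
  obtain ⟨fr, h⟩ := hv x
  have hdom := fr.isOpen_dom.mem_nhds fr.mem_dom
  have hv' := h.differentiableAt one_ne_zero
  set p := chartAt E x x with hp
  have h1 : curvatureTrace κ D H v x = modelTrace F
      (fr.push x ((-4 * Complex.I) • κ.contract x (D.pseudoCurvature H x)) *
        fr.push x (v x)) := by
    rw [← fr.trace_lift_mul fr.mem_nhd, LocalFrame.lift_push fr.mem_nhd]
    rfl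
  have h2 (u : E) : fderiv ℝ (localOneForm (traceForm D H v) x) p u u =
      modelTrace F (fderiv ℝ (fr.potential D H) p u u * fr.localEnd v p +
        fr.potential D H p u * fderiv ℝ (fr.localEnd v) p u) := by
    have hα := ((isC1OneForm_traceForm D H hv x).differentiableAt one_ne_zero).hasFDerivAt
    have e1 := hasFDerivAt_apply hα u
    have e2 : (fun q ↦ localOneForm (traceForm D H v) x q u) =ᶠ[𝓝 p]
        fun q ↦ modelTrace F (fr.potential D H q u * fr.localEnd v q) :=
      Filter.eventually_of_mem hdom fun q hq ↦
        congrArg (fun L : E →L[ℝ] ℂ ↦ L u) (fr.localOneForm_traceForm D H v hq)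
    have e3 := (modelTrace F).hasFDerivAt.comp p
      ((hasFDerivAt_apply (fr.hasFDerivAt_potential D H fr.mem_dom) u).mul' hv'.hasFDerivAt)
    have e4 := congrArg (fun L ↦ L u) (e1.unique (e3.congr_of_eventuallyEq e2))
    refine Eq.trans e4 ?_
    change modelTrace F (fr.potential D H p u * fderiv ℝ (fr.localEnd v) p u +
      fderiv ℝ (fr.potential D H) p u u * fr.localEnd v p) = _
    rw [add_comm]
  have h3 (u : E) : LinearMap.trace ℂ (V x) (D.psi H x u * D.endDeriv v x u) =
      modelTrace F (fr.potential D H p u * (fderiv ℝ (fr.localEnd v) p u +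
        (fr.conn D p u * fr.localEnd v p - fr.localEnd v p * fr.conn D p u))) := by
    rw [fr.psi_center D H, fr.endDeriv_center D hv', fr.trace_lift_mul fr.mem_nhd,
      LocalFrame.push_lift fr.mem_nhd]
  have h4 : κ.divergence (traceForm D H v) x = ∑ a, modelTrace F
      (fderiv ℝ (fr.potential D H) p (κ.frameVec x a) (κ.frameVec x a) * fr.localEnd v p +
        fr.potential D H p (κ.frameVec x a) * fderiv ℝ (fr.localEnd v) p (κ.frameVec x a)) :=
    Finset.sum_congr rfl fun a _ ↦ h2 (κ.frameVec x a)
  have h5 : traceDeriv D H κ v x = ∑ a, modelTrace F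
      (fr.potential D H p (κ.frameVec x a) * (fderiv ℝ (fr.localEnd v) p (κ.frameVec x a) +
        (fr.conn D p (κ.frameVec x a) * fr.localEnd v p -
          fr.localEnd v p * fr.conn D p (κ.frameVec x a)))) :=
    Finset.sum_congr rfl fun a _ ↦ h3 (κ.frameVec x a)
  rw [h1, fr.contract_pseudoCurvature_eq D H κ hD, ← fr.localEnd_center v, smul_mul_assoc,
    modelTrace_smul, h4, h5, ← mul_sub, ← Finset.sum_sub_distrib, Finset.sum_mul, map_sum]
  congr 1
  refine Finset.sum_congr rfl fun a _ ↦ ?_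
  rw [← map_sub]
  -- Cyclicity gives tr([A,ψ]v) = -tr(ψ[A,v]), which moves the connection terms from ψ onto the
  -- derivative of `v`.
  have hc (R S T : ModelEnd F) : modelTrace F (R * S * T) = modelTrace F (S * T * R) := by
    rw [mul_assoc, modelTrace_mul_comm]
  simp only [mul_add, mul_sub, add_mul, sub_mul, map_add, map_sub, ← mul_assoc]
  rw [hc (fr.conn D p (κ.frameVec x a))]
  ring

theorem integral_curvatureTrace [CompactSpace X] [MeasurableSpace E] [BorelSpace E]
    [MeasurableSpace X] [BorelSpace X] (κ : KahlerForm E X) (hD : D.IsNHYM κ)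
    {v : ∀ x, Module.End ℂ (V x)} (hv : IsC1End E F v) (hc : Continuous (traceDeriv D H κ v)) :
    Integrable (curvatureTrace κ D H v) κ.vol ∧
      ∫ x, curvatureTrace κ D H v x ∂κ.vol = -2 * ∫ x, traceDeriv D H κ v x ∂κ.vol := by
  have h : curvatureTrace κ D H v = fun x ↦
      2 * κ.divergence (traceForm D H v) x - 2 * traceDeriv D H κ v x :=
    funext (curvatureTrace_eq D H κ hD hv)
  have h1 := (κ.integrable_of_continuous
    (κ.continuous_divergence (isC1OneForm_traceForm D H hv))).const_mul 2
  have h2 := (κ.integrable_of_continuous hc).const_mul 2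
  rw [h]
  refine ⟨h1.sub h2, ?_⟩
  rw [integral_sub h1 h2, integral_const_mul, integral_const_mul,
    κ.integral_divergence_eq_zero (isC1OneForm_traceForm D H hv)]
  ring

end TraceFormula

/-! ### Continuity of the energy density and of the first-order term -/

section Energy

variable {E : Type*} [NormedAddCommGroup E] [NormedSpace ℂ E] [FiniteDimensional ℂ E]
  {X : Type*} [TopologicalSpace X] [ChartedSpace E X] [IsManifold 𝓘(ℂ, E) ω X]
  {F : Type*} [NormedAddCommGroup F] [NormedSpace ℂ F] [FiniteDimensional ℂ F]
  {V : X → Type*} [TopologicalSpace (TotalSpace F V)] [∀ x, AddCommGroup (V x)]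
  [∀ x, Module ℂ (V x)] [∀ x, TopologicalSpace (V x)]
  [∀ x, IsTopologicalAddGroup (V x)] [∀ x, ContinuousSMul ℝ (V x)]
  [FiberBundle F V] [VectorBundle ℂ F V]
  (D : Connection E F V) (H : HermitianMetric E F V) (κ : KahlerForm E X)

theorem continuousAt_of_chart {W : Type*} [TopologicalSpace W] {f : X → W} (x₀ : X)
    (h : ContinuousAt (fun p ↦ f ((chartAt E x₀).symm p)) (chartAt E x₀ x₀)) :
    ContinuousAt f x₀ := by
  have h1 := h.comp ((chartAt E x₀).continuousAt (mem_chart_source E x₀))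
  refine h1.congr (Filter.eventually_of_mem
    ((chartAt E x₀).open_source.mem_nhds (mem_chart_source E x₀)) fun y hy ↦ ?_)
  exact congrArg f ((chartAt E x₀).left_inv hy)

variable (E) in
/-- The coordinate functionals of a real basis of the model space. -/
noncomputable def coordDual (c : Fin (finrank ℝ E)) : E →L[ℝ] ℝ :=
  haveI : FiniteDimensional ℝ E := FiniteDimensional.complexToReal E
  LinearMap.toContinuousLinearMap ((finBasis ℝ E).coord c)

/-- Replaces the pointwise chosen orthonormal frame by data varying smoothly over one chart. `B` is
a bare function with linearity as hypotheses, because its values come from fibrewise choices. -/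
theorem KahlerForm.sum_frame_eq_chart {W : Type*} [AddCommGroup W] [Module ℝ W] (x₀ : X) {p : E}
    (hp : p ∈ (chartAt E x₀).target)
    {B : TangentSpace 𝓘(ℝ, E) ((chartAt E x₀).symm p) →
      TangentSpace 𝓘(ℝ, E) ((chartAt E x₀).symm p) → W}
    (h₁ : ∀ w, IsLinearMap ℝ fun u ↦ B u w) (h₂ : ∀ u, IsLinearMap ℝ (B u)) :
    ∑ a, B (κ.frame _ a) (κ.frame _ a) =
      haveI : FiniteDimensional ℝ E := FiniteDimensional.complexToReal E
      ∑ c, B (coordField E x₀ (finBasis ℝ E c) _)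
        (coordField E x₀ (κ.sharp x₀ p (coordDual E c)) _) := by
  have : FiniteDimensional ℝ E := FiniteDimensional.complexToReal E
  have h := κ.sum_frame_eq x₀ ((chartAt E x₀).map_target hp) (finBasis ℝ E)
    (LinearMap.mk₂ ℝ B (fun u u' w ↦ (h₁ w).map_add u u') (fun c u w ↦ (h₁ w).map_smul c u)
      (fun u w w' ↦ (h₂ u).map_add w w') (fun c u w ↦ (h₂ u).map_smul c w))
    (coordDual E) (fun c w ↦ rfl)
  rw [(chartAt E x₀).right_inv hp] at h
  exact h

/-- The function `∑ₐ tr (ψ_H(eₐ)²)`. -/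
noncomputable def potentialEnergy (x : X) : ℂ :=
  ∑ a, LinearMap.trace ℂ (V x) (D.psi H x (κ.frame x a) * D.psi H x (κ.frame x a))

theorem isLinearMap_trace_mul_left {x : X} {U : Type*} [AddCommGroup U] [Module ℝ U]
    {f : U → Module.End ℂ (V x)} (hf : IsLinearMap ℝ f) (S : Module.End ℂ (V x)) :
    IsLinearMap ℝ fun u ↦ LinearMap.trace ℂ (V x) (f u * S) :=
  LinearMap.isLinearMap_of_eq (((LinearMap.trace ℂ (V x)).restrictScalars ℝ) ∘ₗ
    ((LinearMap.mulRight ℂ S).restrictScalars ℝ) ∘ₗ hf.mk') fun _ ↦ rfl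

theorem isLinearMap_trace_mul_right {x : X} {U : Type*} [AddCommGroup U] [Module ℝ U]
    {f : U → Module.End ℂ (V x)} (hf : IsLinearMap ℝ f) (S : Module.End ℂ (V x)) :
    IsLinearMap ℝ fun u ↦ LinearMap.trace ℂ (V x) (S * f u) :=
  LinearMap.isLinearMap_of_eq (((LinearMap.trace ℂ (V x)).restrictScalars ℝ) ∘ₗ
    ((LinearMap.mulLeft ℂ S).restrictScalars ℝ) ∘ₗ hf.mk') fun _ ↦ rfl

variable [T2Space X] [ContMDiffVectorBundle ∞ F V 𝓘(ℝ, E)]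

namespace LocalFrame

variable {x₀ : X} (fr : LocalFrame E F V x₀)

theorem potentialEnergy_eq {p : E} (hp : p ∈ fr.dom) :
    potentialEnergy D H κ ((chartAt E x₀).symm p) =
      haveI : FiniteDimensional ℝ E := FiniteDimensional.complexToReal E
      ∑ c, modelTrace F (fr.potential D H p (finBasis ℝ E c) *
        fr.potential D H p (κ.sharp x₀ p (coordDual E c))) := by
  have h := isLinearMap_psi D H ((chartAt E x₀).symm p)
  refine (κ.sum_frame_eq_chart x₀ hp.1 (B := fun u w ↦ LinearMap.trace ℂ _
    (D.psi H _ u * D.psi H _ w)) (fun w ↦ isLinearMap_trace_mul_left h _)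
    (fun u ↦ isLinearMap_trace_mul_right h _)).trans (Finset.sum_congr rfl fun c _ ↦ ?_)
  rw [fr.psi_eq D H hp, fr.psi_eq D H hp, fr.trace_lift_mul hp.2, push_lift hp.2]

theorem traceDeriv_eq {v : ∀ x, Module.End ℂ (V x)} (hv : IsC1End E F v) {p : E}
    (hp : p ∈ fr.dom) (hd : DifferentiableAt ℝ (fr.localEnd v) p) :
    traceDeriv D H κ v ((chartAt E x₀).symm p) =
      haveI : FiniteDimensional ℝ E := FiniteDimensional.complexToReal E
      ∑ c, modelTrace F (fr.potential D H p (finBasis ℝ E c) *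
        (fderiv ℝ (fr.localEnd v) p (κ.sharp x₀ p (coordDual E c)) +
        (fr.conn D p (κ.sharp x₀ p (coordDual E c)) * fr.localEnd v p -
          fr.localEnd v p * fr.conn D p (κ.sharp x₀ p (coordDual E c))))) := by
  have h := isLinearMap_psi D H ((chartAt E x₀).symm p)
  have h' := isLinearMap_endDeriv D hv ((chartAt E x₀).symm p)
  refine (κ.sum_frame_eq_chart x₀ hp.1 (B := fun u w ↦ LinearMap.trace ℂ _
    (D.psi H _ u * D.endDeriv v _ w)) (fun w ↦ isLinearMap_trace_mul_left h _)
    (fun u ↦ isLinearMap_trace_mul_right h' _)).trans (Finset.sum_congr rfl fun c _ ↦ ?_)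
  rw [fr.psi_eq D H hp, fr.endDeriv_eq D hp hd, fr.trace_lift_mul hp.2, push_lift hp.2]

end LocalFrame

theorem continuous_traceDeriv {v : ∀ x, Module.End ℂ (V x)} (hv : IsC1End E F v) :
    Continuous (traceDeriv D H κ v) := by
  have : FiniteDimensional ℝ E := FiniteDimensional.complexToReal E
  refine continuous_iff_continuousAt.mpr fun x ↦ continuousAt_of_chart (E := E) x ?_
  obtain ⟨fr, h⟩ := hv x
  have hdom := fr.isOpen_dom.mem_nhds fr.mem_dom
  have hev := (h.eventually (by simp)).and hdom
  refine ContinuousAt.congr ?_ (hev.mono fun p hp ↦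
    (fr.traceDeriv_eq D H κ hv hp.2 (hp.1.differentiableAt one_ne_zero)).symm)
  have hψ := ((fr.contDiffOn_potential D H).contDiffAt hdom).continuousAt
  have hA := ((fr.contDiffOn_conn D).contDiffAt hdom).continuousAt
  have hv' := (h.fderiv_right (m := 0) (by simp)).continuousAt
  have hs (c) : ContinuousAt (fun q ↦ κ.sharp x q (coordDual E c)) (chartAt E x x) :=
    (κ.contDiffAt_sharp (n := 0) x (mem_chart_target E x)
      (contDiffAt_const (c := coordDual E c))).continuousAt
  exact tendsto_finsetSum _ fun c _ ↦ (modelTrace F).continuous.continuousAt.comp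
    ((hψ.clm_apply continuousAt_const).mul ((hv'.clm_apply (hs c)).add
      (((hA.clm_apply (hs c)).mul h.continuousAt).sub (h.continuousAt.mul (hA.clm_apply (hs c))))))

theorem continuous_potentialEnergy : Continuous (potentialEnergy D H κ) := by
  have : FiniteDimensional ℝ E := FiniteDimensional.complexToReal E
  refine continuous_iff_continuousAt.mpr fun x ↦ continuousAt_of_chart (E := E) x ?_
  obtain ⟨fr⟩ := LocalFrame.exists (E := E) (F := F) (V := V) x
  have hdom := fr.isOpen_dom.mem_nhds fr.mem_dom
  refine ContinuousAt.congr ?_ (Filter.eventually_of_mem hdom fun p hp ↦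
    (fr.potentialEnergy_eq D H κ hp).symm)
  have hψ := ((fr.contDiffOn_potential D H).contDiffAt hdom).continuousAt
  have hs (c) : ContinuousAt (fun q ↦ κ.sharp x q (coordDual E c)) (chartAt E x x) :=
    (κ.contDiffAt_sharp (n := 0) x (mem_chart_target E x)
      (contDiffAt_const (c := coordDual E c))).continuousAt
  exact tendsto_finsetSum _ fun c _ ↦ (modelTrace F).continuous.continuousAt.comp
    ((hψ.clm_apply continuousAt_const).mul (hψ.clm_apply (hs c)))

theorem IsSmoothEnd.isC1End {s : ∀ x, Module.End ℂ (V x)} (hs : IsSmoothEnd E F s) :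
    IsC1End E F s := fun x ↦ by
  obtain ⟨fr⟩ := LocalFrame.exists (E := E) (F := F) (V := V) x
  exact ⟨fr, ((fr.contDiffOn_localEnd hs).contDiffAt (fr.isOpen_dom.mem_nhds fr.mem_dom)).of_le
    (by norm_cast)⟩

end Energy

/-! ### Paths of metrics and the derivative of the energy density -/

section Path

variable {E : Type*} [NormedAddCommGroup E] [NormedSpace ℂ E] [FiniteDimensional ℂ E]
  {X : Type*} [TopologicalSpace X] [ChartedSpace E X] [IsManifold 𝓘(ℂ, E) ω X]
  {F : Type*} [NormedAddCommGroup F] [NormedSpace ℂ F] [FiniteDimensional ℂ F]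
  {V : X → Type*} [TopologicalSpace (TotalSpace F V)] [∀ x, AddCommGroup (V x)]
  [∀ x, Module ℂ (V x)] [∀ x, TopologicalSpace (V x)]
  [∀ x, IsTopologicalAddGroup (V x)] [∀ x, ContinuousSMul ℝ (V x)]
  [FiberBundle F V] [VectorBundle ℂ F V]

/-- Nondegeneracy of the metric leaves at most one solution. -/
theorem HermitianMetric.inverseMul_eq (H : HermitianMetric E F V) {x : X} {B : V x → V x → ℂ}
    {A : Module.End ℂ (V x)} (hA : ∀ u w, H.toFun x u (A w) = B u w) : H.inverseMul x B = A := by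
  have h : ∀ u w, H.toFun x u (H.inverseMul x B w) = B u w :=
    Classical.epsilon_spec (p := fun A : Module.End ℂ (V x) ↦ ∀ u w, H.toFun x u (A w) = B u w)
      ⟨A, hA⟩
  ext w
  by_contra hne
  have h1 := H.positive x (H.inverseMul x B w - A w) (sub_ne_zero.2 hne)
  rw [map_sub, h, hA, sub_self] at h1
  exact lt_irrefl 0 h1

variable {K L : HermitianMetric E F V} (γ : MetricPath K L)

namespace LocalFrame

variable {x₀ : X} (fr : LocalFrame E F V x₀)

/-- The matrix of a path of metrics in a frame. -/
noncomputable def pathMetric (z : ℝ × E) : ModelEnd F := fr.localMetric (γ.toFun z.1) z.2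

theorem contDiffOn_pathMetric :
    ContDiffOn ℝ ∞ (fr.pathMetric γ) (Icc (0 : ℝ) 1 ×ˢ fr.dom) := by
  refine contDiffOn_of_inner fun f g ↦ ?_
  simp only [pathMetric, inner_localMetric]
  have h := γ.smooth _ _ (fr.smooth_sec f) (fr.smooth_sec g)
  have : IsManifold 𝓘(ℝ, E) ∞ X := inferInstance
  have h1 : ContMDiffOn 𝓘(ℝ, ℝ × E) 𝓘(ℝ, E) ∞ (fun z : ℝ × E ↦ (chartAt E x₀).symm z.2)
      (Icc (0 : ℝ) 1 ×ˢ fr.dom) :=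
    (contMDiffOn_chart_symm (I := 𝓘(ℝ, E)) (n := ∞) (x := x₀)).comp
      contDiff_snd.contMDiff.contMDiffOn fun z hz ↦ hz.2.1
  have h2 : ContMDiffOn 𝓘(ℝ, ℝ × E) 𝓘(ℝ, ℝ) ∞ (fun z : ℝ × E ↦ z.1)
      (Icc (0 : ℝ) 1 ×ˢ fr.dom) := contDiff_fst.contMDiff.contMDiffOn
  have h3 := h.comp (h2.prodMk h1) fun z hz ↦ ⟨hz.1, mem_univ _⟩
  exact h3.contDiffOn

theorem isUnit_pathMetric {z : ℝ × E} (hz : z ∈ Icc (0 : ℝ) 1 ×ˢ fr.dom) :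
    IsUnit (fr.pathMetric γ z) :=
  fr.isUnit_localMetric _ hz.2

theorem fderiv_localMetric_path {t : ℝ} (ht : t ∈ Icc (0 : ℝ) 1) {p : E} (hp : p ∈ fr.dom) :
    fderiv ℝ (fr.localMetric (γ.toFun t)) p = spaceDeriv fr.dom (fr.pathMetric γ) (t, p) :=
  (hasFDerivAt_space fr.isOpen_dom (fr.contDiffOn_pathMetric γ) ht hp).fderiv

/-- The matrix of the velocity of a path of metrics. -/
noncomputable def pathVelocity (z : ℝ × E) : ModelEnd F :=
  Ring.inverse (fr.pathMetric γ z) * timeDeriv fr.dom (fr.pathMetric γ) z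

theorem pathMetric_mul_pathVelocity {z : ℝ × E} (hz : z ∈ Icc (0 : ℝ) 1 ×ˢ fr.dom) :
    fr.pathMetric γ z * fr.pathVelocity γ z = timeDeriv fr.dom (fr.pathMetric γ) z :=
  Ring.mul_inverse_cancel_left _ _ (fr.isUnit_pathMetric γ hz)

theorem contDiffOn_pathVelocity :
    ContDiffOn ℝ ∞ (fr.pathVelocity γ) (Icc (0 : ℝ) 1 ×ˢ fr.dom) :=
  (contDiffOn_ringInverse (fr.contDiffOn_pathMetric γ) fun _ hz ↦ fr.isUnit_pathMetric γ hz).mul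
    (contDiffOn_timeDeriv fr.isOpen_dom (fr.contDiffOn_pathMetric γ))

theorem velocity_eq {t : ℝ} (ht : t ∈ Icc (0 : ℝ) 1) {p : E} (hp : p ∈ fr.dom) :
    γ.velocity t ((chartAt E x₀).symm p) = fr.lift _ (fr.pathVelocity γ (t, p)) := by
  refine (γ.toFun t).inverseMul_eq fun u w ↦ ?_
  have hu := fr.sec_coord _ hp.2 u
  have hw := fr.sec_coord _ hp.2 w
  have h1 (τ : ℝ) : (γ.toFun τ).toFun ((chartAt E x₀).symm p) u w =
      inner ℂ (fr.coord _ u) (fr.pathMetric γ (τ, p) (fr.coord _ w)) := by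
    rw [pathMetric, inner_localMetric, hu, hw]
  have h2 := hasDerivWithinAt_time (fr.contDiffOn_pathMetric γ) ht hp
  let Φ : ModelEnd F →L[ℝ] ℂ := ((innerSL ℂ (fr.coord _ u)).comp
    (ContinuousLinearMap.apply ℂ (ModelFiber F) (fr.coord _ w))).restrictScalars ℝ
  have h3 : HasDerivWithinAt (fun τ ↦ (γ.toFun τ).toFun ((chartAt E x₀).symm p) u w)
      (Φ (timeDeriv fr.dom (fr.pathMetric γ) (t, p))) (Icc 0 1) t := by
    simp only [h1]
    exact Φ.hasFDerivAt.comp_hasDerivWithinAt t h2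
  rw [h3.derivWithin (uniqueDiffOn_Icc zero_lt_one t ht), ← fr.pathMetric_mul_pathVelocity γ ⟨ht, hp⟩]
  conv_lhs => rw [← hu, lift_apply, fr.metric_sec]
  rfl

theorem localEnd_velocity {t : ℝ} (ht : t ∈ Icc (0 : ℝ) 1) {p : E} (hp : p ∈ fr.dom) :
    fr.localEnd (γ.velocity t) p = fr.pathVelocity γ (t, p) := by
  change fr.push _ (γ.velocity t _) = _
  rw [fr.velocity_eq γ ht hp, push_lift hp.2]

theorem contDiffOn_localEnd_velocity {t : ℝ} (ht : t ∈ Icc (0 : ℝ) 1) :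
    ContDiffOn ℝ ∞ (fr.localEnd (γ.velocity t)) fr.dom :=
  ((fr.contDiffOn_pathVelocity γ).comp (contDiff_prodMk_right t).contDiffOn
    fun _ hp ↦ ⟨ht, hp⟩).congr fun _ hp ↦ fr.localEnd_velocity γ ht hp

variable (D : Connection E F V)

/-- The matrices of the forms `ψ` for a path of metrics. -/
noncomputable def pathPotential (z : ℝ × E) : E →L[ℝ] ModelEnd F :=
  selfAdjointForm (fr.pathMetric γ z) (spaceDeriv fr.dom (fr.pathMetric γ) z) (fr.conn D z.2)

theorem potential_path {t : ℝ} (ht : t ∈ Icc (0 : ℝ) 1) {p : E} (hp : p ∈ fr.dom) :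
    fr.potential D (γ.toFun t) p = fr.pathPotential γ D (t, p) := by
  rw [potential, fr.fderiv_localMetric_path γ ht hp]
  rfl

theorem contDiffOn_pathPotential :
    ContDiffOn ℝ ∞ (fr.pathPotential γ D) (Icc (0 : ℝ) 1 ×ˢ fr.dom) :=
  contDiffOn_selfAdjointForm (fr.contDiffOn_pathMetric γ)
    (contDiffOn_spaceDeriv fr.isOpen_dom (fr.contDiffOn_pathMetric γ))
    ((fr.contDiffOn_conn D).comp contDiff_snd.contDiffOn fun _ hz ↦ hz.2)
    fun _ hz ↦ fr.isUnit_pathMetric γ hz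

theorem hasDerivWithinAt_pathPotential {t : ℝ} (ht : t ∈ Icc (0 : ℝ) 1) {p : E} (hp : p ∈ fr.dom)
    (u : E) :
    HasDerivWithinAt (fun τ ↦ fr.pathPotential γ D (τ, p) u)
      (-((1 / 2 : ℝ) • (fderiv ℝ (fr.localEnd (γ.velocity t)) p u +
        (fr.conn D p u * fr.localEnd (γ.velocity t) p -
          fr.localEnd (γ.velocity t) p * fr.conn D p u))) -
      (fr.localEnd (γ.velocity t) p * fr.pathPotential γ D (t, p) u -
        fr.pathPotential γ D (t, p) u * fr.localEnd (γ.velocity t) p)) (Icc 0 1) t :=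
  hasDerivWithinAt_selfAdjointForm fr.isOpen_dom (fr.contDiffOn_pathMetric γ)
    (fr.contDiffOn_conn D) (fun _ hz ↦ fr.isUnit_pathMetric γ hz) ht hp
    (fun q hq ↦ by
      rw [fr.localEnd_velocity γ ht hq, fr.pathMetric_mul_pathVelocity γ ⟨ht, hq⟩]) u

end LocalFrame

variable [T2Space X] [ContMDiffVectorBundle ∞ F V 𝓘(ℝ, E)]
  (D : Connection E F V) (κ : KahlerForm E X)

theorem MetricPath.isC1End_velocity {t : ℝ} (ht : t ∈ Icc (0 : ℝ) 1) :
    IsC1End E F (γ.velocity t) := fun x ↦ by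
  obtain ⟨fr⟩ := LocalFrame.exists (E := E) (F := F) (V := V) x
  exact ⟨fr, ((fr.contDiffOn_localEnd_velocity γ ht).contDiffAt
    (fr.isOpen_dom.mem_nhds fr.mem_dom)).of_le (by norm_cast)⟩

/-- With ∂ₜψ = -½Dv - [v,ψ] one has ∂ₜtr(ψ²) = 2tr(ψ ∂ₜψ) = -tr(ψ Dv), because tr(ψ[v,ψ]) = 0. This
makes the functional independent of the path. -/
theorem MetricPath.hasDerivWithinAt_potentialEnergy {t : ℝ} (ht : t ∈ Icc (0 : ℝ) 1) (x : X) :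
    HasDerivWithinAt (fun τ ↦ potentialEnergy D (γ.toFun τ) κ x)
      (-traceDeriv D (γ.toFun t) κ (γ.velocity t) x) (Icc 0 1) t := by
  obtain ⟨fr⟩ := LocalFrame.exists (E := E) (F := F) (V := V) x
  have hdom := fr.isOpen_dom.mem_nhds fr.mem_dom
  have hd : DifferentiableAt ℝ (fr.localEnd (γ.velocity t)) (chartAt E x x) :=
    ((fr.contDiffOn_localEnd_velocity γ ht).contDiffAt hdom).differentiableAt (by simp)
  set p := chartAt E x x with hp
  have h1 {τ : ℝ} (hτ : τ ∈ Icc (0 : ℝ) 1) : potentialEnergy D (γ.toFun τ) κ x =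
      ∑ a, modelTrace F (fr.pathPotential γ D (τ, p) (κ.frameVec x a) *
        fr.pathPotential γ D (τ, p) (κ.frameVec x a)) := by
    refine Finset.sum_congr rfl fun a _ ↦ ?_
    have h := fr.psi_center D (γ.toFun τ) (κ.frameVec x a)
    rw [fr.potential_path γ D hτ fr.mem_dom] at h
    have e : D.psi (γ.toFun τ) x (κ.frame x a) = _ := h
    rw [e, fr.trace_lift_mul fr.mem_nhd, LocalFrame.push_lift fr.mem_nhd]
  have h2 : -traceDeriv D (γ.toFun t) κ (γ.velocity t) x = ∑ a, -modelTrace F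
      (fr.pathPotential γ D (t, p) (κ.frameVec x a) *
        (fderiv ℝ (fr.localEnd (γ.velocity t)) p (κ.frameVec x a) +
        (fr.conn D p (κ.frameVec x a) * fr.localEnd (γ.velocity t) p -
          fr.localEnd (γ.velocity t) p * fr.conn D p (κ.frameVec x a)))) := by
    rw [Finset.sum_neg_distrib]
    congr 1
    refine Finset.sum_congr rfl fun a _ ↦ ?_
    have h := fr.psi_center D (γ.toFun t) (κ.frameVec x a)
    rw [fr.potential_path γ D ht fr.mem_dom] at h
    have e : D.psi (γ.toFun t) x (κ.frame x a) = _ := h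
    have e' : D.endDeriv (γ.velocity t) x (κ.frame x a) = _ :=
      fr.endDeriv_center D hd (κ.frameVec x a)
    rw [e, e', fr.trace_lift_mul fr.mem_nhd, LocalFrame.push_lift fr.mem_nhd]
  rw [h2]
  refine HasDerivWithinAt.congr_of_mem ?_ (fun τ hτ ↦ h1 hτ) ht
  refine HasDerivWithinAt.fun_sum fun a _ ↦ ?_
  have h3 := fr.hasDerivWithinAt_pathPotential γ D ht fr.mem_dom (κ.frameVec x a)
  refine ((modelTrace F).hasFDerivAt.comp_hasDerivWithinAt t (h3.mul h3)).congr_deriv ?_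
  rw [← hp]
  set Q := fr.pathPotential γ D (t, p) (κ.frameVec x a)
  set v := fr.localEnd (γ.velocity t) p
  set B := fderiv ℝ (fr.localEnd (γ.velocity t)) p (κ.frameVec x a) +
        (fr.conn D p (κ.frameVec x a) * v - v * fr.conn D p (κ.frameVec x a))
  change modelTrace F ((-((1 / 2 : ℝ) • B) - (v * Q - Q * v)) * Q +
    Q * (-((1 / 2 : ℝ) • B) - (v * Q - Q * v))) = -modelTrace F (Q * B)
  have h4 : modelTrace F (Q * (v * Q)) = modelTrace F (Q * (Q * v)) := by
    rw [← mul_assoc, modelTrace_mul_comm]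
  rw [map_add, modelTrace_mul_comm _ Q, mul_sub, mul_sub, mul_neg, mul_smul_comm, map_sub, map_sub,
    map_neg, map_smul, h4, Complex.real_smul]
  push_cast
  ring

end Path

/-! ### Donaldson's functional as a difference of energies -/

section Functional

variable {E : Type*} [NormedAddCommGroup E] [NormedSpace ℂ E] [FiniteDimensional ℂ E]
  {X : Type*} [TopologicalSpace X] [ChartedSpace E X] [IsManifold 𝓘(ℂ, E) ω X]
  {F : Type*} [NormedAddCommGroup F] [NormedSpace ℂ F] [FiniteDimensional ℂ F]
  {V : X → Type*} [TopologicalSpace (TotalSpace F V)] [∀ x, AddCommGroup (V x)]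
  [∀ x, Module ℂ (V x)] [∀ x, TopologicalSpace (V x)]
  [∀ x, IsTopologicalAddGroup (V x)] [∀ x, ContinuousSMul ℝ (V x)]
  [FiberBundle F V] [VectorBundle ℂ F V]
  {K L : HermitianMetric E F V} (γ : MetricPath K L) (D : Connection E F V) (κ : KahlerForm E X)
  [T2Space X] [ContMDiffVectorBundle ∞ F V 𝓘(ℝ, E)]

/-- The function `(t, x) ↦ ∑ₐ tr (ψ(eₐ) D_{eₐ} v)` along a path of metrics with velocity `v`. -/
noncomputable def MetricPath.traceDeriv (z : ℝ × X) : ℂ :=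
  NHYM.traceDeriv D (γ.toFun z.1) κ (γ.velocity z.1) z.2

/-- Joint continuity comes for free from the energy density: the function is minus its time
derivative, and the energy density is smooth on [0,1] times a chart domain. -/
theorem MetricPath.continuousOn_traceDeriv :
    ContinuousOn (γ.traceDeriv D κ) (Icc 0 1 ×ˢ univ) := by
  have : FiniteDimensional ℝ E := FiniteDimensional.complexToReal E
  rintro ⟨t, x⟩ ⟨ht, -⟩
  obtain ⟨fr⟩ := LocalFrame.exists (E := E) (F := F) (V := V) x
  let e (z : ℝ × E) : ℂ := ∑ c, modelTrace F (fr.pathPotential γ D z (finBasis ℝ E c) *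
    fr.pathPotential γ D z (κ.sharp x z.2 (coordDual E c)))
  have he : ContDiffOn ℝ ∞ e (Icc 0 1 ×ˢ fr.dom) := by
    have hψ := fr.contDiffOn_pathPotential γ D
    have hs (c) : ContDiffOn ℝ ∞ (fun q ↦ κ.sharp x q (coordDual E c)) fr.dom := fun p hp ↦
      (κ.contDiffAt_sharp (n := ⊤) x hp.1
        (contDiffAt_const (c := coordDual E c))).contDiffWithinAt
    exact ContDiffOn.sum fun c _ ↦ (modelTrace F).contDiff.comp_contDiffOn
      ((hψ.clm_apply contDiffOn_const).mul
        (hψ.clm_apply ((hs c).comp contDiff_snd.contDiffOn fun _ hz ↦ hz.2)))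
  have h1 {τ : ℝ} (hτ : τ ∈ Icc (0 : ℝ) 1) {y : X} (hy : y ∈ fr.nhd) :
      γ.traceDeriv D κ (τ, y) = -timeDeriv fr.dom e (τ, chartAt E x y) := by
    have hp := fr.mem_dom_of_mem hy
    have h2 := hasDerivWithinAt_time he hτ hp
    have h3 := γ.hasDerivWithinAt_potentialEnergy D κ hτ y
    have h4 {σ : ℝ} (hσ : σ ∈ Icc (0 : ℝ) 1) :
        potentialEnergy D (γ.toFun σ) κ y = e (σ, chartAt E x y) := by
      have h5 := fr.potentialEnergy_eq D (γ.toFun σ) κ hp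
      rw [(chartAt E x).left_inv (fr.nhd_subset hy), fr.potential_path γ D hσ hp] at h5
      exact h5
    -- Both derivatives are taken within [0,1], so uniqueness also covers the endpoints.
    have h6 := (uniqueDiffOn_Icc (zero_lt_one' ℝ) τ hτ).eq_deriv _ h3
      (h2.congr_of_mem (fun σ hσ ↦ h4 hσ) hτ)
    rw [← h6, neg_neg]
    rfl
  have h7 : ContinuousOn (γ.traceDeriv D κ) (Icc 0 1 ×ˢ fr.nhd) := by
    have h8 := (contDiffOn_timeDeriv fr.isOpen_dom he).continuousOn.neg
    have h9 : ContinuousOn (fun z : ℝ × X ↦ (z.1, chartAt E x z.2)) (Icc 0 1 ×ˢ fr.nhd) :=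
      continuousOn_fst.prodMk ((chartAt E x).continuousOn.comp continuousOn_snd
        fun _ hz ↦ fr.nhd_subset hz.2)
    exact (h8.comp h9 fun z hz ↦ ⟨hz.1, fr.mem_dom_of_mem hz.2⟩).congr fun z hz ↦ h1 hz.1 hz.2
  refine (h7 (t, x) ⟨ht, fr.mem_nhd⟩).mono_of_mem_nhdsWithin ?_
  have h10 : univ ×ˢ fr.nhd ∈ 𝓝 (t, x) := prod_mem_nhds Filter.univ_mem
    (fr.isOpen_nhd.mem_nhds fr.mem_nhd)
  filter_upwards [self_mem_nhdsWithin, mem_nhdsWithin_of_mem_nhds h10] with z hz hz'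
  exact ⟨hz.1, hz'.2⟩

theorem MetricPath.integral_traceDeriv (x : X) :
    ∫ t in (0 : ℝ)..1, γ.traceDeriv D κ (t, x) =
      potentialEnergy D K κ x - potentialEnergy D L κ x := by
  have hc : ContinuousOn (fun t ↦ γ.traceDeriv D κ (t, x)) (Icc 0 1) :=
    (γ.continuousOn_traceDeriv D κ).comp (by fun_prop) fun t ht ↦ ⟨ht, mem_univ _⟩
  have h1 := intervalIntegral.integral_eq_sub_of_hasDerivAt_of_le (zero_le_one' ℝ)
    (f := fun t ↦ potentialEnergy D (γ.toFun t) κ x) (f' := fun t ↦ -γ.traceDeriv D κ (t, x))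
    (fun t ht ↦ (γ.hasDerivWithinAt_potentialEnergy D κ ht x).continuousWithinAt)
    (fun t ht ↦ (γ.hasDerivWithinAt_potentialEnergy D κ (Ioo_subset_Icc_self ht) x).hasDerivAt
      (Icc_mem_nhds ht.1 ht.2))
    (hc.neg.intervalIntegrable_of_Icc zero_le_one)
  rw [intervalIntegral.integral_neg, γ.source, γ.target] at h1
  linear_combination -h1

variable [CompactSpace X] [MeasurableSpace E] [BorelSpace E] [MeasurableSpace X] [BorelSpace X]

theorem MetricPath.integrable_traceDeriv : Integrable (γ.traceDeriv D κ)
    (((volume : Measure ℝ).restrict (Ioc 0 1)).prod κ.vol) := by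
  have : FiniteDimensional ℝ E := FiniteDimensional.complexToReal E
  -- Needed to pass from continuity to measurability for the product σ-algebra on ℝ × X.
  have : SecondCountableTopology X := ChartedSpace.secondCountable_of_sigmaCompact E X
  have h := (γ.continuousOn_traceDeriv D κ).integrableOn_compact
    (μ := (volume : Measure ℝ).prod κ.vol) (isCompact_Icc.prod isCompact_univ)
  have h2 := h.mono_set (prod_mono (Ioc_subset_Icc_self (a := (0 : ℝ)) (b := 1)) subset_rfl)
  rwa [IntegrableOn, ← Measure.prod_restrict, Measure.restrict_univ] at h2

theorem integrable_curvatureTrace_path (hD : D.IsNHYM κ) {t : ℝ} (ht : t ∈ Icc (0 : ℝ) 1) :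
    Integrable (curvatureTrace κ D (γ.toFun t) (γ.velocity t)) κ.vol ∧
      ∫ x, curvatureTrace κ D (γ.toFun t) (γ.velocity t) x ∂κ.vol =
        -2 * ∫ x, γ.traceDeriv D κ (t, x) ∂κ.vol :=
  integral_curvatureTrace D (γ.toFun t) κ hD (γ.isC1End_velocity ht)
    (continuous_traceDeriv D (γ.toFun t) κ (γ.isC1End_velocity ht))

theorem intervalIntegrable_curvatureTrace_path (hD : D.IsNHYM κ) :
    IntervalIntegrable
      (fun t ↦ ∫ x, curvatureTrace κ D (γ.toFun t) (γ.velocity t) x ∂κ.vol) volume 0 1 := by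
  rw [intervalIntegrable_iff_integrableOn_Ioc_of_le zero_le_one]
  have h := (γ.integrable_traceDeriv D κ).integral_prod_left.const_mul (-2)
  exact h.congr ((ae_restrict_mem measurableSet_Ioc).mono fun t ht ↦
    (integrable_curvatureTrace_path γ D κ hD (Ioc_subset_Icc_self ht)).2.symm)

/-- Donaldson's functional is the difference of the energies of the forms `ψ`. -/
theorem donaldson_eq (hD : D.IsNHYM κ) :
    donaldson κ D γ =
      ∫ x, (2 * potentialEnergy D L κ x - 2 * potentialEnergy D K κ x) ∂κ.vol := by
  have h1 : donaldson κ D γ = ∫ t in (0 : ℝ)..1, -2 * ∫ x, γ.traceDeriv D κ (t, x) ∂κ.vol := by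
    refine intervalIntegral.integral_congr fun t ht ↦ ?_
    rw [uIcc_of_le zero_le_one] at ht
    exact (integrable_curvatureTrace_path γ D κ hD ht).2
  rw [h1, intervalIntegral.integral_const_mul, intervalIntegral.integral_of_le zero_le_one,
    integral_integral_swap (f := fun t x ↦ γ.traceDeriv D κ (t, x)) (γ.integrable_traceDeriv D κ),
    ← integral_const_mul]
  refine integral_congr_ae (Filter.Eventually.of_forall fun x ↦ ?_)
  have h := γ.integral_traceDeriv D κ x
  rw [intervalIntegral.integral_of_le zero_le_one] at h
  simp only [h]
  ring

end Functional

/-! ### Spectral projections of a self-adjoint endomorphism -/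

section SelfAdjoint

variable {W : Type*} [AddCommGroup W] [Module ℂ W] [FiniteDimensional ℂ W]
  (c : InnerProductSpace.Core ℂ W)

theorem trace_eq_sum_onBasis (T : Module.End ℂ W) :
    LinearMap.trace ℂ W T = ∑ i, c.inner (onBasis c i) (T (onBasis c i)) := by
  let _ : NormedAddCommGroup W := c.toNormedAddCommGroup
  let _ : InnerProductSpace ℂ W := InnerProductSpace.ofCore c.toCore
  have h := LinearMap.trace_eq_sum_inner T (stdOrthonormalBasis ℂ W)
  have e : onBasis c = (stdOrthonormalBasis ℂ W).toBasis := rfl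
  rw [e]
  simp only [OrthonormalBasis.coe_toBasis]
  exact h

variable {c} {A : Module.End ℂ W}

/-- A symmetric operator is semisimple. Squarefreeness is all that the Lagrange projections require.
-/
theorem minpoly_squarefree_of_selfAdjoint (hA : ∀ u w, c.inner (A u) w = c.inner u (A w)) :
    Squarefree (minpoly ℂ A) := by
  let _ : NormedAddCommGroup W := c.toNormedAddCommGroup
  let _ : InnerProductSpace ℂ W := InnerProductSpace.ofCore c.toCore
  have h : LinearMap.IsSymmetric A := hA
  exact (Module.End.isFinitelySemisimple_iff_isSemisimple.1
    h.isFinitelySemisimple).minpoly_squarefree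

theorem ofReal_re_of_mem_eigenvalueSet (hA : ∀ u w, c.inner (A u) w = c.inner u (A w)) {l : ℂ}
    (hl : l ∈ eigenvalueSet A) : (l.re : ℂ) = l := by
  let _ : NormedAddCommGroup W := c.toNormedAddCommGroup
  let _ : InnerProductSpace ℂ W := InnerProductSpace.ofCore c.toCore
  have h : LinearMap.IsSymmetric A := hA
  rw [eigenvalueSet, Multiset.mem_toFinset] at hl
  have h1 := h.conj_eigenvalue_eq_self
    (Module.End.hasEigenvalue_iff_isRoot.2 (Polynomial.isRoot_of_mem_roots hl))
  exact Complex.conj_eq_iff_re.1 h1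

theorem sum_eigenProj (A : Module.End ℂ W) : ∑ l ∈ eigenvalueSet A, eigenProj A l = 1 := by
  classical
  -- Lagrange basis polynomials sum to 1 only over a nonempty node set; on the zero space there are
  -- no eigenvalues.
  rcases subsingleton_or_nontrivial W with h | h
  · exact Subsingleton.elim _ _
  have hne : (eigenvalueSet A).Nonempty := by
    obtain ⟨μ, hμ⟩ := Module.End.exists_eigenvalue A
    refine ⟨μ, ?_⟩
    rw [eigenvalueSet, Multiset.mem_toFinset, Polynomial.mem_roots
      (minpoly.ne_zero (Algebra.IsIntegral.isIntegral A))]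
    exact Module.End.hasEigenvalue_iff_isRoot.1 hμ
  simp only [eigenProj]
  rw [← map_sum, Lagrange.sum_basis Function.injective_id.injOn hne, map_one]

theorem aeval_nodal_eigenvalueSet (hA : Squarefree (minpoly ℂ A)) :
    Polynomial.aeval A (Lagrange.nodal (eigenvalueSet A) id) = 0 := by
  classical
  have hmon := minpoly.monic (Algebra.IsIntegral.isIntegral (R := ℂ) A)
  have hs := IsAlgClosed.splits (minpoly ℂ A)
  have hnd : (minpoly ℂ A).roots.Nodup :=
    Polynomial.nodup_roots (PerfectField.separable_iff_squarefree.2 hA)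
  have h : Lagrange.nodal (eigenvalueSet A) id = minpoly ℂ A := by
    rw [Lagrange.nodal_eq, hs.eq_prod_roots_of_monic hmon, eigenvalueSet, Finset.prod,
      Multiset.toFinset_val, Multiset.dedup_eq_self.2 hnd]
    rfl
  rw [h, minpoly.aeval]

/-- The Lagrange polynomial times X - l is a multiple of the nodal polynomial, which is the minimal
polynomial and so vanishes at `A`. -/
theorem mul_eigenProj (hA : Squarefree (minpoly ℂ A)) {l : ℂ} (hl : l ∈ eigenvalueSet A) :
    A * eigenProj A l = l • eigenProj A l := by
  classical
  have h1 : (Polynomial.X - Polynomial.C l) * Lagrange.basis (eigenvalueSet A) id l =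
      Polynomial.C (Lagrange.nodalWeight (eigenvalueSet A) id l) *
        Lagrange.nodal (eigenvalueSet A) id := by
    rw [Lagrange.basis_eq_prod_sub_inv_mul_nodal_div hl, ← Lagrange.nodal_erase_eq_nodal_div hl,
      Lagrange.nodal_eq_mul_nodal_erase hl]
    simp only [id]
    ring
  have h2 := congrArg (Polynomial.aeval A) h1
  rw [map_mul, map_mul, aeval_nodal_eigenvalueSet hA, mul_zero, map_sub, Polynomial.aeval_X,
    Polynomial.aeval_C, sub_mul, sub_eq_zero, Algebra.algebraMap_eq_smul_one, smul_mul_assoc,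
    one_mul] at h2
  exact h2

theorem eigenProj_mul (hA : Squarefree (minpoly ℂ A)) {l : ℂ} (hl : l ∈ eigenvalueSet A) :
    eigenProj A l * A = l • eigenProj A l := by
  rw [← mul_eigenProj hA hl]
  classical
  have h := congrArg (Polynomial.aeval A)
    (mul_comm (Lagrange.basis (eigenvalueSet A) id l) Polynomial.X)
  rw [map_mul, map_mul, Polynomial.aeval_X] at h
  exact h

end SelfAdjoint

/-! ### The trace identity for functions of two eigenvalues -/

section Projections

variable {𝒜 : Type*} [Ring 𝒜] [Algebra ℂ 𝒜] {s : Finset ℂ} {P : ℂ → 𝒜} {S : 𝒜}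
  (hsum : ∑ l ∈ s, P l = 1) (hSP : ∀ l ∈ s, S * P l = l • P l) (hPS : ∀ l ∈ s, P l * S = l • P l)

include hSP hPS in
theorem proj_mul_of_ne {l m : ℂ} (hl : l ∈ s) (hm : m ∈ s) (hlm : l ≠ m) : P l * P m = 0 := by
  have h : (l - m) • (P l * P m) = 0 := by
    rw [sub_smul, ← smul_mul_assoc, ← hPS l hl, mul_assoc, hSP m hm, mul_smul_comm, sub_self]
  exact (smul_eq_zero.1 h).resolve_left (sub_ne_zero.2 hlm)

include hsum hSP hPS in
theorem proj_mul_self {l : ℂ} (hl : l ∈ s) : P l * P l = P l := by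
  conv_rhs => rw [← mul_one (P l), ← hsum, Finset.mul_sum]
  exact (Finset.sum_eq_single l (fun m hm hne ↦ proj_mul_of_ne hSP hPS hl hm hne.symm)
    fun h ↦ absurd hl h).symm

/-- The action of a function of two variables on an element of an algebra. -/
noncomputable def doubleSum (s : Finset ℂ) (P : ℂ → 𝒜) (φ : ℂ → ℂ → ℂ) (B : 𝒜) : 𝒜 :=
  ∑ l ∈ s, ∑ m ∈ s, φ l m • (P m * B * P l)

include hsum hSP hPS in
theorem proj_doubleSum_proj (φ : ℂ → ℂ → ℂ) (B : 𝒜) {l m : ℂ} (hl : l ∈ s) (hm : m ∈ s) :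
    P m * doubleSum s P φ B * P l = φ l m • (P m * B * P l) := by
  have h1 : doubleSum s P φ B * P l = ∑ m ∈ s, φ l m • (P m * B * P l) := by
    rw [doubleSum, Finset.sum_mul]
    refine (Finset.sum_eq_single l (fun l' hl' hne ↦ ?_) fun h ↦ absurd hl h).trans ?_
    · rw [Finset.sum_mul]
      refine Finset.sum_eq_zero fun m _ ↦ ?_
      rw [smul_mul_assoc, mul_assoc, proj_mul_of_ne hSP hPS hl' hl hne, mul_zero, smul_zero]
    · rw [Finset.sum_mul]
      refine Finset.sum_congr rfl fun m _ ↦ ?_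
      rw [smul_mul_assoc, mul_assoc _ (P l), proj_mul_self hsum hSP hPS hl]
  rw [mul_assoc, h1, Finset.mul_sum]
  refine (Finset.sum_eq_single m (fun m' hm' hne ↦ ?_) fun h ↦ absurd hm h).trans ?_
  · rw [mul_smul_comm, ← mul_assoc, ← mul_assoc, proj_mul_of_ne hSP hPS hm hm' hne.symm, zero_mul,
      zero_mul, smul_zero]
  · rw [mul_smul_comm, ← mul_assoc, ← mul_assoc, proj_mul_self hsum hSP hPS hm]

include hsum in
theorem doubleSum_one (B : 𝒜) : doubleSum s P (fun _ _ ↦ 1) B = B := by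
  simp only [doubleSum, one_smul]
  simp only [← Finset.sum_mul, ← Finset.mul_sum, hsum, one_mul, mul_one]

include hsum hSP hPS in
/-- The identity behind the formula for Donaldson's functional along a geodesic. -/
theorem trace_doubleSum_identity (tr : 𝒜 →ₗ[ℂ] ℂ) (htr : ∀ x y, tr (x * y) = tr (y * x))
    {φ Ψ : ℂ → ℂ → ℂ} (h₁ : ∀ l ∈ s, ∀ m ∈ s, Ψ l m * (m - l) = φ l m - 1)
    (h₂ : ∀ l ∈ s, ∀ m ∈ s, Ψ l m + Ψ m l = φ l m * φ m l) (q B : 𝒜) :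
    tr ((q + doubleSum s P φ B) * (q + doubleSum s P φ B)) =
      tr (q * q) + 2 * (tr (q * B) + tr ((B + (q * S - S * q)) * doubleSum s P Ψ B)) := by
  set C := doubleSum s P φ B
  -- Both sides are expanded over tr(q P_m B P_l) and tr(B P_m B P_l). The first kind is matched by
  -- `h₁`, the second by `h₂` after symmetrization in `l` and `m`.
  have hqC : tr (q * C) = ∑ l ∈ s, ∑ m ∈ s, φ l m * tr (q * (P m * B * P l)) := by
    simp only [C, doubleSum, Finset.mul_sum, map_sum, mul_smul_comm, map_smul, smul_eq_mul]
  have hqB : tr (q * B) = ∑ l ∈ s, ∑ m ∈ s, tr (q * (P m * B * P l)) := by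
    conv_lhs => rw [← doubleSum_one hsum B]
    simp only [doubleSum, Finset.mul_sum, map_sum, one_smul]
  have hsymm (l m : ℂ) : tr (B * (P l * B * P m)) = tr (B * (P m * B * P l)) := by
    rw [← mul_assoc, ← mul_assoc, mul_assoc (B * P l), htr]
    simp only [mul_assoc]
  have hCC : tr (C * C) = ∑ l ∈ s, ∑ m ∈ s, φ l m * φ m l * tr (B * (P m * B * P l)) := by
    conv_lhs => arg 2; arg 1; rw [show C = doubleSum s P φ B from rfl, doubleSum]
    simp only [Finset.sum_mul, map_sum, smul_mul_assoc, map_smul, smul_eq_mul]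
    refine Finset.sum_congr rfl fun l hl ↦ Finset.sum_congr rfl fun m hm ↦ ?_
    have h : tr (P m * B * P l * C) = tr (B * (P l * C * P m)) := by
      rw [mul_assoc, mul_assoc, htr]
      simp only [mul_assoc]
    rw [h, proj_doubleSum_proj hsum hSP hPS φ B hm hl, mul_smul_comm, map_smul, smul_eq_mul, hsymm]
    ring
  have hΨ : tr ((B + (q * S - S * q)) * doubleSum s P Ψ B) = ∑ l ∈ s, ∑ m ∈ s,
      (Ψ l m * tr (B * (P m * B * P l)) + Ψ l m * (m - l) * tr (q * (P m * B * P l))) := by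
    simp only [doubleSum, Finset.mul_sum, map_sum, mul_smul_comm, map_smul, smul_eq_mul]
    refine Finset.sum_congr rfl fun l hl ↦ Finset.sum_congr rfl fun m hm ↦ ?_
    -- Against P_m B P_l the commutator with `S` acts as the scalar m - l, which produces the factor
    -- in `h₁`.
    have e1 : tr (q * S * (P m * B * P l)) = m * tr (q * (P m * B * P l)) := by
      rw [mul_assoc, ← mul_assoc S, ← mul_assoc S, hSP m hm]
      simp only [smul_mul_assoc, mul_smul_comm, map_smul, smul_eq_mul]
    have e2 : tr (S * q * (P m * B * P l)) = l * tr (q * (P m * B * P l)) := by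
      rw [mul_assoc, htr, mul_assoc, mul_assoc (P m * B), hPS l hl]
      simp only [mul_smul_comm, map_smul, smul_eq_mul]
    rw [add_mul, sub_mul, map_add, map_sub, e1, e2]
    ring
  -- The trace is symmetric in `l` and `m`, so only Ψ(l,m) + Ψ(m,l) matters.
  have hΨsymm : 2 * ∑ l ∈ s, ∑ m ∈ s, Ψ l m * tr (B * (P m * B * P l)) =
      ∑ l ∈ s, ∑ m ∈ s, φ l m * φ m l * tr (B * (P m * B * P l)) := by
    have e : ∑ l ∈ s, ∑ m ∈ s, Ψ l m * tr (B * (P m * B * P l)) =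
        ∑ l ∈ s, ∑ m ∈ s, Ψ m l * tr (B * (P m * B * P l)) := by
      rw [Finset.sum_comm]
      refine Finset.sum_congr rfl fun l _ ↦ Finset.sum_congr rfl fun m _ ↦ ?_
      rw [hsymm]
    rw [two_mul]
    conv_lhs => arg 2; rw [e]
    rw [← Finset.sum_add_distrib]
    refine Finset.sum_congr rfl fun l hl ↦ ?_
    rw [← Finset.sum_add_distrib]
    refine Finset.sum_congr rfl fun m hm ↦ ?_
    rw [← h₂ l hl m hm]
    ring
  have hφ : ∑ l ∈ s, ∑ m ∈ s, Ψ l m * (m - l) * tr (q * (P m * B * P l)) =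
      tr (q * C) - tr (q * B) := by
    rw [hqC, hqB, ← Finset.sum_sub_distrib]
    refine Finset.sum_congr rfl fun l hl ↦ ?_
    rw [← Finset.sum_sub_distrib]
    refine Finset.sum_congr rfl fun m hm ↦ ?_
    rw [h₁ l hl m hm]
    ring
  simp only [Finset.sum_add_distrib] at hΨ
  rw [hφ] at hΨ
  rw [hΨ, mul_add, add_mul, add_mul, map_add, map_add, map_add, htr C q, hCC, ← hΨsymm]
  ring

end Projections

/-! ### The forms ψ along the curve Ke^{ts} -/

section Exponential

variable {𝒜 : Type*} [NormedRing 𝒜] [NormedAlgebra ℂ 𝒜] [CompleteSpace 𝒜]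

theorem exp_mul_exp_neg (x : 𝒜) : NormedSpace.exp x * NormedSpace.exp (-x) = 1 := by
  let _ : NormedAlgebra ℚ 𝒜 := NormedAlgebra.restrictScalars ℚ ℂ 𝒜
  rw [← NormedSpace.exp_add_of_commute (Commute.neg_right (Commute.refl x)), add_neg_cancel,
    NormedSpace.exp_zero]

theorem exp_neg_mul_exp (x : 𝒜) : NormedSpace.exp (-x) * NormedSpace.exp x = 1 := by
  have h := exp_mul_exp_neg (-x)
  rwa [neg_neg] at h

theorem isUnit_exp_complex (x : 𝒜) : IsUnit (NormedSpace.exp x) :=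
  ⟨⟨_, _, exp_mul_exp_neg x, exp_neg_mul_exp x⟩, rfl⟩

theorem exp_mul_of_mul_eq_smul {S P : 𝒜} {l : ℂ} (h : S * P = l • P) :
    NormedSpace.exp S * P = Complex.exp l • P := by
  have hpow (k : ℕ) : S ^ k * P = l ^ k • P := by
    induction k with
    | zero => simp
    | succ k ih => rw [pow_succ, mul_assoc, h, mul_smul_comm, ih, smul_smul, pow_succ, mul_comm]
  have h1 := (NormedSpace.exp_series_hasSum_exp' (𝕂 := ℂ) S).mul_right P
  have h2 := (NormedSpace.exp_series_hasSum_exp' (𝕂 := ℂ) l).smul_const P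
  rw [← Complex.exp_eq_exp_ℂ] at h2
  simp only [smul_mul_assoc, hpow] at h1
  simp only [smul_assoc] at h2
  exact h1.unique h2

theorem mul_exp_of_mul_eq_smul {S P : 𝒜} {l : ℂ} (h : P * S = l • P) :
    P * NormedSpace.exp S = Complex.exp l • P := by
  have hpow (k : ℕ) : P * S ^ k = l ^ k • P := by
    induction k with
    | zero => simp
    | succ k ih => rw [pow_succ, ← mul_assoc, ih, smul_mul_assoc, h, smul_smul, pow_succ]
  have h1 := (NormedSpace.exp_series_hasSum_exp' (𝕂 := ℂ) S).mul_left P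
  have h2 := (NormedSpace.exp_series_hasSum_exp' (𝕂 := ℂ) l).smul_const P
  rw [← Complex.exp_eq_exp_ℂ] at h2
  simp only [mul_smul_comm, hpow] at h1
  simp only [smul_assoc] at h2
  exact h1.unique h2

/-- The function `(e^{t (m - l)} - 1) / (m - l)`, extended by `t` to the diagonal. -/
noncomputable def expQuotient (t : ℝ) (l m : ℂ) : ℂ :=
  open Classical in if l = m then t else (Complex.exp (t * (m - l)) - 1) / (m - l)

/-- The derivative is left as a product because e^{tS} P_m B P_l e^{-tS} carries exactly these two
eigenvalue factors. -/
theorem hasDerivAt_expQuotient (l m : ℂ) (t : ℝ) :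
    HasDerivAt (fun τ ↦ expQuotient τ l m) (Complex.exp (t * m) * Complex.exp (-(t * l))) t := by
  rw [← Complex.exp_add]
  by_cases h : l = m
  · subst h
    simp only [expQuotient, if_true, add_neg_cancel, Complex.exp_zero]
    exact (hasDerivAt_id t).ofReal_comp
  · simp only [expQuotient, if_neg h]
    have h0 : m - l ≠ 0 := sub_ne_zero.2 (Ne.symm h)
    have h1 : HasDerivAt (fun τ : ℝ ↦ (τ : ℂ) * (m - l)) (1 * (m - l)) t :=
      ((hasDerivAt_id t).ofReal_comp).mul_const _
    refine ((h1.cexp.sub_const 1).div_const (m - l)).congr_deriv ?_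
    rw [one_mul, mul_div_cancel_right₀ _ h0]
    congr 1
    ring

variable [StarRing 𝒜] [NormedStarGroup 𝒜] [StarModule ℂ 𝒜]
  {E : Type*} [NormedAddCommGroup E] [NormedSpace ℝ E] {U : Set E}

theorem contDiffOn_mul_exp {η₀ S : E → 𝒜} (hη : ContDiffOn ℝ ∞ η₀ U) (hS : ContDiffOn ℝ ∞ S U) :
    ContDiffOn ℝ ∞ (fun z : ℝ × E ↦ η₀ z.2 * NormedSpace.exp (z.1 • S z.2))
      (Icc (0 : ℝ) 1 ×ˢ U) := by
  have hexp : ContDiff ℝ ∞ (NormedSpace.exp : 𝒜 → 𝒜) :=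
    contDiff_iff_contDiffAt.2 fun x ↦ (NormedSpace.exp_analytic (𝕂 := ℝ) x).contDiffAt
  have h2 : ContDiffOn ℝ ∞ (fun z : ℝ × E ↦ z.2) (Icc (0 : ℝ) 1 ×ˢ U) := contDiff_snd.contDiffOn
  exact (hη.comp h2 fun _ hz ↦ hz.2).mul (hexp.comp_contDiffOn
    (contDiff_fst.contDiffOn.smul (hS.comp h2 fun _ hz ↦ hz.2)))

theorem timeDeriv_mul_exp {η₀ S : E → 𝒜} (hη : ContDiffOn ℝ ∞ η₀ U)
    (hS : ContDiffOn ℝ ∞ S U) {t : ℝ} (ht : t ∈ Icc (0 : ℝ) 1) {p : E} (hp : p ∈ U) :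
    η₀ p * NormedSpace.exp (t • S p) * S p =
      timeDeriv U (fun z : ℝ × E ↦ η₀ z.2 * NormedSpace.exp (z.1 • S z.2)) (t, p) := by
  have h1 := hasDerivWithinAt_time (contDiffOn_mul_exp hη hS) ht hp
  have h2 := ((hasDerivAt_exp_smul_const (𝕂 := ℝ) (S p) t).const_mul (η₀ p)).hasDerivWithinAt
    (s := Icc 0 1)
  rw [mul_assoc]
  exact (uniqueDiffOn_Icc (zero_lt_one' ℝ) t ht).eq_deriv _ h2 h1

/-- Along η₀e^{tS} the velocity is the constant `S`. Conjugation of -2ψ_t by e^{tS} absorbs the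
commutator in the variation formula, so the conjugate has derivative e^{tS}Be^{-tS} with B the
covariant derivative of `S`. Integrating over [0,1] in the eigenbasis of `S` gives the quotient
(e^{m-l}-1)/(m-l). -/
theorem exp_conj_selfAdjointForm (hU : IsOpen U) {η₀ S : E → 𝒜} {A : E → E →L[ℝ] 𝒜}
    (hη : ContDiffOn ℝ ∞ η₀ U) (hS : ContDiffOn ℝ ∞ S U) (hA : ContDiffOn ℝ ∞ A U)
    (hu : ∀ q ∈ U, IsUnit (η₀ q)) {p : E} (hp : p ∈ U) {s : Finset ℂ} {P : ℂ → 𝒜}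
    (hsum : ∑ l ∈ s, P l = 1) (hSP : ∀ l ∈ s, S p * P l = l • P l)
    (hPS : ∀ l ∈ s, P l * S p = l • P l) (u : E) {η₁ : E → 𝒜}
    (hη₁ : ∀ q ∈ U, η₁ q = η₀ q * NormedSpace.exp (S q)) :
    NormedSpace.exp (S p) * ((-2 : ℝ) • selfAdjointForm (η₁ p) (fderiv ℝ η₁ p) (A p) u) *
        NormedSpace.exp (-S p) =
      (-2 : ℝ) • selfAdjointForm (η₀ p) (fderiv ℝ η₀ p) (A p) u +
        doubleSum s P (expQuotient 1) (fderiv ℝ S p u + (A p u * S p - S p * A p u)) := by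
  set B := fderiv ℝ S p u + (A p u * S p - S p * A p u) with hB
  let η (z : ℝ × E) : 𝒜 := η₀ z.2 * NormedSpace.exp (z.1 • S z.2)
  have hηc : ContDiffOn ℝ ∞ η (Icc (0 : ℝ) 1 ×ˢ U) := contDiffOn_mul_exp hη hS
  have hηu : ∀ z ∈ Icc (0 : ℝ) 1 ×ˢ U, IsUnit (η z) := fun z hz ↦
    (hu z.2 hz.2).mul (isUnit_exp_complex _)
  let ψ (t : ℝ) : 𝒜 := selfAdjointForm (η (t, p)) (spaceDeriv U η (t, p)) (A p) u
  have hψ {t : ℝ} (ht : t ∈ Icc (0 : ℝ) 1) := hasDerivWithinAt_selfAdjointForm hU hηc hA hηu ht hp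
    (v := S) (fun q hq ↦ timeDeriv_mul_exp hη hS ht hq) u
  have hfd {t : ℝ} (ht : t ∈ Icc (0 : ℝ) 1) {η' : E → 𝒜} (h : ∀ q ∈ U, η' q = η (t, q)) :
      selfAdjointForm (η' p) (fderiv ℝ η' p) (A p) u = ψ t := by
    have h1 : η' =ᶠ[𝓝 p] fun q ↦ η (t, q) := Filter.eventually_of_mem (hU.mem_nhds hp) h
    rw [h1.fderiv_eq (𝕜 := ℝ), (hasFDerivAt_space hU hηc ht hp).fderiv, h p hp]
  rw [hfd (right_mem_Icc.2 zero_le_one) fun q hq ↦ by simp only [η, one_smul, hη₁ q hq],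
    hfd (left_mem_Icc.2 zero_le_one) (η' := η₀) fun q hq ↦ by
      simp only [η, zero_smul, NormedSpace.exp_zero, mul_one]]
  -- The difference of the conjugated form and the claimed integral; it has zero derivative, and at
  -- t = 0 the double sum vanishes.
  let g (t : ℝ) : 𝒜 := NormedSpace.exp (t • S p) * ((-2 : ℝ) • ψ t) *
    NormedSpace.exp (t • -S p) - doubleSum s P (expQuotient t) B
  have hg {t : ℝ} (ht : t ∈ Icc (0 : ℝ) 1) : HasDerivWithinAt g 0 (Icc 0 1) t := by
    have e1 := (hasDerivAt_exp_smul_const (𝕂 := ℝ) (S p) t).hasDerivWithinAt (s := Icc 0 1)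
    have e2 := (hasDerivAt_exp_smul_const' (𝕂 := ℝ) (-S p) t).hasDerivWithinAt (s := Icc 0 1)
    have e3 : HasDerivAt (fun τ ↦ doubleSum s P (expQuotient τ) B)
        (∑ l ∈ s, ∑ m ∈ s, (Complex.exp (t * m) * Complex.exp (-(t * l))) • (P m * B * P l)) t :=
      HasDerivAt.fun_sum fun l _ ↦ HasDerivAt.fun_sum fun m _ ↦
        (hasDerivAt_expQuotient l m t).smul_const _
    have e4 : ∑ l ∈ s, ∑ m ∈ s, (Complex.exp (t * m) * Complex.exp (-(t * l))) • (P m * B * P l) =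
        NormedSpace.exp (t • S p) * B * NormedSpace.exp (t • -S p) := by
      conv_rhs => rw [← doubleSum_one hsum B, doubleSum, Finset.mul_sum, Finset.sum_mul]
      refine Finset.sum_congr rfl fun l hl ↦ ?_
      rw [Finset.mul_sum, Finset.sum_mul]
      refine Finset.sum_congr rfl fun m hm ↦ ?_
      have f1 : NormedSpace.exp (t • S p) * P m = Complex.exp (t * m) • P m :=
        exp_mul_of_mul_eq_smul (by
          rw [smul_mul_assoc, hSP m hm, ← smul_assoc, Complex.real_smul])
      have f2 : P l * NormedSpace.exp (t • -S p) = Complex.exp (-(t * l)) • P l :=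
        mul_exp_of_mul_eq_smul (by
          rw [mul_smul_comm, mul_neg, hPS l hl, smul_neg, ← smul_assoc, Complex.real_smul, neg_smul])
      rw [one_smul, ← mul_assoc, ← mul_assoc, f1, mul_assoc _ (P l), f2]
      simp only [smul_mul_assoc, mul_smul_comm, smul_smul]
      rw [mul_comm]
    rw [e4] at e3
    refine (((e1.mul ((hψ ht).const_smul (-2 : ℝ))).mul e2).sub
      e3.hasDerivWithinAt).congr_deriv ?_
    have hz : (-2 : ℝ) • (-((1 / 2 : ℝ) • B) - (S p * ψ t - ψ t * S p)) =
        B - (S p * ((-2 : ℝ) • ψ t) - ((-2 : ℝ) • ψ t) * S p) := by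
      simp only [mul_smul_comm, smul_mul_assoc]
      module
    change (NormedSpace.exp (t • S p) * S p * ((-2 : ℝ) • ψ t) + NormedSpace.exp (t • S p) *
      ((-2 : ℝ) • (-((1 / 2 : ℝ) • B) - (S p * ψ t - ψ t * S p)))) * NormedSpace.exp (t • -S p) +
      NormedSpace.exp (t • S p) * ((-2 : ℝ) • ψ t) * (-S p * NormedSpace.exp (t • -S p)) -
      NormedSpace.exp (t • S p) * B * NormedSpace.exp (t • -S p) = 0
    rw [hz]
    noncomm_ring
  have hconst := constant_of_derivWithin_zero (f := g)
    (fun t ht ↦ (hg ht).differentiableWithinAt)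
    (fun t ht ↦ (hg (Ico_subset_Icc_self ht)).derivWithin
      (uniqueDiffOn_Icc (zero_lt_one' ℝ) t (Ico_subset_Icc_self ht))) 1
    (right_mem_Icc.2 zero_le_one)
  have hq0 : doubleSum s P (expQuotient 0) B = 0 :=
    Finset.sum_eq_zero fun l _ ↦ Finset.sum_eq_zero fun m _ ↦ by
      have : expQuotient 0 l m = 0 := by simp [expQuotient]
      rw [this, zero_smul]
  simp only [g, one_smul, zero_smul, NormedSpace.exp_zero, one_mul, mul_one, hq0, sub_zero]
    at hconst
  exact sub_eq_iff_eq_add.1 hconst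

end Exponential

/-! ### The two functional equations of Ψ -/

section TwoVariables

theorem Psi_mul_sub (a b : ℝ) :
    (Psi a b : ℂ) * ((b : ℂ) - a) = expQuotient 1 a b - 1 := by
  by_cases h : a = b
  · simp [h, expQuotient]
  · have h0 : (b : ℂ) - a ≠ 0 := by
      rw [sub_ne_zero]
      exact_mod_cast Ne.symm h
    have h1 : (a : ℂ) ≠ b := by exact_mod_cast h
    simp only [Psi, expQuotient, if_neg h, if_neg h1]
    push_cast
    field_simp
    ring_nf

/-- With d = b - a both sides equal (e^d + e^{-d} - 2)/d², and both are 1 on the diagonal. -/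
theorem Psi_add_Psi (a b : ℝ) :
    (Psi a b : ℂ) + Psi b a = expQuotient 1 a b * expQuotient 1 b a := by
  by_cases h : a = b
  · simp [h, Psi, expQuotient]
    norm_num
  · have h0 : (b : ℂ) - a ≠ 0 := by
      rw [sub_ne_zero]
      exact_mod_cast Ne.symm h
    have h0' : (a : ℂ) - b ≠ 0 := by
      rw [sub_ne_zero]
      exact_mod_cast h
    have h1 : (a : ℂ) ≠ b := by exact_mod_cast h
    have he : Complex.exp (b - a) * Complex.exp (a - b) = 1 := by
      rw [← Complex.exp_add]
      simp
    simp only [Psi, expQuotient, if_neg h, if_neg h1, if_neg (Ne.symm h), if_neg (Ne.symm h1)]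
    push_cast
    rw [one_mul, one_mul]
    have h2 : (a : ℂ) - b = -(b - a) := by ring
    have h3 : ((a : ℂ) - b) ^ 2 = (b - a) ^ 2 := by ring
    rw [h3, ← add_div, div_mul_div_comm, div_eq_div_iff (pow_ne_zero 2 h0) (mul_ne_zero h0 h0')]
    linear_combination -((b : ℂ) - a) ^ 2 * he

end TwoVariables

/-! ### The adjoint of the covariant derivative of a self-adjoint endomorphism -/

section Adjoint

variable {E : Type*} [NormedAddCommGroup E] [NormedSpace ℝ E]
  {𝒜 : Type*} [NormedRing 𝒜] [NormedAlgebra ℂ 𝒜] [StarRing 𝒜] [NormedStarGroup 𝒜]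
  [StarModule ℂ 𝒜]

/-- The adjoint of the covariant derivative of a self-adjoint endomorphism. -/
theorem star_endDeriv_mul {η S : E → 𝒜} {η' S' A : E →L[ℝ] 𝒜} {p : E}
    (hη : HasFDerivAt η η' p) (hS : HasFDerivAt S S' p) (hu : IsUnit (η p))
    (hsa : ∀ᶠ q in 𝓝 p, star (S q) * η q = η q * S q) (u : E) :
    star (S' u + (A u * S p - S p * A u)) * η p =
      η p * ((S' u + (A u * S p - S p * A u)) +
        ((-2 : ℝ) • selfAdjointForm (η p) η' A u * S p -
          S p * ((-2 : ℝ) • selfAdjointForm (η p) η' A u))) := by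
  set q := (-2 : ℝ) • selfAdjointForm (η p) η' A u with hq
  have h0 := hsa.self_of_nhds
  have hηq : η p * q = η' u - star (A u) * η p - η p * A u := by
    rw [hq, mul_smul_comm, mul_selfAdjointForm hu]
    change (-2 : ℝ) • -((1 / 2 : ℝ) • (η' u - star (A u) * η p - η p * A u)) = _
    module
  have h1 := ((starReal 𝒜).hasFDerivAt.comp p hS).mul' hη
  have h2 := hη.mul' hS
  have h3 := h1.unique (h2.congr_of_eventuallyEq hsa)
  have h4 : star (S p) * η' u + star (S' u) * η p = η p * S' u + η' u * S p :=
    congrArg (fun L : E →L[ℝ] 𝒜 ↦ L u) h3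
  have h5 : η' u = η p * q + star (A u) * η p + η p * A u := by
    rw [hηq]
    abel
  rw [h5] at h4
  simp only [star_add, star_sub, star_mul, mul_add, add_mul, mul_sub, sub_mul] at h4 ⊢
  have h6 (T : 𝒜) : star (S p) * (η p * T) = η p * (S p * T) := by
    rw [← mul_assoc, h0, mul_assoc]
  simp only [mul_assoc, h0, h6] at h4 ⊢
  linear_combination (norm := abel) h4

end Adjoint

/-! ### The pointwise formula for ⟨Ψ(s)(Ds), Ds⟩ -/

section Pointwise

variable {E : Type*} [NormedAddCommGroup E] [NormedSpace ℂ E] [FiniteDimensional ℂ E]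
  {X : Type*} [TopologicalSpace X] [ChartedSpace E X] [IsManifold 𝓘(ℂ, E) ω X]
  {F : Type*} [NormedAddCommGroup F] [NormedSpace ℂ F] [FiniteDimensional ℂ F]
  {V : X → Type*} [TopologicalSpace (TotalSpace F V)] [∀ x, AddCommGroup (V x)]
  [∀ x, Module ℂ (V x)] [∀ x, TopologicalSpace (V x)]
  [∀ x, IsTopologicalAddGroup (V x)] [∀ x, ContinuousSMul ℝ (V x)]
  [FiberBundle F V] [VectorBundle ℂ F V]
  {K L : HermitianMetric E F V} (D : Connection E F V) {s : ∀ x, Module.End ℂ (V x)}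

theorem endInner_eq_trace (K : HermitianMetric E F V) (x : X) (A : Module.End ℂ (V x))
    {B B' : Module.End ℂ (V x)} (h : ∀ u w, K.toFun x (B u) w = K.toFun x u (B' w)) :
    endInner K x A B = LinearMap.trace ℂ (V x) (B' * A) := by
  have : FiniteDimensional ℂ (V x) := finiteDimensional_fiber F x
  rw [trace_eq_sum_onBasis (K.core x)]
  exact Finset.sum_congr rfl fun i _ ↦ h _ _

namespace LocalFrame

variable {x₀ : X} (fr : LocalFrame E F V x₀)

theorem push_pow {y : X} (hy : y ∈ fr.nhd) (S : Module.End ℂ (V y)) (k : ℕ) :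
    fr.push y (S ^ k) = fr.push y S ^ k := by
  induction k with
  | zero => rw [pow_zero, pow_zero, push_one hy]
  | succ k ih => rw [pow_succ, pow_succ, push_mul hy, ih]

theorem metric_apply_sec {y : X} (hy : y ∈ fr.nhd) (B : V y →ₗ⋆[ℂ] V y →ₗ[ℂ] ℂ)
    (S : Module.End ℂ (V y)) (f g : ModelFiber F) :
    B (fr.sec y f) (S (fr.sec y g)) = inner ℂ f ((fr.formMatrix y B * fr.push y S) g) := by
  change _ = inner ℂ f (fr.formMatrix y B (fr.push y S g))
  rw [inner_formMatrix, push_apply, fr.sec_coord y hy]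

theorem star_push_mul {y : X} (hy : y ∈ fr.nhd) (B : V y →ₗ⋆[ℂ] V y →ₗ[ℂ] ℂ)
    {S T : Module.End ℂ (V y)} (h : ∀ u w, B (S u) w = B u (T w)) :
    star (fr.push y S) * fr.formMatrix y B = fr.formMatrix y B * fr.push y T := by
  refine ModelEnd.ext_inner fun f g ↦ ?_
  rw [← fr.metric_apply_sec hy, ← h]
  change inner ℂ f (star (fr.push y S) (fr.formMatrix y B g)) = _
  rw [ContinuousLinearMap.star_eq_adjoint, ContinuousLinearMap.adjoint_inner_right,
    inner_formMatrix, push_apply, fr.sec_coord y hy]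

theorem apply_eq_of_star_push_mul {y : X} (hy : y ∈ fr.nhd) (B : V y →ₗ⋆[ℂ] V y →ₗ[ℂ] ℂ)
    {S T : Module.End ℂ (V y)}
    (h : star (fr.push y S) * fr.formMatrix y B = fr.formMatrix y B * fr.push y T) (u w : V y) :
    B (S u) w = B u (T w) := by
  have h1 := congrArg (fun R : ModelEnd F ↦ inner ℂ (fr.coord y u) (R (fr.coord y w))) h
  beta_reduce at h1
  rw [← fr.metric_apply_sec hy, fr.sec_coord y hy, fr.sec_coord y hy] at h1
  rw [← h1]
  change _ = inner ℂ (fr.coord y u) (star (fr.push y S) (fr.formMatrix y B (fr.coord y w)))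
  rw [ContinuousLinearMap.star_eq_adjoint, ContinuousLinearMap.adjoint_inner_right,
    inner_formMatrix, push_apply, fr.sec_coord y hy, fr.sec_coord y hy, fr.sec_coord y hy]

theorem localMetric_center (H : HermitianMetric E F V) :
    fr.localMetric H (chartAt E x₀ x₀) = fr.formMatrix x₀ (H.toFun x₀) := by
  have h (y : X) (hy : y = x₀) : fr.formMatrix y (H.toFun y) = fr.formMatrix x₀ (H.toFun x₀) := by
    subst hy
    rfl
  exact h _ symm_chart_center

/-- The exponential series for L = Ke^s, tested on frame vectors, is the image of the matrix
exponential series under a continuous functional; s stands in the linear variable, which is harmless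
for self-adjoint s. -/
theorem localMetric_eq_mul_exp
    (hL : ∀ x u w, HasSum (fun k : ℕ ↦ ((k.factorial : ℂ)⁻¹) * K.toFun x u ((s x ^ k) w))
      (L.toFun x u w)) {p : E} (hp : p ∈ fr.dom) :
    fr.localMetric L p = fr.localMetric K p * NormedSpace.exp (fr.localEnd s p) := by
  refine ModelEnd.ext_inner fun f g ↦ ?_
  rw [inner_localMetric]
  have h1 := hL ((chartAt E x₀).symm p) (fr.sec _ f) (fr.sec _ g)
  simp only [fr.metric_apply_sec hp.2, fr.push_pow hp.2] at h1
  let Φ : ModelEnd F →L[ℂ] ℂ := ((innerSL ℂ f).comp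
    (ContinuousLinearMap.apply ℂ (ModelFiber F) g)).comp
    (ContinuousLinearMap.mul ℂ (ModelEnd F) (fr.localMetric K p))
  have h2 := (NormedSpace.exp_series_hasSum_exp' (𝕂 := ℂ) (fr.localEnd s p)).mapL Φ
  simp only [map_smul] at h2
  exact h1.unique h2

theorem push_applyTwoVar {y : X} (hy : y ∈ fr.nhd) (Φ : ℝ → ℝ → ℝ) (A B : Module.End ℂ (V y)) :
    fr.push y (applyTwoVar Φ A B) = doubleSum (eigenvalueSet A)
      (fun l ↦ fr.push y (eigenProj A l)) (fun l m ↦ (Φ l.re m.re : ℂ)) (fr.push y B) := by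
  simp only [applyTwoVar, doubleSum, map_sum, map_smul, push_mul hy]

/-- Conjugation by e^s does not change the trace of a square, so 4tr(ψ_L²) = tr((q_K + φ(s)(Ds))²).
The trace identity expands this, and Ds + [q_K,s] is the K-adjoint of Ds, which makes its last term
the inner product with Ψ(s)(Ds). -/
theorem trace_potential_sq (fr : LocalFrame E F V x₀) (hs : IsSmoothEnd E F s) (hsK : ∀ x, K.IsSelfAdjointAt x (s x))
    (hL : ∀ x u w, HasSum (fun k : ℕ ↦ ((k.factorial : ℂ)⁻¹) * K.toFun x u ((s x ^ k) w))
      (L.toFun x u w)) (u : E) :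
    2 * LinearMap.trace ℂ (V x₀) (D.psi L x₀ u * D.psi L x₀ u) =
      2 * LinearMap.trace ℂ (V x₀) (D.psi K x₀ u * D.psi K x₀ u) -
      2 * LinearMap.trace ℂ (V x₀) (D.psi K x₀ u * D.endDeriv s x₀ u) +
      endInner K x₀ (applyTwoVar Psi (s x₀) (D.endDeriv s x₀ u)) (D.endDeriv s x₀ u) := by
  have hfd : FiniteDimensional ℂ (V x₀) := finiteDimensional_fiber F x₀
  have hy := fr.mem_nhd
  have hdom := fr.isOpen_dom.mem_nhds fr.mem_dom
  have hS := fr.contDiffOn_localEnd hs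
  have hSd : DifferentiableAt ℝ (fr.localEnd s) (chartAt E x₀ x₀) :=
    (hS.contDiffAt hdom).differentiableAt (by simp)
  have hηd : DifferentiableAt ℝ (fr.localMetric K) (chartAt E x₀ x₀) :=
    ((fr.contDiffOn_localMetric K).contDiffAt hdom).differentiableAt (by simp)
  set p := chartAt E x₀ x₀ with hp
  set B := fderiv ℝ (fr.localEnd s) p u +
    (fr.conn D p u * fr.localEnd s p - fr.localEnd s p * fr.conn D p u) with hB
  have hBe : D.endDeriv s x₀ u = fr.lift x₀ B := fr.endDeriv_center D hSd u
  have hSp : fr.localEnd s p = fr.push x₀ (s x₀) := fr.localEnd_center s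
  have hsq : Squarefree (minpoly ℂ (s x₀)) :=
    minpoly_squarefree_of_selfAdjoint (c := K.core x₀) (hsK x₀)
  have hre {l : ℂ} (hl : l ∈ eigenvalueSet (s x₀)) : (l.re : ℂ) = l :=
    ofReal_re_of_mem_eigenvalueSet (c := K.core x₀) (hsK x₀) hl
  let P (l : ℂ) : ModelEnd F := fr.push x₀ (eigenProj (s x₀) l)
  have hsum : ∑ l ∈ eigenvalueSet (s x₀), P l = 1 := by
    rw [← map_sum, sum_eigenProj, push_one hy]
  have hSP : ∀ l ∈ eigenvalueSet (s x₀), fr.localEnd s p * P l = l • P l := fun l hl ↦ by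
    rw [hSp, ← push_mul hy, mul_eigenProj hsq hl, map_smul]
  have hPS : ∀ l ∈ eigenvalueSet (s x₀), P l * fr.localEnd s p = l • P l := fun l hl ↦ by
    rw [hSp, ← push_mul hy, eigenProj_mul hsq hl, map_smul]
  have hconj := exp_conj_selfAdjointForm fr.isOpen_dom (fr.contDiffOn_localMetric K) hS
    (fr.contDiffOn_conn D) (fun q hq ↦ fr.isUnit_localMetric K hq) fr.mem_dom hsum hSP hPS u
    (fun q hq ↦ fr.localMetric_eq_mul_exp hL hq)
  have hadj := star_endDeriv_mul (A := fr.conn D p) hηd.hasFDerivAt hSd.hasFDerivAt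
    (fr.isUnit_localMetric K fr.mem_dom) (Filter.eventually_of_mem hdom fun q hq ↦
      fr.star_push_mul hq.2 _ (hsK _)) u
  change NormedSpace.exp (fr.localEnd s p) * ((-2 : ℝ) • fr.potential D L p u) *
    NormedSpace.exp (-fr.localEnd s p) = (-2 : ℝ) • fr.potential D K p u + _ at hconj
  change _ = fr.localMetric K p * (B + ((-2 : ℝ) • fr.potential D K p u * fr.localEnd s p -
    fr.localEnd s p * ((-2 : ℝ) • fr.potential D K p u))) at hadj
  set q := (-2 : ℝ) • fr.potential D K p u with hq
  let tr : ModelEnd F →ₗ[ℂ] ℂ :=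
    (LinearMap.trace ℂ (ModelFiber F)) ∘ₗ (ContinuousLinearMap.coeLM ℂ)
  have htr (T : ModelEnd F) : tr T = modelTrace F T := rfl
  have key := trace_doubleSum_identity hsum hSP hPS tr modelTrace_mul_comm
    (φ := expQuotient 1) (Ψ := fun l m ↦ (Psi l.re m.re : ℂ))
    (fun l hl m hm ↦ by
      have h := Psi_mul_sub l.re m.re
      rwa [hre hl, hre hm] at h)
    (fun l hl m hm ↦ by
      have h := Psi_add_Psi l.re m.re
      rwa [hre hl, hre hm] at h) q B
  rw [← hconj] at key
  simp only [htr] at key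
  have e1 : modelTrace F (NormedSpace.exp (fr.localEnd s p) *
      ((-2 : ℝ) • fr.potential D L p u) * NormedSpace.exp (-fr.localEnd s p) *
      (NormedSpace.exp (fr.localEnd s p) * ((-2 : ℝ) • fr.potential D L p u) *
      NormedSpace.exp (-fr.localEnd s p))) =
      4 * modelTrace F (fr.potential D L p u * fr.potential D L p u) := by
    have e (T : ModelEnd F) : NormedSpace.exp (fr.localEnd s p) * T *
        NormedSpace.exp (-fr.localEnd s p) * (NormedSpace.exp (fr.localEnd s p) * T *
        NormedSpace.exp (-fr.localEnd s p)) = NormedSpace.exp (fr.localEnd s p) * (T * T *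
        NormedSpace.exp (-fr.localEnd s p)) := by
      simp only [mul_assoc]
      rw [← mul_assoc (NormedSpace.exp (-fr.localEnd s p)), exp_neg_mul_exp, one_mul]
    rw [e, modelTrace_mul_comm, mul_assoc, exp_neg_mul_exp, mul_one]
    simp only [smul_mul_assoc, mul_smul_comm, map_smul, Complex.real_smul]
    push_cast
    ring
  have e2 : endInner K x₀ (applyTwoVar Psi (s x₀) (D.endDeriv s x₀ u)) (D.endDeriv s x₀ u) =
      modelTrace F ((B + (q * fr.localEnd s p - fr.localEnd s p * q)) *
        doubleSum (eigenvalueSet (s x₀)) P (fun l m ↦ (Psi l.re m.re : ℂ)) B) := by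
    rw [endInner_eq_trace K x₀ _ (B' := fr.lift x₀ (B + (q * fr.localEnd s p -
      fr.localEnd s p * q))), fr.trace_lift_mul hy, fr.push_applyTwoVar hy, hBe, push_lift hy]
    refine fr.apply_eq_of_star_push_mul hy _ ?_
    rw [hBe, push_lift hy, push_lift hy, ← fr.localMetric_center K]
    exact hadj
  rw [e2, fr.psi_center D L, fr.psi_center D K, hBe, fr.trace_lift_mul hy, fr.trace_lift_mul hy,
    fr.trace_lift_mul hy, push_lift hy, push_lift hy, push_lift hy]
  rw [e1] at key
  have e3 : modelTrace F (q * q) =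
      4 * modelTrace F (fr.potential D K p u * fr.potential D K p u) := by
    simp only [hq, smul_mul_assoc, mul_smul_comm, map_smul, Complex.real_smul]
    push_cast
    ring
  have e4 : modelTrace F (q * B) = -2 * modelTrace F (fr.potential D K p u * B) := by
    simp only [hq, smul_mul_assoc, map_smul, Complex.real_smul]
    push_cast
    ring
  rw [e3, e4] at key
  linear_combination (1 / 2) * key

end LocalFrame

variable [T2Space X] [ContMDiffVectorBundle ∞ F V 𝓘(ℝ, E)] (κ : KahlerForm E X)

theorem psiEnergy_eq (hs : IsSmoothEnd E F s) (hsK : ∀ x, K.IsSelfAdjointAt x (s x))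
    (hL : ∀ x u w, HasSum (fun k : ℕ ↦ ((k.factorial : ℂ)⁻¹) * K.toFun x u ((s x ^ k) w))
      (L.toFun x u w)) (x : X) :
    psiEnergy κ D K s x = 2 * potentialEnergy D L κ x - 2 * potentialEnergy D K κ x +
      2 * traceDeriv D K κ s x := by
  obtain ⟨fr⟩ := LocalFrame.exists (E := E) (F := F) (V := V) x
  simp only [psiEnergy, potentialEnergy, traceDeriv, Finset.mul_sum]
  rw [← Finset.sum_sub_distrib, ← Finset.sum_add_distrib]
  refine Finset.sum_congr rfl fun a _ ↦ ?_
  have h := LocalFrame.trace_potential_sq D fr hs hsK hL (κ.frameVec x a)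
  have h' : 2 * LinearMap.trace ℂ (V x) (D.psi L x (κ.frame x a) * D.psi L x (κ.frame x a)) =
      2 * LinearMap.trace ℂ (V x) (D.psi K x (κ.frame x a) * D.psi K x (κ.frame x a)) -
      2 * LinearMap.trace ℂ (V x) (D.psi K x (κ.frame x a) * D.endDeriv s x (κ.frame x a)) +
      endInner K x (applyTwoVar Psi (s x) (D.endDeriv s x (κ.frame x a)))
        (D.endDeriv s x (κ.frame x a)) := h
  linear_combination -h'

end Pointwise

end NHYM

theorem proposition3p2
    {E : Type*} [NormedAddCommGroup E] [NormedSpace ℂ E] [FiniteDimensional ℂ E]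
    [MeasurableSpace E] [BorelSpace E]
    {X : Type*} [TopologicalSpace X] [ChartedSpace E X] [IsManifold 𝓘(ℂ, E) ω X]
    [CompactSpace X] [T2Space X] [MeasurableSpace X] [BorelSpace X]
    {F : Type*} [NormedAddCommGroup F] [NormedSpace ℂ F] [FiniteDimensional ℂ F]
    {V : X → Type*} [TopologicalSpace (TotalSpace F V)] [∀ x, AddCommGroup (V x)]
    [∀ x, Module ℂ (V x)] [∀ x, TopologicalSpace (V x)]
    [∀ x, IsTopologicalAddGroup (V x)] [∀ x, ContinuousSMul ℝ (V x)]
    [FiberBundle F V] [VectorBundle ℂ F V] [ContMDiffVectorBundle ∞ F V 𝓘(ℝ, E)]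
    (κ : NHYM.KahlerForm E X) (D : NHYM.Connection E F V) (hD : D.IsNHYM κ)
    (K L : NHYM.HermitianMetric E F V)
    (s : ∀ x, Module.End ℂ (V x)) (hs : NHYM.IsSmoothEnd E F s)
    (hsK : ∀ x, K.IsSelfAdjointAt x (s x))
    (hL : ∀ x u w, HasSum (fun k : ℕ ↦ ((k.factorial : ℂ)⁻¹) * K.toFun x u ((s x ^ k) w))
      (L.toFun x u w)) :
    Integrable (NHYM.curvatureTrace κ D K s) κ.vol ∧
    Integrable (NHYM.psiEnergy κ D K s) κ.vol ∧
    ∀ γ : NHYM.MetricPath K L,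
      (∀ t ∈ Icc (0 : ℝ) 1,
        Integrable (NHYM.curvatureTrace κ D (γ.toFun t) (γ.velocity t)) κ.vol) ∧
      IntervalIntegrable
        (fun t ↦ ∫ x, NHYM.curvatureTrace κ D (γ.toFun t) (γ.velocity t) x ∂κ.vol) volume 0 1 ∧
      NHYM.donaldson κ D γ =
        ∫ x, NHYM.curvatureTrace κ D K s x ∂κ.vol + ∫ x, NHYM.psiEnergy κ D K s x ∂κ.vol := by
  have hc := NHYM.continuous_traceDeriv D K κ hs.isC1End
  obtain ⟨h1, h2⟩ := NHYM.integral_curvatureTrace D K κ hD hs.isC1End hc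
  have hi := κ.integrable_of_continuous hc
  have hψ : NHYM.psiEnergy κ D K s = fun x ↦ 2 * NHYM.potentialEnergy D L κ x -
      2 * NHYM.potentialEnergy D K κ x + 2 * NHYM.traceDeriv D K κ s x :=
    funext (NHYM.psiEnergy_eq D κ hs hsK hL)
  have hE : Integrable (fun x ↦ 2 * NHYM.potentialEnergy D L κ x -
      2 * NHYM.potentialEnergy D K κ x) κ.vol :=
    ((κ.integrable_of_continuous (NHYM.continuous_potentialEnergy D L κ)).const_mul 2).sub
      ((κ.integrable_of_continuous (NHYM.continuous_potentialEnergy D K κ)).const_mul 2)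
  refine ⟨h1, hψ ▸ hE.add (hi.const_mul 2), fun γ ↦
    ⟨fun t ht ↦ (NHYM.integrable_curvatureTrace_path γ D κ hD ht).1,
      NHYM.intervalIntegrable_curvatureTrace_path γ D κ hD, ?_⟩⟩
  -- The first-order term occurs with factor -2 in the curvature integral and +2 in the Ψ-integral;
  -- what remains is twice the difference of energies.
  rw [NHYM.donaldson_eq γ D κ hD, h2, hψ, integral_add hE (hi.const_mul 2), integral_const_mul]
  ring
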